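/- Let $n\ge 1$, $\alpha>0$, and let $(X_t)_{t\ge 0}$ be an Ornstein--Uhlenbeck process in $\mathbb{R}^n$ with target measure $\nu=\mathcal N(0,\frac1\alpha I)$, that is, a solution of $dX_t=-\alpha X_t\,dt+\sqrt2\,dW_t$ with $W$ a standard Brownian motion independent of $X_0$; in particular, for each $t>0$, $X_t=e^{-\alpha t}X_0+\sqrt{(1-e^{-2\alpha t})/\alpha}\;Z$ with $Z\sim\mathcal N(0,I)$ independent of $X_0$. Suppose that $X_0$ has a probability density $\rho_0$ with finite fourth central moment $M=\mathbb E\big[\|X_0-\mathbb E X_0\|^4\big]<\infty$ and finite Fisher information $J=\int_{\mathbb R^n}\rho_0(x)\,\|\nabla\log\rho_0(x)\|^2\,dx<\infty$ (where $\nabla\log\rho_0=\nabla\rho_0/\rho_0$ with $\nabla\rho_0$ the weak gradient, and $J=\infty$ if $\rho_0$ has no weak gradient). Then the mutual information $t\mapsto I(X_0;X_t)$ is finite and convex on the interval of all $$t\;\ge\;\frac{1}{2\alpha}\log\!\left(1+\frac{\alpha MJ}{n^2}+\frac13\Big(1-\frac{\alpha MJ}{n^2}+\frac{\alpha^2M}{n}\Big)^2\right).$$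 -/

import Mathlib

open MeasureTheory ProbabilityTheory Set
open scoped ENNReal NNReal

/-- `X = (X_t)_{t ≥ 0}` is an Ornstein-Uhlenbeck process in `E` with target measure `N(0, α⁻¹ I)`,
i.e. a (weak) solution of `dX = -α X dt + √2 dW`, described by its law: it has continuous paths and
for all `0 ≤ s < t` it satisfies `X_t = e^{-α(t-s)} X_s + √((1 - e^{-2α(t-s)})/α) Z`, where
`Z ∼ N(0, I)` is independent of the past `(X_u)_{0 ≤ u ≤ s}`. The law of `X_0` is arbitrary. -/
structure IsOUProcess {Ω E : Type*} [MeasurableSpace Ω] [NormedAddCommGroup E]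
    [InnerProductSpace ℝ E] [FiniteDimensional ℝ E] [MeasurableSpace E] [BorelSpace E]
    (α : ℝ) (X : ℝ → Ω → E) (P : Measure Ω) : Prop where
  measurable : ∀ t, 0 ≤ t → Measurable (X t)
  continuous_paths : ∀ᵐ ω ∂P, ContinuousOn (fun t => X t ω) (Ici 0)
  exists_innovation : ∀ s t, 0 ≤ s → s < t → ∃ Z : Ω → E,
    HasLaw Z (stdGaussian E) P ∧
    IndepFun (fun ω (u : Icc 0 s) => X u ω) Z P ∧
    ∀ᵐ ω ∂P, X t ω = Real.exp (-α * (t - s)) • X s ω +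
      Real.sqrt ((1 - Real.exp (-2 * α * (t - s))) / α) • Z ω

/-- Mutual information `I(X;Y)`: the relative entropy (Kullback-Leibler divergence) of the joint law
of `(X, Y)` with respect to the product of the marginal laws, a value in `[0, ∞]`. -/
noncomputable def mutualInfo {Ω E F : Type*} [MeasurableSpace Ω] [MeasurableSpace E]
    [MeasurableSpace F] (X : Ω → E) (Y : Ω → F) (P : Measure Ω) : ℝ≥0∞ :=
  InformationTheory.klDiv (P.map (fun ω => (X ω, Y ω))) ((P.map X).prod (P.map Y))

/-- The fourth central moment `E ‖X - μ‖⁴`, `μ = E X`, a value in `[0, ∞]`. (If `X` is not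
integrable then this is `∞`, whatever the value of the Bochner integral.) -/
noncomputable def fourthCentralMoment {Ω E : Type*} [MeasurableSpace Ω] [NormedAddCommGroup E]
    [NormedSpace ℝ E] (X : Ω → E) (P : Measure Ω) : ℝ≥0∞ :=
  ∫⁻ ω, ‖X ω - ∫ ω', X ω' ∂P‖ₑ ^ 4 ∂P

/-- `g` is a weak (distributional) gradient of `f`, tested against smooth compactly supported
functions. -/
structure HasWeakGradient {E : Type*} [NormedAddCommGroup E] [InnerProductSpace ℝ E]
    [FiniteDimensional ℝ E] [MeasurableSpace E] [BorelSpace E]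
    (f : E → ℝ) (g : E → E) : Prop where
  locallyIntegrable : LocallyIntegrable f
  locallyIntegrable_grad : LocallyIntegrable g
  integral_eq : ∀ φ : E → ℝ, ContDiff ℝ (⊤ : ℕ∞) φ → HasCompactSupport φ →
    ∫ x, f x • gradient φ x = -∫ x, φ x • g x

/-- The Fisher information `J(ρ) = ∫ ρ ‖∇ log ρ‖² dx = ∫ ρ ‖ρ⁻¹ ∇ρ‖² dx` of a probability density
`ρ`, with `∇ρ` the weak gradient. As this gradient is unique almost everywhere, the infimum is over
at most one value; it is `∞` if `ρ` has no weak gradient. -/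
noncomputable def fisherInfo {E : Type*} [NormedAddCommGroup E] [InnerProductSpace ℝ E]
    [FiniteDimensional ℝ E] [MeasurableSpace E] [BorelSpace E] (ρ : E → ℝ) : ℝ≥0∞ :=
  ⨅ (g : E → E) (_ : HasWeakGradient ρ g), ∫⁻ x, ENNReal.ofReal (ρ x * ‖(ρ x)⁻¹ • g x‖ ^ 2)

set_option linter.unusedSectionVars false

/-! Up to an invertible scaling, X_t is the output Y = l X_0 + √l Z of a Gaussian channel with
signal-to-noise ratio l = α / (exp(2αt) - 1), so the mutual information is a function I(l). The
I-MMSE relation I'(l) = mmse(l) / 2 (`hasDerivAt_channelInfo`) and dl/dt = -2 l (l + α)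
(`hasDerivAt_snr`) give dI/dt = -mmse(l) l (l + α). As l decreases in t, convexity in t means that
mmse(l) l (l + α) increases with l.

Two bounds settle this. First, mmse falls at rate at most M: minus its derivative is the mean
squared Hilbert-Schmidt norm of the posterior covariance, which the fourth central moment controls
(`sum_sq_cov_le`, `mmse_sub`). Second, the van Trees inequality gives mmse(l) ≥ n² / (J + n l)
(`sq_card_le_mul_mmse`). So it suffices that M l (l + α) (J + n l) ≤ n² (2 l + α). With u = exp(2αt)
- 1 this is a cubic inequality in u, which the stated threshold implies (`threshold_inequality`).

Both derivative formulas come from one device. Relative to N(0, l I) the output has density q_l(y) =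
∫ exp(⟨x, y⟩ - l ‖x‖² / 2) dμ(x), and q, like every unnormalised posterior moment, solves the
backward heat equation (∂_l + Δ/2) f = 0. In Dynkin's formula (`integral_mul_gaussKernel_sub`) for a
nonlinear function of such solutions only the terms quadratic in first derivatives survive: q log q
yields half the mean squared norm of the posterior mean, and (moment)² / q yields squared posterior
covariances. The formulas are used in integrated form, so mmse need only be Lipschitz, never
differentiated.

The van Trees inequality integrates the posterior by parts against a density that has only a weak
gradient. The Fisher information does not see the zero set of ρ, so recovering the gradient as ρ
times the score requires that it vanish there almost everywhere (`HasWeakGradient.ae_eq_zero`). -/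

namespace GaussianChannel

open Filter Topology
open scoped RealInnerProductSpace

/-! ### Unnormalised posterior moments and their derivatives -/

section Weights

variable {E : Type*} [NormedAddCommGroup E] [InnerProductSpace ℝ E] [FiniteDimensional ℝ E]
  [MeasurableSpace E] [BorelSpace E]

/-- Measurable functions of at most exponential growth. -/
structure ExpGrowth (ψ : E → ℝ) : Prop where
  measurable : Measurable ψ
  bound : ∃ C k, 0 ≤ C ∧ 0 ≤ k ∧ ∀ x, |ψ x| ≤ C * Real.exp (k * ‖x‖)

namespace ExpGrowth

lemma mul {ψ θ : E → ℝ} (hψ : ExpGrowth ψ) (hθ : ExpGrowth θ) :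
    ExpGrowth (fun x => ψ x * θ x) := by
  obtain ⟨C, k, hC, hk, h⟩ := hψ.bound
  obtain ⟨C', k', hC', hk', h'⟩ := hθ.bound
  refine ⟨hψ.measurable.mul hθ.measurable, C * C', k + k', by positivity, by positivity, ?_⟩
  intro x
  rw [abs_mul, add_mul, Real.exp_add]
  calc |ψ x| * |θ x| ≤ (C * Real.exp (k * ‖x‖)) * (C' * Real.exp (k' * ‖x‖)) :=
        mul_le_mul (h x) (h' x) (abs_nonneg _) (by positivity)
    _ = _ := by ring

lemma add {ψ θ : E → ℝ} (hψ : ExpGrowth ψ) (hθ : ExpGrowth θ) :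
    ExpGrowth (fun x => ψ x + θ x) := by
  obtain ⟨C, k, hC, hk, h⟩ := hψ.bound
  obtain ⟨C', k', hC', hk', h'⟩ := hθ.bound
  refine ⟨hψ.measurable.add hθ.measurable, C + C', k + k', by positivity, by positivity, ?_⟩
  intro x
  have e1 : Real.exp (k * ‖x‖) ≤ Real.exp ((k + k') * ‖x‖) :=
    Real.exp_le_exp.2 (by nlinarith [norm_nonneg x])
  have e2 : Real.exp (k' * ‖x‖) ≤ Real.exp ((k + k') * ‖x‖) :=
    Real.exp_le_exp.2 (by nlinarith [norm_nonneg x])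
  calc |ψ x + θ x| ≤ |ψ x| + |θ x| := abs_add_le _ _
    _ ≤ C * Real.exp (k * ‖x‖) + C' * Real.exp (k' * ‖x‖) := add_le_add (h x) (h' x)
    _ ≤ C * Real.exp ((k + k') * ‖x‖) + C' * Real.exp ((k + k') * ‖x‖) := by gcongr
    _ = _ := by ring

lemma const (c : ℝ) : ExpGrowth (fun _ : E => c) :=
  ⟨measurable_const, |c|, 0, abs_nonneg _, le_rfl, by simp⟩

lemma norm : ExpGrowth (fun x : E => ‖x‖) := by
  refine ⟨measurable_norm, 1, 1, zero_le_one, zero_le_one, fun x => ?_⟩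
  rw [abs_norm, one_mul, one_mul]
  linarith [Real.add_one_le_exp ‖x‖]

lemma of_le {ψ θ : E → ℝ} (hθ : ExpGrowth θ) (hψ : Measurable ψ) (h : ∀ x, |ψ x| ≤ θ x) :
    ExpGrowth ψ := by
  obtain ⟨C, k, hC, hk, h'⟩ := hθ.bound
  exact ⟨hψ, C, k, hC, hk, fun x => (h x).trans ((le_abs_self _).trans (h' x))⟩

lemma norm_pow (m : ℕ) : ExpGrowth (fun x : E => ‖x‖ ^ m) := by
  induction m with
  | zero => simpa using const (E := E) 1
  | succ m ih => simpa [pow_succ] using ih.mul norm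

lemma inner_right (v : E) : ExpGrowth (fun x : E => ⟪x, v⟫) := by
  refine of_le (norm.mul (const ‖v‖)) (by fun_prop) fun x => abs_real_inner_le_norm x v

lemma neg {ψ : E → ℝ} (hψ : ExpGrowth ψ) : ExpGrowth (fun x => -ψ x) := by
  simpa using (const (E := E) (-1)).mul hψ

lemma sub {ψ θ : E → ℝ} (hψ : ExpGrowth ψ) (hθ : ExpGrowth θ) :
    ExpGrowth (fun x => ψ x - θ x) := by
  simpa [sub_eq_add_neg] using hψ.add hθ.neg

end ExpGrowth

/-- The unnormalised posterior weight `exp (⟪x, y⟫ - l ‖x‖² / 2)`. -/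
noncomputable def tiltWeight (l : ℝ) (y x : E) : ℝ := Real.exp (⟪x, y⟫ - l * ‖x‖ ^ 2 / 2)

lemma tiltWeight_pos (l : ℝ) (y x : E) : 0 < tiltWeight l y x := Real.exp_pos _

lemma measurable_tiltWeight : Measurable (fun p : (ℝ × E) × E => tiltWeight p.1.1 p.1.2 p.2) := by
  unfold tiltWeight; fun_prop

lemma measurable_tiltWeight_right (l : ℝ) (y : E) : Measurable (tiltWeight l y) := by
  unfold tiltWeight; fun_prop

/-- The right side is the exponential of the maximum of (k + R) r - c r² / 2 over r = ‖x‖. Its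
uniformity in l ≥ c and ‖y‖ ≤ R is what differentiation under the integral sign needs. -/
lemma exp_mul_tiltWeight_le {c l R k : ℝ} {x y : E} (hc : 0 < c) (hl : c ≤ l) (hy : ‖y‖ ≤ R) :
    Real.exp (k * ‖x‖) * tiltWeight l y x ≤ Real.exp ((k + R) ^ 2 / (2 * c)) := by
  rw [tiltWeight, ← Real.exp_add, Real.exp_le_exp, le_div_iff₀ (by positivity)]
  have h1 : ⟪x, y⟫ ≤ ‖x‖ * R :=
    (real_inner_le_norm x y).trans (mul_le_mul_of_nonneg_left hy (norm_nonneg x))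
  have h2 : c * ‖x‖ ^ 2 ≤ l * ‖x‖ ^ 2 := mul_le_mul_of_nonneg_right hl (by positivity)
  nlinarith [sq_nonneg (k + R - c * ‖x‖)]

variable (μ : Measure E)

/-- The integral of `ψ` against the unnormalised posterior with prior `μ`. -/
noncomputable def moment (ψ : E → ℝ) (l : ℝ) (y : E) : ℝ := ∫ x, ψ x * tiltWeight l y x ∂μ

variable {μ} [IsFiniteMeasure μ]

lemma ExpGrowth.bounded_mul_tiltWeight {ψ : E → ℝ} (hψ : ExpGrowth ψ) {l : ℝ} (hl : 0 < l)
    (y : E) : ∃ K, 0 ≤ K ∧ ∀ x, |ψ x * tiltWeight l y x| ≤ K := by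
  obtain ⟨C, k, hC, hk, h⟩ := hψ.bound
  refine ⟨C * Real.exp ((k + ‖y‖) ^ 2 / (2 * l)), by positivity, fun x => ?_⟩
  rw [abs_mul, abs_of_pos (tiltWeight_pos l y x)]
  calc |ψ x| * tiltWeight l y x ≤ C * Real.exp (k * ‖x‖) * tiltWeight l y x :=
        mul_le_mul_of_nonneg_right (h x) (tiltWeight_pos l y x).le
    _ = C * (Real.exp (k * ‖x‖) * tiltWeight l y x) := by ring
    _ ≤ _ := mul_le_mul_of_nonneg_left (exp_mul_tiltWeight_le hl le_rfl le_rfl) hC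

lemma ExpGrowth.integrable {ψ : E → ℝ} (hψ : ExpGrowth ψ) {l : ℝ} (hl : 0 < l) (y : E) :
    Integrable (fun x => ψ x * tiltWeight l y x) μ := by
  obtain ⟨K, -, hK⟩ := hψ.bounded_mul_tiltWeight hl y
  exact Integrable.of_bound
    (hψ.measurable.mul (measurable_tiltWeight_right l y)).aestronglyMeasurable K
    (Eventually.of_forall hK)

lemma measurable_moment {ψ : E → ℝ} (hψ : Measurable ψ) :
    Measurable (fun p : ℝ × E => moment μ ψ p.1 p.2) := by
  have : StronglyMeasurable (fun q : (ℝ × E) × E => ψ q.2 * tiltWeight q.1.1 q.1.2 q.2) :=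
    ((hψ.comp measurable_snd).mul measurable_tiltWeight).stronglyMeasurable
  exact this.integral_prod_right.measurable

/-- The exponent of the weight is affine in t along any direction (a, v), so differentiation
multiplies the integrand by the slope. The choices a = 0 and (a, v) = (1, 0) give the derivatives in
y and in l from one domination argument. -/
lemma hasDerivAt_moment {ψ : E → ℝ} (hψ : ExpGrowth ψ) {l : ℝ} (hl : 0 < l) (y v : E) (a : ℝ) :
    HasDerivAt (fun t : ℝ => moment μ ψ (l + t * a) (y + t • v))
      (moment μ (fun x => ψ x * (⟪x, v⟫ - a * ‖x‖ ^ 2 / 2)) l y) 0 := by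
  have hθ : ExpGrowth (fun x : E => ψ x * (⟪x, v⟫ - a * ‖x‖ ^ 2 / 2)) := by
    refine hψ.mul ((ExpGrowth.inner_right v).sub ?_)
    have := (ExpGrowth.const (E := E) (a / 2)).mul (ExpGrowth.norm_pow 2)
    convert this using 2
    ring
  obtain ⟨C, k, hC, hk, h⟩ := hθ.bound
  -- For |t| < ε both |t| ≤ 1 and l + t a ≥ l / 2, so the weight stays uniformly Gaussian.
  set ε := min 1 (l / (2 * (|a| + 1)))
  have hε : 0 < ε := lt_min one_pos (by positivity)
  have key := hasDerivAt_integral_of_dominated_loc_of_deriv_le (μ := μ)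
    (F := fun (t : ℝ) (x : E) => ψ x * tiltWeight (l + t * a) (y + t • v) x)
    (F' := fun (t : ℝ) (x : E) =>
      ψ x * (⟪x, v⟫ - a * ‖x‖ ^ 2 / 2) * tiltWeight (l + t * a) (y + t • v) x)
    (x₀ := 0) (s := Metric.ball 0 ε)
    (bound := fun _ => C * Real.exp ((k + (‖y‖ + ‖v‖)) ^ 2 / (2 * (l / 2))))
    (Metric.ball_mem_nhds _ hε)
    (Eventually.of_forall fun t =>
      (hψ.measurable.mul (measurable_tiltWeight_right _ _)).aestronglyMeasurable)
    (by simpa using hψ.integrable hl y)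
    (hθ.measurable.mul (measurable_tiltWeight_right _ _)).aestronglyMeasurable
    (Eventually.of_forall fun x t ht => ?_) (integrable_const _)
    (Eventually.of_forall fun x t ht => ?_)
  · simpa [moment] using key.2
  · have ht' : |t| < ε := by simpa using ht
    have h1 : |t| ≤ 1 := ht'.le.trans (min_le_left _ _)
    have h2 : |t| * (2 * (|a| + 1)) ≤ l := by
      have := ht'.le.trans (min_le_right _ _)
      rwa [le_div_iff₀ (by positivity)] at this
    have h3 : l / 2 ≤ l + t * a := by
      have : |t * a| ≤ |t| * (|a| + 1) := by
        rw [abs_mul]; exact mul_le_mul_of_nonneg_left (by linarith) (abs_nonneg t)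
      have := neg_abs_le (t * a)
      linarith
    have h4 : ‖y + t • v‖ ≤ ‖y‖ + ‖v‖ := by
      refine (norm_add_le _ _).trans ?_
      rw [norm_smul, Real.norm_eq_abs]
      have := mul_le_mul_of_nonneg_right h1 (norm_nonneg v)
      linarith
    rw [Real.norm_eq_abs, abs_mul, abs_of_pos (tiltWeight_pos _ _ x)]
    calc _ ≤ C * Real.exp (k * ‖x‖) * tiltWeight (l + t * a) (y + t • v) x :=
          mul_le_mul_of_nonneg_right (h x) (tiltWeight_pos _ _ x).le
      _ = C * (Real.exp (k * ‖x‖) * tiltWeight (l + t * a) (y + t • v) x) := by ring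
      _ ≤ _ := mul_le_mul_of_nonneg_left (exp_mul_tiltWeight_le (by positivity) h3 h4) hC
  · have e1 : HasDerivAt (fun t : ℝ => ⟪x, y + t • v⟫ - (l + t * a) * ‖x‖ ^ 2 / 2)
        (⟪x, v⟫ - a * ‖x‖ ^ 2 / 2) t := by
      have : (fun t : ℝ => ⟪x, y + t • v⟫ - (l + t * a) * ‖x‖ ^ 2 / 2)
          = fun t : ℝ => (⟪x, y⟫ - l * ‖x‖ ^ 2 / 2) + t * (⟪x, v⟫ - a * ‖x‖ ^ 2 / 2) := by
        funext t
        rw [inner_add_right, inner_smul_right]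
        ring
      rw [this]
      simpa using ((hasDerivAt_id t).mul_const (⟪x, v⟫ - a * ‖x‖ ^ 2 / 2)).const_add
        (⟪x, y⟫ - l * ‖x‖ ^ 2 / 2)
    have := (e1.exp).const_mul (ψ x)
    refine this.congr_deriv ?_
    simp only [tiltWeight]
    ring

lemma hasLineDerivAt_moment {ψ : E → ℝ} (hψ : ExpGrowth ψ) {l : ℝ} (hl : 0 < l) (y v : E) :
    HasLineDerivAt ℝ (moment μ ψ l) (moment μ (fun x => ψ x * ⟪x, v⟫) l y) y v := by
  have := hasDerivAt_moment (μ := μ) hψ hl y v 0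
  simpa [HasLineDerivAt] using this

lemma hasDerivAt_moment_param {ψ : E → ℝ} (hψ : ExpGrowth ψ) {l : ℝ} (hl : 0 < l) (y : E) :
    HasDerivAt (fun l => moment μ ψ l y) (moment μ (fun x => ψ x * (-(‖x‖ ^ 2 / 2))) l y) l := by
  have := hasDerivAt_moment (μ := μ) hψ hl y 0 1
  simp only [mul_one, smul_zero, add_zero, inner_zero_right, one_mul, zero_sub] at this
  have h2 := (HasDerivAt.comp_const_add (-l) l (f := fun t => moment μ ψ (l + t) y) 
    (by simpa using this))
  simpa using h2

lemma moment_mono {ψ θ : E → ℝ} (hψ : ExpGrowth ψ) (hθ : ExpGrowth θ) (h : ∀ x, ψ x ≤ θ x)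
    {l : ℝ} (hl : 0 < l) (y : E) : moment μ ψ l y ≤ moment μ θ l y :=
  integral_mono (hψ.integrable hl y) (hθ.integrable hl y)
    fun x => mul_le_mul_of_nonneg_right (h x) (tiltWeight_pos l y x).le

lemma moment_add {ψ θ : E → ℝ} (hψ : ExpGrowth ψ) (hθ : ExpGrowth θ) {l : ℝ} (hl : 0 < l)
    (y : E) : moment μ (fun x => ψ x + θ x) l y = moment μ ψ l y + moment μ θ l y := by
  simp only [moment, add_mul]
  exact integral_add (hψ.integrable hl y) (hθ.integrable hl y)

lemma moment_const_mul (c : ℝ) (ψ : E → ℝ) (l : ℝ) (y : E) :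
    moment μ (fun x => c * ψ x) l y = c * moment μ ψ l y := by
  simp only [moment, mul_assoc]
  exact integral_const_mul _ _

lemma moment_sum {ι : Type*} (s : Finset ι) {ψ : ι → E → ℝ} (hψ : ∀ i, ExpGrowth (ψ i)) {l : ℝ}
    (hl : 0 < l) (y : E) :
    moment μ (fun x => ∑ i ∈ s, ψ i x) l y = ∑ i ∈ s, moment μ (ψ i) l y := by
  simp only [moment, Finset.sum_mul]
  exact integral_finsetSum _ fun i _ => (hψ i).integrable hl y

end Weights

/-! ### The Gaussian kernel, its derivatives and integrability -/

section Kernel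

variable {E : Type*} [NormedAddCommGroup E] [InnerProductSpace ℝ E] [FiniteDimensional ℝ E]

/-- The density of the centred Gaussian distribution with covariance `l • 1`. -/
noncomputable def gaussKernel (l : ℝ) (y : E) : ℝ :=
  (2 * Real.pi * l) ^ (-(Module.finrank ℝ E / 2 : ℝ)) * Real.exp (-(‖y‖ ^ 2 / (2 * l)))

lemma gaussKernel_pos {l : ℝ} (hl : 0 < l) (y : E) : 0 < gaussKernel l y := by
  unfold gaussKernel; positivity

/-- Completing the square. Integrals of posterior moments against N(0, l I) thereby become integrals
over the joint law of input and output. -/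
lemma tiltWeight_mul_gaussKernel {l : ℝ} (hl : 0 < l) (y x : E) :
    tiltWeight l y x * gaussKernel l y = gaussKernel l (y - l • x) := by
  unfold tiltWeight gaussKernel
  rw [mul_left_comm, ← Real.exp_add]
  congr 2
  rw [norm_sub_sq_real, inner_smul_right, norm_smul, Real.norm_eq_abs, abs_of_pos hl,
    real_inner_comm]
  field_simp
  ring

lemma hasLineDerivAt_gaussKernel (l : ℝ) (y v : E) :
    HasLineDerivAt ℝ (gaussKernel l) (-(⟪y, v⟫ / l) * gaussKernel l y) y v := by
  have e : HasDerivAt (fun t : ℝ => -(‖y + t • v‖ ^ 2 / (2 * l))) (-(⟪y, v⟫ / l)) 0 := by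
    have : (fun t : ℝ => -(‖y + t • v‖ ^ 2 / (2 * l)))
        = fun t : ℝ => -((‖y‖ ^ 2 + t * (2 * ⟪y, v⟫) + t ^ 2 * ‖v‖ ^ 2) / (2 * l)) := by
      funext t
      rw [norm_add_sq_real, inner_smul_right, norm_smul, mul_pow, Real.norm_eq_abs, sq_abs]
      ring
    rw [this]
    have h := (((((hasDerivAt_id (0 : ℝ)).mul_const (2 * ⟪y, v⟫)).const_add (‖y‖ ^ 2)).add
      (((hasDerivAt_id (0 : ℝ)).pow 2).mul_const (‖v‖ ^ 2))).div_const (2 * l)).neg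
    refine h.congr_deriv ?_
    simp only [one_mul, id, Nat.cast_ofNat, mul_zero, zero_mul, add_zero, Nat.add_one_sub_one,
      pow_one]
    rw [mul_div_mul_left _ _ two_ne_zero]
  have := (e.exp).const_mul ((2 * Real.pi * l) ^ (-(Module.finrank ℝ E / 2 : ℝ)))
  unfold HasLineDerivAt gaussKernel
  refine this.congr_deriv ?_
  simp only [zero_smul, add_zero]
  ring

lemma hasLineDerivAt_inner_mul_gaussKernel (l : ℝ) (y v : E) :
    HasLineDerivAt ℝ (fun y => -(⟪y, v⟫ / l) * gaussKernel l y)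
      ((⟪y, v⟫ ^ 2 / l ^ 2 - ‖v‖ ^ 2 / l) * gaussKernel l y) y v := by
  have e : HasDerivAt (fun t : ℝ => -(⟪y + t • v, v⟫ / l)) (-(‖v‖ ^ 2 / l)) 0 := by
    have : (fun t : ℝ => -(⟪y + t • v, v⟫ / l))
        = fun t : ℝ => -((⟪y, v⟫ + t * ‖v‖ ^ 2) / l) := by
      funext t
      rw [inner_add_left, inner_smul_left, real_inner_self_eq_norm_sq]
      simp
    rw [this]
    refine ((((hasDerivAt_id (0 : ℝ)).mul_const (‖v‖ ^ 2)).const_add ⟪y, v⟫).div_const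
      l).neg.congr_deriv ?_
    ring
  have h := e.mul (hasLineDerivAt_gaussKernel l y v)
  unfold HasLineDerivAt
  refine h.congr_deriv ?_
  simp only [zero_smul, add_zero]
  ring

/-- The coefficient is half the sum over an orthonormal basis of those in
`hasLineDerivAt_inner_mul_gaussKernel`: together they express the heat equation. -/
lemma hasDerivAt_gaussKernel {l : ℝ} (hl : 0 < l) (y : E) :
    HasDerivAt (fun l => gaussKernel l y)
      ((‖y‖ ^ 2 / l ^ 2 - Module.finrank ℝ E / l) / 2 * gaussKernel l y) l := by
  have h1 : HasDerivAt (fun l : ℝ => (2 * Real.pi * l) ^ (-(Module.finrank ℝ E / 2 : ℝ)))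
      (2 * Real.pi * (-(Module.finrank ℝ E / 2 : ℝ)) *
        (2 * Real.pi * l) ^ (-(Module.finrank ℝ E / 2 : ℝ) - 1)) l := by
    have := ((hasDerivAt_id l).const_mul (2 * Real.pi)).rpow_const
      (p := -(Module.finrank ℝ E / 2 : ℝ)) (Or.inl (by simp only [id]; positivity))
    simpa using this
  have h2 : HasDerivAt (fun l : ℝ => Real.exp (-(‖y‖ ^ 2 / (2 * l))))
      (Real.exp (-(‖y‖ ^ 2 / (2 * l))) * (‖y‖ ^ 2 / l ^ 2 / 2)) l := by
    have e : HasDerivAt (fun l : ℝ => -(‖y‖ ^ 2 / (2 * l))) (‖y‖ ^ 2 / l ^ 2 / 2) l := by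
      refine ((((hasDerivAt_id l).const_mul 2).inv (by simp only [id]; positivity)).const_mul
        (‖y‖ ^ 2)).neg.congr_deriv ?_
      simp only [id]
      field_simp
    exact e.exp
  have := h1.mul h2
  unfold gaussKernel
  refine this.congr_deriv ?_
  rw [Real.rpow_sub (by positivity), Real.rpow_one]
  field_simp
  ring

variable [MeasurableSpace E] [BorelSpace E]

lemma measurable_gaussKernel : Measurable (fun p : ℝ × E => gaussKernel p.1 p.2) := by
  unfold gaussKernel; fun_prop

lemma measurable_gaussKernel_right (l : ℝ) : Measurable (gaussKernel (E := E) l) := by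
  unfold gaussKernel; fun_prop

lemma integral_gaussKernel {l : ℝ} (hl : 0 < l) : ∫ y : E, gaussKernel l y = 1 := by
  unfold gaussKernel
  rw [integral_const_mul]
  have := GaussianFourier.integral_rexp_neg_mul_sq_norm (V := E) (b := (2 * l)⁻¹) (by positivity)
  have e : (fun y : E => Real.exp (-(‖y‖ ^ 2 / (2 * l))))
      = fun y : E => Real.exp (-(2 * l)⁻¹ * ‖y‖ ^ 2) := by
    funext y; congr 1; ring
  rw [e, this, show Real.pi / (2 * l)⁻¹ = 2 * Real.pi * l by field_simp, ← Real.rpow_add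
    (by positivity)]
  simp

/-- A nonintegrable function would have Bochner integral 0 instead of 1. -/
lemma integrable_gaussKernel {l : ℝ} (hl : 0 < l) : Integrable (gaussKernel (E := E) l) := by
  by_contra h
  have := integral_gaussKernel (E := E) hl
  rw [integral_undef h] at this
  exact zero_ne_one this

/-- The power is absorbed into m! exp ‖y‖, and exp ‖y‖ into half of the Gaussian exponent. -/
lemma integrable_norm_pow_mul_exp {c : ℝ} (hc : 0 < c) (m : ℕ) :
    Integrable (fun y : E => ‖y‖ ^ m * Real.exp (-(c * ‖y‖ ^ 2))) := by
  have h0 : Integrable (fun y : E => Real.exp (-(c / 2 * ‖y‖ ^ 2))) := by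
    have := (integrable_gaussKernel (E := E) (l := 1 / c) (by positivity)).const_mul
      (((2 * Real.pi * (1 / c)) ^ (-(Module.finrank ℝ E / 2 : ℝ)))⁻¹)
    convert this using 2 with y
    unfold gaussKernel
    rw [inv_mul_cancel_left₀ (by positivity)]
    congr 1
    field_simp
  refine (h0.const_mul (m.factorial * Real.exp (1 / (2 * c)))).mono' (by fun_prop)
    (Eventually.of_forall fun y => ?_)
  rw [Real.norm_eq_abs, abs_of_nonneg (by positivity)]
  have h1 : ‖y‖ ^ m ≤ m.factorial * Real.exp ‖y‖ := by
    have := Real.pow_div_factorial_le_exp ‖y‖ (norm_nonneg y) m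
    rwa [div_le_iff₀' (by positivity)] at this
  calc ‖y‖ ^ m * Real.exp (-(c * ‖y‖ ^ 2))
      ≤ m.factorial * Real.exp ‖y‖ * Real.exp (-(c * ‖y‖ ^ 2)) := by gcongr
    _ = m.factorial * Real.exp (‖y‖ - c * ‖y‖ ^ 2) := by
        rw [mul_assoc, ← Real.exp_add]; ring_nf
    _ ≤ m.factorial * Real.exp (1 / (2 * c) + -(c / 2 * ‖y‖ ^ 2)) := by
        gcongr
        have : 1 / (2 * c) - ‖y‖ + c / 2 * ‖y‖ ^ 2 = (1 - c * ‖y‖) ^ 2 / (2 * c) := by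
          field_simp; ring
        have h2 : 0 ≤ (1 - c * ‖y‖) ^ 2 / (2 * c) := by positivity
        linarith
    _ = _ := by rw [Real.exp_add]; ring

/-- On `[l₁, l₂] ⊆ (0, ∞)` the Gaussian kernels are dominated by a single Gaussian. -/
lemma gaussKernel_le {l₁ l₂ l : ℝ} (h₁ : 0 < l₁) (h : l ∈ Icc l₁ l₂) (y : E) :
    gaussKernel l y ≤ (2 * Real.pi * l₁) ^ (-(Module.finrank ℝ E / 2 : ℝ)) *
      Real.exp (-((2 * l₂)⁻¹ * ‖y‖ ^ 2)) := by
  have hl : 0 < l := h₁.trans_le h.1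
  unfold gaussKernel
  refine mul_le_mul ?_ ?_ (Real.exp_pos _).le (by positivity)
  · exact Real.rpow_le_rpow_of_nonpos (by positivity)
      (mul_le_mul_of_nonneg_left h.1 (by positivity)) (by simp; positivity)
  · rw [Real.exp_le_exp, neg_le_neg_iff, inv_mul_eq_div]
    exact div_le_div_of_nonneg_left (by positivity) (by positivity) (by linarith [h.2])

lemma integrable_norm_pow_mul_gaussKernel {l : ℝ} (hl : 0 < l) (m : ℕ) :
    Integrable (fun y : E => ‖y‖ ^ m * gaussKernel l y) := by
  have := (integrable_norm_pow_mul_exp (E := E) (c := (2 * l)⁻¹) (by positivity) m).const_mul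
    ((2 * Real.pi * l) ^ (-(Module.finrank ℝ E / 2 : ℝ)))
  convert this using 2 with y
  unfold gaussKernel
  rw [inv_mul_eq_div]
  ring

end Kernel

/-! ### Dynkin's formula by integration by parts -/

section Dynkin

open Filter Topology
open scoped RealInnerProductSpace

variable {E : Type*} [NormedAddCommGroup E] [InnerProductSpace ℝ E] [FiniteDimensional ℝ E]
  [MeasurableSpace E] [BorelSpace E]

lemma integral_mul_lineDeriv_eq_neg {f f' g g' : E → ℝ} {v : E}
    (hf'g : Integrable (fun x => f' x * g x)) (hfg' : Integrable (fun x => f x * g' x))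
    (hfg : Integrable (fun x => f x * g x)) (hf : ∀ x, HasLineDerivAt ℝ f (f' x) x v)
    (hg : ∀ x, HasLineDerivAt ℝ g (g' x) x v) :
    ∫ x, f x * g' x = -∫ x, f' x * g x := by
  have := integral_bilinear_hasLineDerivAt_right_eq_neg_left_of_integrable (μ := volume)
    (B := ContinuousLinearMap.mul ℝ ℝ) (f := f) (f' := f') (g := g) (g' := g') (v := v)
    (by simpa using hf'g) (by simpa using hfg') (by simpa using hfg)
    (fun x _ => hf x) (fun x _ => hg x)
  simpa using this

/-- Two integrations by parts move the second derivative from the kernel to f. Each derivative of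
the kernel costs a factor linear in y, whence the weights of degree two, one and zero in the bounds
on f, f1 and f2. -/
lemma integral_mul_gaussKernel_lineDeriv_lineDeriv {l : ℝ} (hl : 0 < l) {v : E} (hv : ‖v‖ = 1)
    {f f1 f2 D : E → ℝ} (mf : Measurable f) (mf1 : Measurable f1) (mf2 : Measurable f2)
    (h1 : ∀ y, HasLineDerivAt ℝ f (f1 y) y v) (h2 : ∀ y, HasLineDerivAt ℝ f1 (f2 y) y v)
    (b0 : ∀ y, |f y| * (1 + ‖y‖ ^ 2) ≤ D y) (b1 : ∀ y, |f1 y| * (1 + ‖y‖) ≤ D y)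
    (b2 : ∀ y, |f2 y| ≤ D y) (hD : Integrable (fun y => D y * gaussKernel l y)) :
    Integrable (fun y => f y * ((⟪y, v⟫ ^ 2 / l ^ 2 - ‖v‖ ^ 2 / l) * gaussKernel l y)) ∧
    Integrable (fun y => f2 y * gaussKernel l y) ∧
    ∫ y, f y * ((⟪y, v⟫ ^ 2 / l ^ 2 - ‖v‖ ^ 2 / l) * gaussKernel l y)
      = ∫ y, f2 y * gaussKernel l y := by
  have mg := measurable_gaussKernel_right (E := E) l
  have hin : ∀ y : E, |⟪y, v⟫| ≤ ‖y‖ := fun y => by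
    simpa [hv] using abs_real_inner_le_norm y v
  have dom : ∀ (g : E → ℝ) (C : ℝ), Measurable g → (∀ y, |g y| ≤ C * D y) →
      Integrable (fun y => g y * gaussKernel l y) := by
    intro g C hg h
    refine (hD.const_mul C).mono' (hg.mul mg).aestronglyMeasurable (Eventually.of_forall fun y => ?_)
    rw [Real.norm_eq_abs, abs_mul, abs_of_pos (gaussKernel_pos hl y), ← mul_assoc]
    exact mul_le_mul_of_nonneg_right (h y) (gaussKernel_pos hl y).le
  have i0 : Integrable (fun y => f y * gaussKernel l y) := by
    refine dom f 1 mf fun y => ?_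
    nlinarith [b0 y, abs_nonneg (f y), sq_nonneg ‖y‖]
  have i1 : Integrable (fun y => f1 y * gaussKernel l y) := by
    refine dom f1 1 mf1 fun y => ?_
    nlinarith [b1 y, abs_nonneg (f1 y), norm_nonneg y]
  have i2 : Integrable (fun y => f2 y * gaussKernel l y) := dom f2 1 mf2 (by simpa using b2)
  have i3 : Integrable (fun y => f y * (-(⟪y, v⟫ / l) * gaussKernel l y)) := by
    have := dom (fun y => f y * -(⟪y, v⟫ / l)) (1 / l) (by fun_prop) fun y => ?_
    · simpa only [mul_assoc] using this
    · rw [abs_mul, abs_neg, abs_div, abs_of_pos hl, ← mul_div_assoc, one_div, inv_mul_eq_div]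
      gcongr
      nlinarith [b0 y, mul_le_mul_of_nonneg_left (hin y) (abs_nonneg (f y)), abs_nonneg (f y),
        mul_nonneg (abs_nonneg (f y)) (sq_nonneg (‖y‖ - 1))]
  have i4 : Integrable (fun y => f1 y * (-(⟪y, v⟫ / l) * gaussKernel l y)) := by
    have := dom (fun y => f1 y * -(⟪y, v⟫ / l)) (1 / l) (by fun_prop) fun y => ?_
    · simpa only [mul_assoc] using this
    · rw [abs_mul, abs_neg, abs_div, abs_of_pos hl, ← mul_div_assoc, one_div, inv_mul_eq_div]
      gcongr
      nlinarith [b1 y, mul_le_mul_of_nonneg_left (hin y) (abs_nonneg (f1 y)), abs_nonneg (f1 y)]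
  have i5 : Integrable (fun y => f y * ((⟪y, v⟫ ^ 2 / l ^ 2 - ‖v‖ ^ 2 / l) * gaussKernel l y)) := by
    have := dom (fun y => f y * (⟪y, v⟫ ^ 2 / l ^ 2 - ‖v‖ ^ 2 / l)) (1 / l ^ 2 + 1 / l)
      (by fun_prop) fun y => ?_
    · simpa only [mul_assoc] using this
    · rw [abs_mul, hv, one_pow]
      have hq : ⟪y, v⟫ ^ 2 ≤ ‖y‖ ^ 2 := sq_le_sq' (neg_le_of_abs_le (hin y)) (le_of_abs_le (hin y))
      have : |⟪y, v⟫ ^ 2 / l ^ 2 - 1 / l| ≤ (1 / l ^ 2 + 1 / l) * (1 + ‖y‖ ^ 2) := by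
        refine (abs_sub _ _).trans ?_
        rw [abs_of_nonneg (by positivity : (0:ℝ) ≤ ⟪y, v⟫ ^ 2 / l ^ 2),
          abs_of_pos (by positivity : (0:ℝ) < 1 / l)]
        have e1 : ⟪y, v⟫ ^ 2 / l ^ 2 ≤ 1 / l ^ 2 * ‖y‖ ^ 2 := by
          rw [div_mul_eq_mul_div, one_mul]; gcongr
        have p1 : 0 ≤ 1 / l ^ 2 := by positivity
        have p2 : 0 ≤ 1 / l * ‖y‖ ^ 2 := by positivity
        nlinarith
      calc _ ≤ |f y| * ((1 / l ^ 2 + 1 / l) * (1 + ‖y‖ ^ 2)) := by gcongr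
        _ = (1 / l ^ 2 + 1 / l) * (|f y| * (1 + ‖y‖ ^ 2)) := by ring
        _ ≤ _ := by gcongr; exact b0 y
  refine ⟨i5, i2, ?_⟩
  rw [integral_mul_lineDeriv_eq_neg i4 i5 i3 h1
      (fun y => hasLineDerivAt_inner_mul_gaussKernel l y v),
    integral_mul_lineDeriv_eq_neg i2 i4 i1 h2 (fun y => hasLineDerivAt_gaussKernel l y v), neg_neg]

/-- Integrated Itô formula (Dynkin's formula) for the expectation of `Φ l` under `N(0, l • 1)`. -/
theorem integral_mul_gaussKernel_sub {ι : Type*} [Fintype ι] (b : OrthonormalBasis ι ℝ E)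
    {Φ Φ' : ℝ → E → ℝ} {Φ1 Φ2 : ι → ℝ → E → ℝ} {D : ℝ → E → ℝ} {l₁ l₂ : ℝ} (h₁ : 0 < l₁)
    (h₁₂ : l₁ ≤ l₂) (mΦ : Measurable (fun p : ℝ × E => Φ p.1 p.2))
    (mΦ' : Measurable (fun p : ℝ × E => Φ' p.1 p.2))
    (mΦ1 : ∀ i l, Measurable (Φ1 i l)) (mΦ2 : ∀ i l, Measurable (Φ2 i l))
    (d' : ∀ l ∈ Icc l₁ l₂, ∀ y, HasDerivAt (fun l => Φ l y) (Φ' l y) l)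
    (d1 : ∀ i, ∀ l ∈ Icc l₁ l₂, ∀ y, HasLineDerivAt ℝ (Φ l) (Φ1 i l y) y (b i))
    (d2 : ∀ i, ∀ l ∈ Icc l₁ l₂, ∀ y, HasLineDerivAt ℝ (Φ1 i l) (Φ2 i l y) y (b i))
    (b0 : ∀ l ∈ Icc l₁ l₂, ∀ y, |Φ l y| * (1 + ‖y‖ ^ 2) ≤ D l y)
    (b' : ∀ l ∈ Icc l₁ l₂, ∀ y, |Φ' l y| ≤ D l y)
    (b1 : ∀ i, ∀ l ∈ Icc l₁ l₂, ∀ y, |Φ1 i l y| * (1 + ‖y‖) ≤ D l y)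
    (b2 : ∀ i, ∀ l ∈ Icc l₁ l₂, ∀ y, |Φ2 i l y| ≤ D l y)
    (hD : Integrable (fun p : ℝ × E => D p.1 p.2 * gaussKernel p.1 p.2)
      ((volume.restrict (Icc l₁ l₂)).prod volume))
    (hD' : ∀ l ∈ Icc l₁ l₂, Integrable (fun y => D l y * gaussKernel l y)) :
    IntervalIntegrable (fun l => ∫ y, (Φ' l y + 1 / 2 * ∑ i, Φ2 i l y) * gaussKernel l y)
      volume l₁ l₂ ∧
    (∫ y, Φ l₂ y * gaussKernel l₂ y) - ∫ y, Φ l₁ y * gaussKernel l₁ y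
      = ∫ l in l₁..l₂, ∫ y, (Φ' l y + 1 / 2 * ∑ i, Φ2 i l y) * gaussKernel l y := by
  have memae : ∀ᵐ p : ℝ × E ∂((volume.restrict (Icc l₁ l₂)).prod volume), p.1 ∈ Icc l₁ l₂ :=
    Measure.quasiMeasurePreserving_fst.ae (ae_restrict_mem measurableSet_Icc)
  have mΦl : ∀ l, Measurable (Φ l) := fun l => mΦ.comp (measurable_prodMk_left (x := l))
  have int0 : ∀ l ∈ Icc l₁ l₂, Integrable (fun y => Φ l y * gaussKernel l y) := by
    intro l hl
    have hl0 : 0 < l := h₁.trans_le hl.1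
    refine (hD' l hl).mono' ((mΦl l).mul (measurable_gaussKernel_right l)).aestronglyMeasurable
      (Eventually.of_forall fun y => ?_)
    rw [Real.norm_eq_abs, abs_mul, abs_of_pos (gaussKernel_pos hl0 y)]
    refine mul_le_mul_of_nonneg_right ?_ (gaussKernel_pos hl0 y).le
    nlinarith [b0 l hl y, abs_nonneg (Φ l y), sq_nonneg ‖y‖]
  -- G is the l-derivative of Φ times the kernel. For almost every y it is integrated in l by the
  -- fundamental theorem of calculus; Fubini then allows work on single slices in l.
  set G : ℝ → E → ℝ := fun l y => Φ' l y * gaussKernel l y +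
    Φ l y * ((‖y‖ ^ 2 / l ^ 2 - Module.finrank ℝ E / l) / 2 * gaussKernel l y) with hG
  have mG : Measurable (fun p : ℝ × E => G p.1 p.2) := by
    have := measurable_gaussKernel (E := E)
    simp only [hG]
    fun_prop
  have intG : Integrable (fun p : ℝ × E => G p.1 p.2)
      ((volume.restrict (Icc l₁ l₂)).prod volume) := by
    refine (hD.const_mul (1 + (1 / l₁ ^ 2 + Module.finrank ℝ E / l₁))).mono'
      mG.aestronglyMeasurable ?_
    filter_upwards [memae] with p hp
    have hl0 : 0 < p.1 := h₁.trans_le hp.1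
    have hg := gaussKernel_pos hl0 p.2
    have e : G p.1 p.2 = (Φ' p.1 p.2 + Φ p.1 p.2 *
        ((‖p.2‖ ^ 2 / p.1 ^ 2 - Module.finrank ℝ E / p.1) / 2)) * gaussKernel p.1 p.2 := by
      simp only [hG]; ring
    rw [e, Real.norm_eq_abs, abs_mul, abs_of_pos hg, ← mul_assoc]
    refine mul_le_mul_of_nonneg_right ?_ hg.le
    have hc : |(‖p.2‖ ^ 2 / p.1 ^ 2 - Module.finrank ℝ E / p.1) / 2|
        ≤ (1 / l₁ ^ 2 + Module.finrank ℝ E / l₁) * (1 + ‖p.2‖ ^ 2) := by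
      have e1 : ‖p.2‖ ^ 2 / p.1 ^ 2 ≤ 1 / l₁ ^ 2 * ‖p.2‖ ^ 2 := by
        rw [div_mul_eq_mul_div, one_mul]
        exact div_le_div_of_nonneg_left (by positivity) (by positivity)
          (pow_le_pow_left₀ h₁.le hp.1 2)
      have e2 : (Module.finrank ℝ E : ℝ) / p.1 ≤ Module.finrank ℝ E / l₁ :=
        div_le_div_of_nonneg_left (by positivity) h₁ hp.1
      have p1 : 0 ≤ 1 / l₁ ^ 2 := by positivity
      have p2 : 0 ≤ Module.finrank ℝ E / l₁ * ‖p.2‖ ^ 2 := by positivity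
      have p3 : 0 ≤ ‖p.2‖ ^ 2 / p.1 ^ 2 := by positivity
      have p4 : 0 ≤ (Module.finrank ℝ E : ℝ) / p.1 := by positivity
      rw [abs_le]
      constructor <;> nlinarith
    calc _ ≤ |Φ' p.1 p.2| + |Φ p.1 p.2| *
          |(‖p.2‖ ^ 2 / p.1 ^ 2 - Module.finrank ℝ E / p.1) / 2| := by
            rw [← abs_mul]; exact abs_add_le _ _
      _ ≤ D p.1 p.2 + |Φ p.1 p.2| *
          ((1 / l₁ ^ 2 + Module.finrank ℝ E / l₁) * (1 + ‖p.2‖ ^ 2)) := by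
            gcongr; exact b' _ hp _
      _ = D p.1 p.2 + (1 / l₁ ^ 2 + Module.finrank ℝ E / l₁) *
          (|Φ p.1 p.2| * (1 + ‖p.2‖ ^ 2)) := by ring
      _ ≤ D p.1 p.2 + (1 / l₁ ^ 2 + Module.finrank ℝ E / l₁) * D p.1 p.2 := by
            gcongr; exact b0 _ hp _
      _ = _ := by ring
  have ftc : ∀ᵐ y : E, Φ l₂ y * gaussKernel l₂ y - Φ l₁ y * gaussKernel l₁ y
      = ∫ l in Icc l₁ l₂, G l y := by
    filter_upwards [intG.prod_left_ae] with y hy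
    rw [integral_Icc_eq_integral_Ioc, ← intervalIntegral.integral_of_le h₁₂]
    symm
    refine intervalIntegral.integral_eq_sub_of_hasDerivAt
      (f := fun l => Φ l y * gaussKernel l y) (fun l hl => ?_) ?_
    · rw [uIcc_of_le h₁₂] at hl
      exact (d' l hl y).mul (hasDerivAt_gaussKernel (h₁.trans_le hl.1) y)
    · exact (intervalIntegrable_iff_integrableOn_Icc_of_le h₁₂).2 hy
  have intGl := intG.prod_right_ae
  suffices hae : (fun l => ∫ y, G l y) =ᵐ[volume.restrict (Icc l₁ l₂)]
      fun l => ∫ y, (Φ' l y + 1 / 2 * ∑ i, Φ2 i l y) * gaussKernel l y by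
    refine ⟨(intervalIntegrable_iff_integrableOn_Icc_of_le h₁₂).2
      (intG.integral_prod_left.congr hae), ?_⟩
    rw [← integral_sub (int0 l₂ ⟨h₁₂, le_rfl⟩) (int0 l₁ ⟨le_rfl, h₁₂⟩), integral_congr_ae ftc,
      ← integral_integral_swap intG, intervalIntegral.integral_of_le h₁₂,
      ← integral_Icc_eq_integral_Ioc]
    exact integral_congr_ae hae
  filter_upwards [intGl, ae_restrict_mem measurableSet_Icc] with l hGl hl
  have hl0 : 0 < l := h₁.trans_le hl.1
  have key := fun i => integral_mul_gaussKernel_lineDeriv_lineDeriv hl0 (b.norm_eq_one i) (mΦl l)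
    (mΦ1 i l) (mΦ2 i l) (d1 i l hl) (d2 i l hl) (b0 l hl) (b1 i l hl) (b2 i l hl) (hD' l hl)
  have int' : Integrable (fun y => Φ' l y * gaussKernel l y) := by
    refine (hD' l hl).mono' ((mΦ'.comp (measurable_prodMk_left (x := l))).mul
      (measurable_gaussKernel_right l)).aestronglyMeasurable (Eventually.of_forall fun y => ?_)
    rw [Real.norm_eq_abs, abs_mul, abs_of_pos (gaussKernel_pos hl0 y)]
    exact mul_le_mul_of_nonneg_right (b' l hl y) (gaussKernel_pos hl0 y).le
  -- The heat equation: the l-derivative of the kernel is half its Laplacian in the basis b, so each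
  -- summand can be integrated by parts twice.
  have e1 : ∀ y, G l y = Φ' l y * gaussKernel l y + 1 / 2 * ∑ i,
      Φ l y * ((⟪y, b i⟫ ^ 2 / l ^ 2 - ‖b i‖ ^ 2 / l) * gaussKernel l y) := by
    intro y
    simp only [hG]
    rw [← Finset.mul_sum, ← Finset.sum_mul, Finset.sum_sub_distrib, ← Finset.sum_div,
      ← Finset.sum_div, b.sum_sq_inner_left]
    simp only [b.norm_eq_one, one_pow, Finset.sum_const, Finset.card_univ, nsmul_eq_mul, mul_one]
    rw [Module.finrank_eq_card_basis b.toBasis]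
    ring
  have e2 : ∀ y, (Φ' l y + 1 / 2 * ∑ i, Φ2 i l y) * gaussKernel l y
      = Φ' l y * gaussKernel l y + 1 / 2 * ∑ i, Φ2 i l y * gaussKernel l y := by
    intro y
    rw [← Finset.sum_mul]
    ring
  simp only [e1, e2]
  rw [integral_add int' ((integrable_finsetSum _ fun i _ => (key i).1).const_mul _),
    integral_add int' ((integrable_finsetSum _ fun i _ => (key i).2.1).const_mul _),
    integral_const_mul, integral_const_mul, integral_finsetSum _ (fun i _ => (key i).1),
    integral_finsetSum _ (fun i _ => (key i).2.1)]
  simp only [fun i => (key i).2.2]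

end Dynkin

/-! ### Averaging the posterior over the output, and a common dominating function -/

section Nishimori

open Filter Topology
open scoped RealInnerProductSpace

variable {E : Type*} [NormedAddCommGroup E] [InnerProductSpace ℝ E] [FiniteDimensional ℝ E]
  [MeasurableSpace E] [BorelSpace E] {μ : Measure E} [IsProbabilityMeasure μ]

/-- The shear `(x, y) ↦ (x, y + l x)`. -/
def shear (l : ℝ) : E × E ≃ᵐ E × E where
  toFun p := (p.1, p.2 + l • p.1)
  invFun p := (p.1, p.2 - l • p.1)
  left_inv p := by simp
  right_inv p := by simp
  measurable_toFun := by simp only [Equiv.coe_fn_mk]; fun_prop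
  measurable_invFun := by simp only [Equiv.coe_fn_symm_mk]; fun_prop

lemma measurePreserving_shear (l : ℝ) :
    MeasurePreserving (shear l) (μ.prod (volume : Measure E)) (μ.prod volume) := by
  refine (MeasurePreserving.id μ).skew_product (g := fun x y => y + l • x) (by fun_prop)
    (Eventually.of_forall fun x => ?_)
  exact (measurePreserving_add_right volume (l • x)).map_eq

/-- In the coordinates (x, y - l x), input and noise, the joint law is a product measure. -/
lemma integrable_shear {f : E → E → ℝ} {l : ℝ} :
    Integrable (fun p : E × E => f p.1 p.2 * gaussKernel l (p.2 - l • p.1)) (μ.prod volume) ↔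
    Integrable (fun p : E × E => f p.1 (p.2 + l • p.1) * gaussKernel l p.2) (μ.prod volume) := by
  rw [← (measurePreserving_shear (μ := μ) l).integrable_comp_emb
    (shear l).measurableEmbedding]
  simp [shear, Function.comp_def]

lemma integral_shear {f : E → E → ℝ} {l : ℝ} :
    ∫ p : E × E, f p.1 p.2 * gaussKernel l (p.2 - l • p.1) ∂(μ.prod volume) =
    ∫ p : E × E, f p.1 (p.2 + l • p.1) * gaussKernel l p.2 ∂(μ.prod volume) := by
  rw [← (measurePreserving_shear (μ := μ) l).integral_comp (shear l).measurableEmbedding]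
  simp [shear]

lemma moment_mul_gaussKernel {l : ℝ} (hl : 0 < l) (ψ : E → ℝ) (y : E) :
    moment μ ψ l y * gaussKernel l y = ∫ x, ψ x * gaussKernel l (y - l • x) ∂μ := by
  rw [moment, ← integral_mul_const]
  simp only [mul_assoc, tiltWeight_mul_gaussKernel hl]

lemma integrable_prod_channel {ψ : E → ℝ} (hi : Integrable ψ μ) {l : ℝ} (hl : 0 < l) :
    Integrable (fun p : E × E => ψ p.1 * gaussKernel l (p.2 - l • p.1)) (μ.prod volume) :=
  (integrable_shear (f := fun x _ => ψ x)).2 (hi.mul_prod (integrable_gaussKernel hl))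

lemma integrable_moment_mul_gaussKernel {ψ : E → ℝ} (hi : Integrable ψ μ) {l : ℝ} (hl : 0 < l) :
    Integrable (fun y => moment μ ψ l y * gaussKernel l y) := by
  simp only [moment_mul_gaussKernel hl]
  exact (integrable_prod_channel hi hl).integral_prod_right

/-- The posterior averages to the prior. -/
lemma integral_moment_mul_gaussKernel {ψ : E → ℝ} (hi : Integrable ψ μ) {l : ℝ} (hl : 0 < l) :
    ∫ y, moment μ ψ l y * gaussKernel l y = ∫ x, ψ x ∂μ := by
  simp only [moment_mul_gaussKernel hl]
  rw [← integral_prod_symm _ (integrable_prod_channel hi hl),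
    integral_shear (f := fun x _ => ψ x), integral_prod_mul, integral_gaussKernel hl, mul_one]

lemma norm_add_pow_four_le (x y : E) : ‖y + x‖ ^ 4 ≤ 8 * (‖y‖ ^ 4 + ‖x‖ ^ 4) := by
  have h : ‖y + x‖ ^ 4 ≤ (‖y‖ + ‖x‖) ^ 4 := pow_le_pow_left₀ (norm_nonneg _) (norm_add_le _ _) 4
  have := add_pow_le (norm_nonneg y) (norm_nonneg x) 4
  norm_num at this
  linarith

lemma integrable_norm_pow_four_channel (h4 : Integrable (fun x => ‖x‖ ^ 4) μ) {l : ℝ}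
    (hl : 0 < l) : Integrable (fun p : E × E => ‖p.2‖ ^ 4 * gaussKernel l (p.2 - l • p.1))
      (μ.prod volume) := by
  refine (integrable_shear (f := fun _ y => ‖y‖ ^ 4)).2 ?_
  have i1 := (integrable_const (μ := μ) (1:ℝ)).mul_prod (integrable_norm_pow_mul_gaussKernel
    (E := E) hl 4)
  have i2 := (h4.const_mul (l ^ 4)).mul_prod (integrable_gaussKernel (E := E) hl)
  refine ((i1.add i2).const_mul 8).mono' ?_ (Eventually.of_forall fun p => ?_)
  · have := measurable_gaussKernel_right (E := E) l
    exact Measurable.aestronglyMeasurable (by fun_prop)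
  · have hg := (gaussKernel_pos hl p.2).le
    rw [Real.norm_eq_abs, abs_of_nonneg (by positivity)]
    have := norm_add_pow_four_le (l • p.1) p.2
    rw [norm_smul, mul_pow, Real.norm_eq_abs, abs_of_pos hl] at this
    calc _ ≤ 8 * (‖p.2‖ ^ 4 + l ^ 4 * ‖p.1‖ ^ 4) * gaussKernel l p.2 := by gcongr
      _ = _ := by simp only [Pi.add_apply]; ring

/-- After the shear ‖y + l x‖⁴ splits into a noise part and an input part. On a compact interval of
l one Gaussian dominates all kernels in the first, which makes K uniform; this permits integration
over l as well. -/
lemma exists_integral_norm_pow_four_channel_le (h4 : Integrable (fun x => ‖x‖ ^ 4) μ)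
    {l₁ l₂ : ℝ} (h₁ : 0 < l₁) : ∃ K, ∀ l ∈ Icc l₁ l₂,
      ∫ p : E × E, ‖p.2‖ ^ 4 * gaussKernel l (p.2 - l • p.1) ∂(μ.prod volume) ≤ K := by
  set c := (2 * Real.pi * l₁) ^ (-(Module.finrank ℝ E / 2 : ℝ))
  refine ⟨8 * (∫ y : E, ‖y‖ ^ 4 * (c * Real.exp (-((2 * l₂)⁻¹ * ‖y‖ ^ 2)))) +
    8 * (l₂ ^ 4 * ∫ x, ‖x‖ ^ 4 ∂μ), fun l hl => ?_⟩
  have hl0 : 0 < l := h₁.trans_le hl.1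
  have hl2 : 0 < l₂ := hl0.trans_le hl.2
  have J0 : Integrable (fun y : E => ‖y‖ ^ 4 * (c * Real.exp (-((2 * l₂)⁻¹ * ‖y‖ ^ 2)))) := by
    have := (integrable_norm_pow_mul_exp (E := E) (c := (2 * l₂)⁻¹) (by positivity) 4).const_mul c
    convert this using 2
    ring
  have i1 := (integrable_const (μ := μ) (1:ℝ)).mul_prod J0
  have i2 := (h4.const_mul (l₂ ^ 4)).mul_prod (integrable_gaussKernel (E := E) hl0)
  rw [integral_shear (f := fun _ y => ‖y‖ ^ 4)]
  have := integral_mono ((integrable_shear (f := fun _ y => ‖y‖ ^ 4)).1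
    (integrable_norm_pow_four_channel h4 hl0)) ((i1.const_mul 8).add (i2.const_mul 8)) fun p => ?_
  · refine this.trans_eq ?_
    simp only [Pi.add_apply]
    have E1 : ∫ p : E × E, 8 * (1 * (‖p.2‖ ^ 4 * (c * Real.exp (-((2 * l₂)⁻¹ * ‖p.2‖ ^ 2)))))
        ∂(μ.prod volume) = 8 * ∫ y : E, ‖y‖ ^ 4 * (c * Real.exp (-((2 * l₂)⁻¹ * ‖y‖ ^ 2))) := by
      rw [integral_const_mul, integral_prod_mul (fun _ : E => (1:ℝ))
        (fun y : E => ‖y‖ ^ 4 * (c * Real.exp (-((2 * l₂)⁻¹ * ‖y‖ ^ 2))))]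
      simp
    have E2 : ∫ p : E × E, 8 * (l₂ ^ 4 * ‖p.1‖ ^ 4 * gaussKernel l p.2) ∂(μ.prod volume)
        = 8 * (l₂ ^ 4 * ∫ x, ‖x‖ ^ 4 ∂μ) := by
      rw [integral_const_mul, integral_prod_mul (fun x : E => l₂ ^ 4 * ‖x‖ ^ 4),
        integral_gaussKernel hl0, integral_const_mul, mul_one]
    rw [integral_add (i1.const_mul 8) (i2.const_mul 8), E1, E2]
  · have hg := (gaussKernel_pos hl0 p.2).le
    have h := norm_add_pow_four_le (l • p.1) p.2
    rw [norm_smul, mul_pow, Real.norm_eq_abs, abs_of_pos hl0] at h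
    have hk := gaussKernel_le h₁ hl p.2
    have hll : l ^ 4 ≤ l₂ ^ 4 := pow_le_pow_left₀ hl0.le hl.2 4
    calc _ ≤ 8 * (‖p.2‖ ^ 4 + l ^ 4 * ‖p.1‖ ^ 4) * gaussKernel l p.2 := by gcongr
      _ = 8 * (‖p.2‖ ^ 4 * gaussKernel l p.2) + 8 * (l ^ 4 * ‖p.1‖ ^ 4 * gaussKernel l p.2) := by
        ring
      _ ≤ 8 * (1 * (‖p.2‖ ^ 4 * (c * Real.exp (-((2 * l₂)⁻¹ * ‖p.2‖ ^ 2))))) +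
          8 * (l₂ ^ 4 * ‖p.1‖ ^ 4 * gaussKernel l p.2) := by
        rw [one_mul]; gcongr

variable (μ) in
/-- A function dominating all expressions of joint degree at most four in the posterior moments
and the observation. -/
noncomputable def domFn (l : ℝ) (y : E) : ℝ :=
  moment μ (fun x => 1 + ‖x‖ ^ 4) l y + ‖y‖ ^ 4 * moment μ (fun _ => 1) l y

lemma measurable_domFn : Measurable (fun p : ℝ × E => domFn μ p.1 p.2) := by
  have h1 : Measurable (fun p : ℝ × E => moment μ (fun x : E => 1 + ‖x‖ ^ 4) p.1 p.2) :=
    measurable_moment (by fun_prop)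
  have h2 : Measurable (fun p : ℝ × E => moment μ (fun _ : E => (1:ℝ)) p.1 p.2) :=
    measurable_moment (by fun_prop)
  unfold domFn
  fun_prop

lemma domFn_nonneg (l : ℝ) (y : E) : 0 ≤ domFn μ l y := by
  have h : ∀ ψ : E → ℝ, (∀ x, 0 ≤ ψ x) → 0 ≤ moment μ ψ l y := fun ψ hψ =>
    integral_nonneg fun x => mul_nonneg (hψ x) (tiltWeight_pos l y x).le
  exact add_nonneg (h _ fun x => by positivity)
    (mul_nonneg (by positivity) (h _ fun x => zero_le_one))

lemma domFn_mul_gaussKernel {l : ℝ} (hl : 0 < l) (y : E) :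
    domFn μ l y * gaussKernel l y = moment μ (fun x => 1 + ‖x‖ ^ 4) l y * gaussKernel l y +
      ∫ x, ‖y‖ ^ 4 * gaussKernel l (y - l • x) ∂μ := by
  rw [domFn, add_mul, mul_assoc, moment_mul_gaussKernel hl (fun _ => 1)]
  simp only [one_mul, integral_const_mul]

lemma integrable_domFn (h4 : Integrable (fun x => ‖x‖ ^ 4) μ) {l : ℝ} (hl : 0 < l) :
    Integrable (fun y => domFn μ l y * gaussKernel l y) := by
  simp only [domFn_mul_gaussKernel hl]
  exact (integrable_moment_mul_gaussKernel ((integrable_const 1).add h4) hl).add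
    (integrable_norm_pow_four_channel h4 hl).integral_prod_right

lemma integrable_domFn_prod (h4 : Integrable (fun x => ‖x‖ ^ 4) μ) {l₁ l₂ : ℝ} (h₁ : 0 < l₁) :
    Integrable (fun p : ℝ × E => domFn μ p.1 p.2 * gaussKernel p.1 p.2)
      ((volume.restrict (Icc l₁ l₂)).prod volume) := by
  obtain ⟨K, hK⟩ := exists_integral_norm_pow_four_channel_le (μ := μ) h4 (l₂ := l₂) h₁
  have hm : Measurable (fun p : ℝ × E => domFn μ p.1 p.2 * gaussKernel p.1 p.2) :=
    measurable_domFn.mul measurable_gaussKernel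
  rw [integrable_prod_iff hm.aestronglyMeasurable]
  constructor
  · filter_upwards [ae_restrict_mem measurableSet_Icc] with l hl
    exact integrable_domFn h4 (h₁.trans_le hl.1)
  · refine Integrable.of_bound (C := (∫ x, (1 + ‖x‖ ^ 4) ∂μ) + K)
      hm.norm.stronglyMeasurable.integral_prod_right.aestronglyMeasurable ?_
    filter_upwards [ae_restrict_mem measurableSet_Icc] with l hl
    have hl0 : 0 < l := h₁.trans_le hl.1
    rw [Real.norm_eq_abs, abs_of_nonneg (integral_nonneg fun y => norm_nonneg _)]
    have e : ∀ y : E, ‖domFn μ l y * gaussKernel l y‖ = domFn μ l y * gaussKernel l y := fun y => by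
      rw [Real.norm_eq_abs, abs_of_nonneg (mul_nonneg (domFn_nonneg l y) (gaussKernel_pos hl0 y).le)]
    have I1 : Integrable (fun y => moment μ (fun x => 1 + ‖x‖ ^ 4) l y * gaussKernel l y) :=
      integrable_moment_mul_gaussKernel ((integrable_const 1).add h4) hl0
    have I2 := integrable_norm_pow_four_channel h4 hl0
    have I3 : Integrable (fun y : E => ∫ x, ‖y‖ ^ 4 * gaussKernel l (y - l • x) ∂μ) :=
      I2.integral_prod_right
    have E1 : ∫ y, moment μ (fun x => 1 + ‖x‖ ^ 4) l y * gaussKernel l y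
        = ∫ x, (1 + ‖x‖ ^ 4) ∂μ :=
      integral_moment_mul_gaussKernel ((integrable_const 1).add h4) hl0
    have E2 : ∫ y : E, ∫ x, ‖y‖ ^ 4 * gaussKernel l (y - l • x) ∂μ
        = ∫ p : E × E, ‖p.2‖ ^ 4 * gaussKernel l (p.2 - l • p.1) ∂(μ.prod volume) :=
      (integral_prod_symm _ I2).symm
    rw [integral_congr_ae (Eventually.of_forall e),
      integral_congr_ae (Eventually.of_forall (domFn_mul_gaussKernel hl0)),
      integral_add I1 I3, E1, E2]
    gcongr
    exact hK l hl

lemma moment_one_pos {l : ℝ} (hl : 0 < l) (y : E) : 0 < moment μ (fun _ => 1) l y := by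
  have := (ExpGrowth.const (E := E) 1).integrable (μ := μ) hl y
  unfold moment
  rw [integral_pos_iff_support_of_nonneg
    (fun x => mul_nonneg zero_le_one (tiltWeight_pos l y x).le) this]
  have : Function.support (fun x : E => 1 * tiltWeight l y x) = univ := by
    ext x; simp [(tiltWeight_pos l y x).ne']
  rw [this]
  simp

/-- Posterior moments of degree at most four are controlled by powers of one number. -/
lemma exists_moment_bound {l : ℝ} (hl : 0 < l) (y : E) : ∃ N : ℝ, 1 ≤ N ∧
    domFn μ l y = moment μ (fun _ => 1) l y * (N ^ 4 + ‖y‖ ^ 4) ∧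
    ∀ d ≤ 4, ∀ ψ : E → ℝ, ExpGrowth ψ → (∀ x, |ψ x| ≤ ‖x‖ ^ d) →
      |moment μ ψ l y| ≤ moment μ (fun _ => 1) l y * N ^ d := by
  set q := moment μ (fun _ : E => (1:ℝ)) l y with hq
  have hq0 : 0 < q := moment_one_pos hl y
  have g4 := ExpGrowth.norm_pow (E := E) 4
  have g0 := ExpGrowth.const (E := E) 1
  set r := moment μ (fun x : E => ‖x‖ ^ 4) l y with hr
  have hr0 : 0 ≤ r := integral_nonneg fun x => mul_nonneg (by positivity) (tiltWeight_pos l y x).le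
  have hsum : moment μ (fun x : E => 1 + ‖x‖ ^ 4) l y = q + r := moment_add g0 g4 hl y
  -- N⁴ is the posterior mean of 1 + ‖x‖⁴; the summand 1 ensures N ≥ 1.
  set N := (1 + r / q) ^ ((1:ℝ) / 4)
  have hN1 : 1 ≤ N := Real.one_le_rpow (by simp; positivity) (by norm_num)
  have hN4 : N ^ 4 = 1 + r / q := by
    rw [← Real.rpow_natCast, ← Real.rpow_mul (by positivity)]; norm_num
  have hqN : q * N ^ 4 = q + r := by rw [hN4]; field_simp
  refine ⟨N, hN1, by rw [domFn, hsum, mul_add, hqN]; ring, fun d hd ψ hψ h => ?_⟩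
  -- Weighted AM-GM. At s = ‖x‖ / N it interpolates the moment of degree d between those of degrees
  -- 0 and 4.
  have young : ∀ s : ℝ, 0 ≤ s → s ^ d ≤ (4 - d) / 4 + d / 4 * s ^ 4 := by
    intro s hs
    interval_cases d <;> norm_num <;>
      nlinarith [sq_nonneg (s - 1), sq_nonneg (s ^ 2 - 1), mul_nonneg hs (sq_nonneg (s - 1)),
        sq_nonneg (s * (s - 1))]
  have hN0 : 0 < N := by linarith
  have hd' : (d:ℝ) ≤ 4 := by exact_mod_cast hd
  have bd : ∀ x : E, |ψ x| ≤ N ^ d * ((4 - d) / 4) * 1 + N ^ d * (d / 4) / N ^ 4 * ‖x‖ ^ 4 := by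
    intro x
    refine (h x).trans ?_
    have := mul_le_mul_of_nonneg_left (young (‖x‖ / N) (by positivity)) (by positivity : 0 ≤ N ^ d)
    rw [div_pow, mul_div_cancel₀ _ (by positivity)] at this
    refine this.trans_eq ?_
    rw [div_pow]; ring
  have gb := ((ExpGrowth.const (E := E) (N ^ d * ((4 - d) / 4))).mul g0).add
    ((ExpGrowth.const (E := E) (N ^ d * (d / 4) / N ^ 4)).mul g4)
  have key : moment μ (fun x : E => N ^ d * ((4 - d) / 4) * 1 + N ^ d * (d / 4) / N ^ 4 * ‖x‖ ^ 4) l y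
      ≤ q * N ^ d := by
    rw [moment_add ((ExpGrowth.const (E := E) (N ^ d * ((4 - d) / 4))).mul g0)
      ((ExpGrowth.const (E := E) (N ^ d * (d / 4) / N ^ 4)).mul g4) hl y,
      moment_const_mul, moment_const_mul, ← hq, ← hr]
    have : r ≤ q * N ^ 4 := by linarith
    calc _ ≤ N ^ d * ((4 - d) / 4) * q + N ^ d * (d / 4) / N ^ 4 * (q * N ^ 4) := by gcongr
      _ = _ := by field_simp; ring
  rw [abs_le]
  constructor
  · have := moment_mono (μ := μ) gb.neg hψ (fun x => neg_le_of_abs_le (bd x)) hl y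
    have e : moment μ (fun x : E => -(N ^ d * ((4 - d) / 4) * 1 + N ^ d * (d / 4) / N ^ 4 * ‖x‖ ^ 4))
      l y = -moment μ (fun x : E => N ^ d * ((4 - d) / 4) * 1 + N ^ d * (d / 4) / N ^ 4 * ‖x‖ ^ 4) l y := by
      simp only [moment, neg_mul]; exact integral_neg _
    linarith
  · exact (moment_mono (μ := μ) hψ gb (fun x => le_of_abs_le (bd x)) hl y).trans key

end Nishimori

/-! ### Evolution in l of squared posterior means -/

section InformationDerivatives

open Filter Topology
open scoped RealInnerProductSpace

variable {E : Type*} [NormedAddCommGroup E] [InnerProductSpace ℝ E] [FiniteDimensional ℝ E]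
  [MeasurableSpace E] [BorelSpace E] (μ : Measure E)

/-- The evidence `∫ exp (⟪x, y⟫ - l ‖x‖² / 2) dμ`, the density of the observation relative to
`N(0, l • 1)`. -/
noncomputable def evidence (l : ℝ) (y : E) : ℝ := moment μ (fun _ => 1) l y

/-- The unnormalised first posterior moment in the direction `u`. -/
noncomputable def moment₁ (u : E) (l : ℝ) (y : E) : ℝ := moment μ (fun x => ⟪x, u⟫) l y

/-- The unnormalised second posterior moment in the directions `u`, `v`. -/
noncomputable def moment₂ (u v : E) (l : ℝ) (y : E) : ℝ :=
  moment μ (fun x => ⟪x, u⟫ * ⟪x, v⟫) l y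

/-- The posterior mean in the direction `u`. -/
noncomputable def postMean (u : E) (l : ℝ) (y : E) : ℝ := moment₁ μ u l y / evidence μ l y

variable {μ} [IsProbabilityMeasure μ]

lemma evidence_pos {l : ℝ} (hl : 0 < l) (y : E) : 0 < evidence μ l y := moment_one_pos hl y

lemma measurable_evidence : Measurable (fun p : ℝ × E => evidence μ p.1 p.2) :=
  measurable_moment measurable_const

lemma measurable_moment₁ (u : E) : Measurable (fun p : ℝ × E => moment₁ μ u p.1 p.2) :=
  measurable_moment (ExpGrowth.inner_right u).measurable

lemma measurable_moment₂ (u v : E) : Measurable (fun p : ℝ × E => moment₂ μ u v p.1 p.2) :=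
  measurable_moment ((ExpGrowth.inner_right u).mul (ExpGrowth.inner_right v)).measurable

lemma measurable_postMean (u : E) : Measurable (fun p : ℝ × E => postMean μ u p.1 p.2) :=
  (measurable_moment₁ u).div measurable_evidence

lemma hasLineDerivAt_evidence {l : ℝ} (hl : 0 < l) (y v : E) :
    HasLineDerivAt ℝ (evidence μ l) (moment₁ μ v l y) y v := by
  simpa only [one_mul] using! hasLineDerivAt_moment (μ := μ) (ExpGrowth.const 1) hl y v

lemma hasLineDerivAt_moment₁ (u : E) {l : ℝ} (hl : 0 < l) (y v : E) :
    HasLineDerivAt ℝ (moment₁ μ u l) (moment₂ μ u v l y) y v :=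
  hasLineDerivAt_moment (ExpGrowth.inner_right u) hl y v

/-- Written through a = A / q, the derivative 2 a A' - a² q' is linear in (A', q'), with
coefficients that reappear in the second derivative below. -/
lemma hasDerivAt_sq_div {A q : ℝ → ℝ} {A' q' t : ℝ} (hA : HasDerivAt A A' t)
    (hq : HasDerivAt q q' t) (h0 : q t ≠ 0) :
    HasDerivAt (fun t => A t ^ 2 / q t) (2 * (A t / q t) * A' - (A t / q t) ^ 2 * q') t := by
  refine ((hA.pow 2).div hq h0).congr_deriv ?_
  simp only [Pi.pow_apply]
  field_simp
  norm_num
  ring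

/-- The last two terms apply the linear form of `hasDerivAt_sq_div` to the second derivatives of A
and q. They cancel against the l-derivative when A and q solve the backward heat equation, and only
the square remains. -/
lemma hasDerivAt_sq_div_deriv {A q C p : ℝ → ℝ} {C' p' t : ℝ} (hA : HasDerivAt A (C t) t)
    (hq : HasDerivAt q (p t) t) (hC : HasDerivAt C C' t) (hp : HasDerivAt p p' t) (h0 : q t ≠ 0) :
    HasDerivAt (fun t => 2 * (A t / q t) * C t - (A t / q t) ^ 2 * p t)
      (2 * (C t - A t / q t * p t) ^ 2 / q t + 2 * (A t / q t) * C' - (A t / q t) ^ 2 * p') t := by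
  have ha := hA.div hq h0
  refine (((ha.const_mul 2).mul hC).sub ((ha.pow 2).mul hp)).congr_deriv ?_
  simp only [Pi.pow_apply, Pi.div_apply]
  field_simp
  norm_num
  field_simp
  ring

/-- The backward heat equation: the left side is the Laplacian in y of the moment of ψ, and the
right side is -2 times its l-derivative. -/
lemma sum_inner_mul_inner_sq {ι : Type*} [Fintype ι] (b : OrthonormalBasis ι ℝ E) {ψ : E → ℝ}
    (hψ : ExpGrowth ψ) {l : ℝ} (hl : 0 < l) (y : E) :
    ∑ i, moment μ (fun x => ψ x * ⟪x, b i⟫ * ⟪x, b i⟫) l y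
      = -2 * moment μ (fun x => ψ x * (-(‖x‖ ^ 2 / 2))) l y := by
  rw [← moment_sum _ (fun i => (hψ.mul (ExpGrowth.inner_right (b i))).mul
    (ExpGrowth.inner_right (b i))) hl, ← moment_const_mul]
  congr 1
  funext x
  rw [← b.sum_sq_inner_left x]
  simp only [mul_assoc, ← Finset.mul_sum, pow_two]
  ring

lemma pow_mul_pow_le {N t : ℝ} (hN : 1 ≤ N) (ht : 0 ≤ t) {j k : ℕ} (h : j + k ≤ 4) :
    N ^ j * t ^ k ≤ N ^ 4 + t ^ 4 := by
  have hm : 1 ≤ max N t := le_max_of_le_left hN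
  calc N ^ j * t ^ k ≤ max N t ^ j * max N t ^ k := by
        gcongr
        exacts [le_max_left _ _, le_max_right _ _]
    _ = max N t ^ (j + k) := (pow_add _ _ _).symm
    _ ≤ max N t ^ 4 := pow_le_pow_right₀ hm h
    _ ≤ N ^ 4 + t ^ 4 := by
        rcases max_choice N t with e | e <;> rw [e]
        · exact le_add_of_nonneg_right (by positivity)
        · exact le_add_of_nonneg_left (by positivity)

/-- The first posterior moment A and the evidence q both solve the backward heat equation, so ∂_l +
Δ/2 applied to A² / q leaves only the terms (∂_i A - (A / q) ∂_i q)² / q. Each equals q times the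
square of a posterior covariance entry. -/
theorem integral_moment₁_sq_sub {ι : Type*} [Fintype ι] (b : OrthonormalBasis ι ℝ E)
    (h4 : Integrable (fun x => ‖x‖ ^ 4) μ) {u : E} (hu : ‖u‖ = 1) {l₁ l₂ : ℝ} (h₁ : 0 < l₁)
    (h₁₂ : l₁ ≤ l₂) :
    IntervalIntegrable (fun l => ∫ y, (∑ i, (moment₂ μ u (b i) l y -
        postMean μ u l y * moment₁ μ (b i) l y) ^ 2 / evidence μ l y) * gaussKernel l y)
      volume l₁ l₂ ∧
    (∫ y, moment₁ μ u l₂ y ^ 2 / evidence μ l₂ y * gaussKernel l₂ y) -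
      ∫ y, moment₁ μ u l₁ y ^ 2 / evidence μ l₁ y * gaussKernel l₁ y
    = ∫ l in l₁..l₂, ∫ y, (∑ i, (moment₂ μ u (b i) l y - postMean μ u l y * moment₁ μ (b i) l y) ^ 2
        / evidence μ l y) * gaussKernel l y := by
  have gu := ExpGrowth.inner_right u
  have gb := fun i => ExpGrowth.inner_right (b i)
  have gn : ExpGrowth (fun x : E => -(‖x‖ ^ 2 / 2)) := by
    have := (ExpGrowth.const (E := E) (-1 / 2)).mul (ExpGrowth.norm_pow 2)
    convert this using 2
    ring
  have hin : ∀ v : E, ‖v‖ = 1 → ∀ x : E, |⟪x, v⟫| ≤ ‖x‖ := fun v hv x => by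
    simpa [hv] using abs_real_inner_le_norm x v
  set mq' : ℝ → E → ℝ := fun l y => moment μ (fun x : E => 1 * (-(‖x‖ ^ 2 / 2))) l y with hmq'
  set mA' : ℝ → E → ℝ := fun l y => moment μ (fun x : E => ⟪x, u⟫ * (-(‖x‖ ^ 2 / 2))) l y with hmA'
  set m3 : ι → ℝ → E → ℝ := fun i l y =>
    moment μ (fun x : E => ⟪x, u⟫ * ⟪x, b i⟫ * ⟪x, b i⟫) l y with hm3
  have me := measurable_evidence (μ := μ)
  have m1 := measurable_moment₁ (μ := μ)
  have m2 := measurable_moment₂ (μ := μ)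
  have mm := measurable_postMean (μ := μ)
  have mq'm : Measurable (fun p : ℝ × E => mq' p.1 p.2) :=
    measurable_moment ((ExpGrowth.const 1).mul gn).measurable
  have mA'm : Measurable (fun p : ℝ × E => mA' p.1 p.2) :=
    measurable_moment (gu.mul gn).measurable
  have m3m : ∀ i, Measurable (fun p : ℝ × E => m3 i p.1 p.2) := fun i =>
    measurable_moment ((gu.mul (gb i)).mul (gb i)).measurable
  have sec : ∀ {f : ℝ → E → ℝ}, Measurable (fun p : ℝ × E => f p.1 p.2) → ∀ l, Measurable (f l) :=
    fun hf l => hf.comp (measurable_prodMk_left (x := l))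
  have bnd : ∀ l ∈ Icc l₁ l₂, ∀ y, ∃ N : ℝ, 1 ≤ N ∧ (∀ d ≤ 4, N ^ d ≤ N ^ 4) ∧ 0 < N ∧
      (∀ j k, j + k ≤ 4 → N ^ j * ‖y‖ ^ k ≤ N ^ 4 + ‖y‖ ^ 4) ∧ 0 < evidence μ l y ∧
      domFn μ l y = evidence μ l y * (N ^ 4 + ‖y‖ ^ 4) ∧ |postMean μ u l y| ≤ N ∧
      |mA' l y| ≤ evidence μ l y * N ^ 3 ∧ |mq' l y| ≤ evidence μ l y * N ^ 2 ∧
      |moment₁ μ u l y| ≤ evidence μ l y * N ∧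
      ∀ i, |moment₁ μ (b i) l y| ≤ evidence μ l y * N ∧
        |moment₂ μ u (b i) l y| ≤ evidence μ l y * N ^ 2 ∧
        |moment₂ μ (b i) (b i) l y| ≤ evidence μ l y * N ^ 2 ∧
        |m3 i l y| ≤ evidence μ l y * N ^ 3 := by
    intro l hl y
    have hl0 : 0 < l := h₁.trans_le hl.1
    obtain ⟨N, hN, hD, hb⟩ := exists_moment_bound (μ := μ) hl0 y
    have hq := evidence_pos (μ := μ) hl0 y
    have hu1 : |moment₁ μ u l y| ≤ evidence μ l y * N := by
      simpa using! hb 1 (by norm_num) _ gu fun x => by simpa using hin u hu x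
    refine ⟨N, hN, fun d hd => pow_le_pow_right₀ hN hd, by linarith,
      fun j k hjk => pow_mul_pow_le hN (norm_nonneg y) hjk, hq, hD, ?_, ?_, ?_, hu1, fun i =>
      ⟨?_, ?_, ?_, ?_⟩⟩
    · rw [postMean, abs_div, abs_of_pos hq, div_le_iff₀ hq]
      linarith
    · refine hb 3 (by norm_num) _ (gu.mul gn) fun x => ?_
      rw [abs_mul, abs_neg, abs_of_nonneg (by positivity : (0:ℝ) ≤ ‖x‖ ^ 2 / 2)]
      calc _ ≤ ‖x‖ * (‖x‖ ^ 2 / 2) := by gcongr; exact hin u hu x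
        _ ≤ _ := by nlinarith [pow_nonneg (norm_nonneg x) 3]
    · refine hb 2 (by norm_num) _ ((ExpGrowth.const 1).mul gn) fun x => ?_
      rw [one_mul, abs_neg, abs_of_nonneg (by positivity : (0:ℝ) ≤ ‖x‖ ^ 2 / 2)]
      linarith [pow_nonneg (norm_nonneg x) 2]
    · simpa using! hb 1 (by norm_num) _ (gb i) fun x => by simpa using hin _ (b.norm_eq_one i) x
    · refine hb 2 (by norm_num) _ (gu.mul (gb i)) fun x => ?_
      rw [abs_mul, pow_two]
      gcongr
      exacts [hin u hu x, hin _ (b.norm_eq_one i) x]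
    · refine hb 2 (by norm_num) _ ((gb i).mul (gb i)) fun x => ?_
      rw [abs_mul, pow_two]
      gcongr <;> exact hin _ (b.norm_eq_one i) x
    · refine hb 3 (by norm_num) _ ((gu.mul (gb i)).mul (gb i)) fun x => ?_
      rw [abs_mul, abs_mul, pow_succ, pow_two]
      gcongr
      exacts [hin u hu x, hin _ (b.norm_eq_one i) x, hin _ (b.norm_eq_one i) x]
  have key := integral_mul_gaussKernel_sub b
    (Φ := fun l y => moment₁ μ u l y ^ 2 / evidence μ l y)
    (Φ' := fun l y => 2 * postMean μ u l y * mA' l y - postMean μ u l y ^ 2 * mq' l y)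
    (Φ1 := fun i l y => 2 * postMean μ u l y * moment₂ μ u (b i) l y -
      postMean μ u l y ^ 2 * moment₁ μ (b i) l y)
    (Φ2 := fun i l y => 2 * (moment₂ μ u (b i) l y - postMean μ u l y * moment₁ μ (b i) l y) ^ 2
        / evidence μ l y + 2 * postMean μ u l y * m3 i l y
        - postMean μ u l y ^ 2 * moment₂ μ (b i) (b i) l y)
    -- The largest constant is needed for Φ2: its three terms contribute 8 + 2 + 1.
    (D := fun l y => 11 * domFn μ l y) h₁ h₁₂ ?_ ?_ ?_ ?_ ?_ ?_ ?_ ?_ ?_ ?_ ?_ ?_ ?_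
  -- The cancellation: the heat equations s1 and s2 remove everything except the squares.
  · have hcongr : ∀ l ∈ Icc l₁ l₂, ∫ y, (2 * postMean μ u l y * mA' l y -
        postMean μ u l y ^ 2 * mq' l y + 1 / 2 * ∑ i, (2 * (moment₂ μ u (b i) l y -
        postMean μ u l y * moment₁ μ (b i) l y) ^ 2 / evidence μ l y +
        2 * postMean μ u l y * m3 i l y - postMean μ u l y ^ 2 * moment₂ μ (b i) (b i) l y)) *
        gaussKernel l y = ∫ y, (∑ i, (moment₂ μ u (b i) l y -
        postMean μ u l y * moment₁ μ (b i) l y) ^ 2 / evidence μ l y) * gaussKernel l y := by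
      intro l hl
      have hl0 : 0 < l := h₁.trans_le hl.1
      refine integral_congr_ae (Eventually.of_forall fun y => ?_)
      have s1 := sum_inner_mul_inner_sq (μ := μ) b gu hl0 y
      have s2 := sum_inner_mul_inner_sq (μ := μ) b (ExpGrowth.const 1) hl0 y
      simp only [one_mul] at s2
      simp only [Finset.sum_sub_distrib, Finset.sum_add_distrib, mul_div_assoc, ← Finset.mul_sum,
        moment₂, hm3, s1, s2, hmA', hmq', one_mul]
      ring
    refine ⟨key.1.congr fun l hl => ?_, key.2.trans (intervalIntegral.integral_congr fun l hl => ?_)⟩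
    · exact hcongr l (Ioc_subset_Icc_self (by rwa [uIoc_of_le h₁₂] at hl))
    · exact hcongr l (by rwa [uIcc_of_le h₁₂] at hl)
  · exact (((m1 u).pow_const 2).div me)
  · exact ((measurable_const.mul (mm u)).mul mA'm).sub (((mm u).pow_const 2).mul mq'm)
  · intro i l
    exact ((measurable_const.mul (sec (mm u) l)).mul (sec (m2 u (b i)) l)).sub
      (((sec (mm u) l).pow_const 2).mul (sec (m1 (b i)) l))
  · intro i l
    have := sec (mm u) l
    have := sec (m2 u (b i)) l
    have := sec (m1 (b i)) l
    have := sec (m2 (b i) (b i)) l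
    have := sec me l
    have := sec (m3m i) l
    fun_prop
  · intro l hl y
    have hl0 : 0 < l := h₁.trans_le hl.1
    exact hasDerivAt_sq_div (hasDerivAt_moment_param gu hl0 y)
      (hasDerivAt_moment_param (ExpGrowth.const 1) hl0 y) (evidence_pos hl0 y).ne'
  · intro i l hl y
    have hl0 : 0 < l := h₁.trans_le hl.1
    have := hasDerivAt_sq_div (hasLineDerivAt_moment₁ (μ := μ) u hl0 y (b i))
      (hasLineDerivAt_evidence (μ := μ) hl0 y (b i)) (evidence_pos hl0 _).ne'
    simpa only [zero_smul, add_zero] using! this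
  · intro i l hl y
    have hl0 : 0 < l := h₁.trans_le hl.1
    have := hasDerivAt_sq_div_deriv (t := 0)
      (A := fun t => moment₁ μ u l (y + t • b i)) (q := fun t => evidence μ l (y + t • b i))
      (C := fun t => moment₂ μ u (b i) l (y + t • b i))
      (p := fun t => moment₁ μ (b i) l (y + t • b i))
      (by simpa only [zero_smul, add_zero] using! hasLineDerivAt_moment₁ (μ := μ) u hl0 y (b i))
      (by simpa only [zero_smul, add_zero] using! hasLineDerivAt_evidence (μ := μ) hl0 y (b i))
      (hasLineDerivAt_moment (μ := μ) (gu.mul (gb i)) hl0 y (b i))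
      (hasLineDerivAt_moment₁ (μ := μ) (b i) hl0 y (b i)) (evidence_pos hl0 _).ne'
    simpa only [zero_smul, add_zero] using! this
  · intro l hl y
    obtain ⟨N, hN, t, h0, ht, hq, hD, ha, -, -, hA, -⟩ := bnd l hl y
    rw [hD]
    have : |moment₁ μ u l y ^ 2 / evidence μ l y| ≤ evidence μ l y * N ^ 2 := by
      rw [abs_div, abs_pow, abs_of_pos hq, div_le_iff₀ hq]
      calc _ ≤ (evidence μ l y * N) ^ 2 := by gcongr
        _ = _ := by ring
    calc _ ≤ evidence μ l y * N ^ 2 * (1 + ‖y‖ ^ 2) := by gcongr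
      _ = evidence μ l y * (N ^ 2 * (1 + ‖y‖ ^ 2)) := by ring
      _ ≤ evidence μ l y * (11 * (N ^ 4 + ‖y‖ ^ 4)) := by
        refine mul_le_mul_of_nonneg_left ?_ hq.le
        have := ht 2 2 (by norm_num)
        have := t 2 (by norm_num)
        have : 0 ≤ ‖y‖ ^ 4 := by positivity
        nlinarith
      _ = _ := by ring
  · intro l hl y
    obtain ⟨N, hN, t, h0, ht, hq, hD, ha, hA', hq', -, -⟩ := bnd l hl y
    rw [hD]
    calc _ ≤ |2 * postMean μ u l y * mA' l y| + |postMean μ u l y ^ 2 * mq' l y| := abs_sub _ _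
      _ = 2 * |postMean μ u l y| * |mA' l y| + |postMean μ u l y| ^ 2 * |mq' l y| := by
        simp only [abs_mul, abs_pow, abs_two]
      _ ≤ 2 * N * (evidence μ l y * N ^ 3) + N ^ 2 * (evidence μ l y * N ^ 2) := by gcongr
      _ = evidence μ l y * (3 * N ^ 4) := by ring
      _ ≤ evidence μ l y * (11 * (N ^ 4 + ‖y‖ ^ 4)) := by
        refine mul_le_mul_of_nonneg_left ?_ hq.le
        have : 0 ≤ ‖y‖ ^ 4 := by positivity
        nlinarith [t 4 le_rfl]
      _ = _ := by ring
  · intro i l hl y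
    obtain ⟨N, hN, t, h0, ht, hq, hD, ha, -, -, -, hi⟩ := bnd l hl y
    obtain ⟨hb, hub, -, -⟩ := hi i
    rw [hD]
    have e : |2 * postMean μ u l y * moment₂ μ u (b i) l y - postMean μ u l y ^ 2 *
        moment₁ μ (b i) l y| ≤ evidence μ l y * (3 * N ^ 3) := by
      calc _ ≤ |2 * postMean μ u l y * moment₂ μ u (b i) l y| +
            |postMean μ u l y ^ 2 * moment₁ μ (b i) l y| := abs_sub _ _
        _ = 2 * |postMean μ u l y| * |moment₂ μ u (b i) l y| +
            |postMean μ u l y| ^ 2 * |moment₁ μ (b i) l y| := by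
          simp only [abs_mul, abs_pow, abs_two]
        _ ≤ 2 * N * (evidence μ l y * N ^ 2) + N ^ 2 * (evidence μ l y * N) := by gcongr
        _ = _ := by ring
    calc _ ≤ evidence μ l y * (3 * N ^ 3) * (1 + ‖y‖) := by gcongr
      _ = evidence μ l y * (3 * (N ^ 3 + N ^ 3 * ‖y‖)) := by ring
      _ ≤ evidence μ l y * (11 * (N ^ 4 + ‖y‖ ^ 4)) := by
        refine mul_le_mul_of_nonneg_left ?_ hq.le
        have := ht 3 1 (by norm_num)
        have := t 3 (by norm_num)
        have : 0 ≤ ‖y‖ ^ 4 := by positivity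
        simp only [pow_one] at *
        nlinarith
      _ = _ := by ring
  · intro i l hl y
    obtain ⟨N, hN, t, h0, ht, hq, hD, ha, -, -, -, hi⟩ := bnd l hl y
    obtain ⟨hb, hub, hbb, h3⟩ := hi i
    rw [hD]
    have e1 : |moment₂ μ u (b i) l y - postMean μ u l y * moment₁ μ (b i) l y|
        ≤ 2 * (evidence μ l y * N ^ 2) := by
      calc _ ≤ |moment₂ μ u (b i) l y| + |postMean μ u l y * moment₁ μ (b i) l y| := abs_sub _ _
        _ = |moment₂ μ u (b i) l y| + |postMean μ u l y| * |moment₁ μ (b i) l y| := by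
          rw [abs_mul]
        _ ≤ evidence μ l y * N ^ 2 + N * (evidence μ l y * N) := by gcongr
        _ = _ := by ring
    have e2 : |2 * (moment₂ μ u (b i) l y - postMean μ u l y * moment₁ μ (b i) l y) ^ 2
        / evidence μ l y| ≤ evidence μ l y * (8 * N ^ 4) := by
      rw [abs_div, abs_mul, abs_two, abs_pow, abs_of_pos hq, div_le_iff₀ hq]
      calc _ ≤ 2 * (2 * (evidence μ l y * N ^ 2)) ^ 2 := by gcongr
        _ = _ := by ring
    calc _ ≤ |2 * (moment₂ μ u (b i) l y - postMean μ u l y * moment₁ μ (b i) l y) ^ 2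
          / evidence μ l y| + |2 * postMean μ u l y * m3 i l y|
          + |postMean μ u l y ^ 2 * moment₂ μ (b i) (b i) l y| :=
          (abs_sub _ _).trans (add_le_add_left (abs_add_le _ _) _)
      _ = |2 * (moment₂ μ u (b i) l y - postMean μ u l y * moment₁ μ (b i) l y) ^ 2
          / evidence μ l y| + 2 * |postMean μ u l y| * |m3 i l y|
          + |postMean μ u l y| ^ 2 * |moment₂ μ (b i) (b i) l y| := by
          simp only [abs_mul, abs_pow, abs_two]
      _ ≤ evidence μ l y * (8 * N ^ 4) + 2 * N * (evidence μ l y * N ^ 3)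
          + N ^ 2 * (evidence μ l y * N ^ 2) := by gcongr
      _ = evidence μ l y * (11 * N ^ 4) := by ring
      _ ≤ evidence μ l y * (11 * (N ^ 4 + ‖y‖ ^ 4)) := by
        refine mul_le_mul_of_nonneg_left ?_ hq.le
        have : 0 ≤ ‖y‖ ^ 4 := by positivity
        linarith
      _ = _ := by ring
  · simpa only [mul_assoc] using (integrable_domFn_prod h4 h₁ (l₂ := l₂)).const_mul 11
  · intro l hl
    simpa only [mul_assoc] using (integrable_domFn h4 (h₁.trans_le hl.1)).const_mul 11

end InformationDerivatives

/-! ### Growth of the log-evidence and evolution of the output entropy -/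

section Entropy

open Filter Topology
open scoped RealInnerProductSpace

variable {E : Type*} [NormedAddCommGroup E] [InnerProductSpace ℝ E] [FiniteDimensional ℝ E]
  [MeasurableSpace E] [BorelSpace E] {μ : Measure E} [IsProbabilityMeasure μ]

lemma integrable_norm_pow_of_le (h4 : Integrable (fun x => ‖x‖ ^ 4) μ) {d : ℕ} (hd : d ≤ 4) :
    Integrable (fun x : E => ‖x‖ ^ d) μ := by
  refine ((integrable_const (1:ℝ)).add h4).mono' (by fun_prop) (Eventually.of_forall fun x => ?_)
  have := pow_mul_pow_le (le_refl (1:ℝ)) (norm_nonneg x) (j := 0) (k := d) (by omega)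
  simpa using this

/-- The bound is the maximum over x of the integrand, and μ has mass one. -/
lemma evidence_le {l : ℝ} (hl : 0 < l) (y : E) :
    evidence μ l y ≤ Real.exp (‖y‖ ^ 2 / (2 * l)) := by
  have := integral_mono (((ExpGrowth.const (E := E) 1).integrable (μ := μ) hl y))
    (integrable_const (Real.exp (‖y‖ ^ 2 / (2 * l)))) fun x => ?_
  · simpa [evidence, moment] using this
  · simpa using exp_mul_tiltWeight_le (k := 0) (x := x) hl le_rfl (le_refl ‖y‖)

/-- Jensen's inequality for exp bounds the log-evidence below by the prior mean of the exponent. -/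
lemma le_log_evidence (h4 : Integrable (fun x => ‖x‖ ^ 4) μ) {l : ℝ} (hl : 0 < l) (y : E) :
    -(‖y‖ * (∫ x, ‖x‖ ∂μ) + l / 2 * ∫ x, ‖x‖ ^ 2 ∂μ) ≤ Real.log (evidence μ l y) := by
  have i1 : Integrable (fun x : E => ‖x‖) μ := by
    simpa using integrable_norm_pow_of_le h4 (d := 1) (by norm_num)
  have i2 := integrable_norm_pow_of_le h4 (d := 2) (by norm_num)
  have i3 : Integrable (fun x : E => ⟪x, y⟫) μ :=
    (i1.mul_const ‖y‖).mono' (by fun_prop) (Eventually.of_forall fun x => abs_real_inner_le_norm x y)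
  have i4 : Integrable (fun x : E => ⟪x, y⟫ - l * ‖x‖ ^ 2 / 2) μ := by
    refine (i3.sub (i2.const_mul (l / 2))).congr (Eventually.of_forall fun x => ?_)
    simp only [Pi.sub_apply]
    ring
  rw [Real.le_log_iff_exp_le (evidence_pos hl y)]
  have jensen : Real.exp (∫ x, (⟪x, y⟫ - l * ‖x‖ ^ 2 / 2) ∂μ) ≤ evidence μ l y := by
    have := convexOn_exp.map_integral_le (μ := μ) (f := fun x : E => ⟪x, y⟫ - l * ‖x‖ ^ 2 / 2)
      Real.continuous_exp.continuousOn isClosed_univ (by simp) i4 ?_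
    · simpa [evidence, moment, tiltWeight] using this
    · simpa [Function.comp_def, tiltWeight] using (ExpGrowth.const (E := E) 1).integrable (μ := μ) hl y
  refine le_trans (Real.exp_le_exp.2 ?_) jensen
  rw [mul_comm ‖y‖, ← integral_mul_const, ← integral_const_mul, ← integral_add (i1.mul_const _)
    (i2.const_mul _), ← integral_neg]
  refine integral_mono ((i1.mul_const _).add (i2.const_mul _)).neg i4 fun x => ?_
  have := neg_le_of_abs_le (abs_real_inner_le_norm x y)
  simp only
  linarith

/-- A logarithm counts as degree two in y, so the terms arising from q log q stay within the degree
four that `domFn` controls. -/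
lemma exists_abs_log_evidence_le (h4 : Integrable (fun x => ‖x‖ ^ 4) μ) {l₁ l₂ : ℝ}
    (h₁ : 0 < l₁) : ∃ K, 0 ≤ K ∧ ∀ l ∈ Icc l₁ l₂, ∀ y : E,
      |Real.log (evidence μ l y)| ≤ K * (1 + ‖y‖ ^ 2) := by
  have n1 : 0 ≤ ∫ x, ‖x‖ ∂μ := integral_nonneg fun x => norm_nonneg x
  have n2 : 0 ≤ ∫ x, ‖x‖ ^ 2 ∂μ := integral_nonneg fun x => by positivity
  refine ⟨1 / (2 * l₁) + (∫ x, ‖x‖ ∂μ) + |l₂| / 2 * ∫ x, ‖x‖ ^ 2 ∂μ, by positivity,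
    fun l hl y => ?_⟩
  have hl0 : 0 < l := h₁.trans_le hl.1
  have p1 : 0 ≤ 1 / (2 * l₁) := by positivity
  have p2 : 0 ≤ |l₂| / 2 * ∫ x, ‖x‖ ^ 2 ∂μ := by positivity
  have py : ‖y‖ ≤ 1 + ‖y‖ ^ 2 := by nlinarith [sq_nonneg (‖y‖ - 1)]
  have py2 : 0 ≤ ‖y‖ ^ 2 := by positivity
  rw [abs_le]
  constructor
  · have h := le_log_evidence h4 hl0 y
    have h2 : l / 2 * ∫ x, ‖x‖ ^ 2 ∂μ ≤ |l₂| / 2 * ∫ x, ‖x‖ ^ 2 ∂μ := by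
      have := hl.2.trans (le_abs_self l₂)
      gcongr
    nlinarith [mul_le_mul_of_nonneg_right py n1, mul_nonneg p1 py2, mul_nonneg p2 py2]
  · have h := Real.log_le_log (evidence_pos hl0 y) (evidence_le (μ := μ) hl0 y)
    rw [Real.log_exp] at h
    have h2 : ‖y‖ ^ 2 / (2 * l) ≤ 1 / (2 * l₁) * ‖y‖ ^ 2 := by
      rw [div_mul_eq_mul_div, one_mul]
      exact div_le_div_of_nonneg_left (by positivity) (by positivity) (by linarith [hl.1])
    nlinarith [mul_nonneg n1 py2, mul_nonneg p2 py2]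

/-- Every derivative of q log q carries the factor log q + 1 on a derivative of q, and these terms
cancel by the backward heat equation. What is left is half the sum of (∂_i q)² / q, that is, q / 2
times the squared norm of the posterior mean. -/
theorem integral_evidence_mul_log_sub {ι : Type*} [Fintype ι] (b : OrthonormalBasis ι ℝ E)
    (h4 : Integrable (fun x => ‖x‖ ^ 4) μ) {l₁ l₂ : ℝ} (h₁ : 0 < l₁) (h₁₂ : l₁ ≤ l₂) :
    IntervalIntegrable (fun l => ∫ y, (1 / 2 * ∑ i, moment₁ μ (b i) l y ^ 2 / evidence μ l y) *
      gaussKernel l y) volume l₁ l₂ ∧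
    (∫ y, evidence μ l₂ y * Real.log (evidence μ l₂ y) * gaussKernel l₂ y) -
      ∫ y, evidence μ l₁ y * Real.log (evidence μ l₁ y) * gaussKernel l₁ y
    = ∫ l in l₁..l₂, ∫ y, (1 / 2 * ∑ i, moment₁ μ (b i) l y ^ 2 / evidence μ l y) *
      gaussKernel l y := by
  obtain ⟨K, hK0, hK⟩ := exists_abs_log_evidence_le h4 (l₂ := l₂) h₁
  have gn : ExpGrowth (fun x : E => -(‖x‖ ^ 2 / 2)) := by
    have := (ExpGrowth.const (E := E) (-1 / 2)).mul (ExpGrowth.norm_pow 2)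
    convert this using 2
    ring
  have gb := fun i => ExpGrowth.inner_right (b i)
  have hin : ∀ i, ∀ x : E, |⟪x, b i⟫| ≤ ‖x‖ := fun i x => by
    simpa using abs_real_inner_le_norm x (b i)
  set mq' : ℝ → E → ℝ := fun l y => moment μ (fun x : E => 1 * (-(‖x‖ ^ 2 / 2))) l y with hmq'
  have me := measurable_evidence (μ := μ)
  have m1 := measurable_moment₁ (μ := μ)
  have m2 := measurable_moment₂ (μ := μ)
  have mq'm : Measurable (fun p : ℝ × E => mq' p.1 p.2) :=
    measurable_moment ((ExpGrowth.const 1).mul gn).measurable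
  have sec : ∀ {f : ℝ → E → ℝ}, Measurable (fun p : ℝ × E => f p.1 p.2) → ∀ l, Measurable (f l) :=
    fun hf l => hf.comp (measurable_prodMk_left (x := l))
  have bnd : ∀ l ∈ Icc l₁ l₂, ∀ y, ∃ N : ℝ, 1 ≤ N ∧ 0 < N ∧
      (∀ j k, j + k ≤ 4 → N ^ j * ‖y‖ ^ k ≤ N ^ 4 + ‖y‖ ^ 4) ∧ 0 < evidence μ l y ∧
      domFn μ l y = evidence μ l y * (N ^ 4 + ‖y‖ ^ 4) ∧
      |mq' l y| ≤ evidence μ l y * N ^ 2 ∧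
      ∀ i, |moment₁ μ (b i) l y| ≤ evidence μ l y * N ∧
        |moment₂ μ (b i) (b i) l y| ≤ evidence μ l y * N ^ 2 := by
    intro l hl y
    have hl0 : 0 < l := h₁.trans_le hl.1
    obtain ⟨N, hN, hD, hb⟩ := exists_moment_bound (μ := μ) hl0 y
    have hq := evidence_pos (μ := μ) hl0 y
    refine ⟨N, hN, by linarith,
      fun j k hjk => pow_mul_pow_le hN (norm_nonneg y) hjk, hq, hD, ?_, fun i => ⟨?_, ?_⟩⟩
    · refine hb 2 (by norm_num) _ ((ExpGrowth.const 1).mul gn) fun x => ?_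
      rw [one_mul, abs_neg, abs_of_nonneg (by positivity : (0:ℝ) ≤ ‖x‖ ^ 2 / 2)]
      linarith [pow_nonneg (norm_nonneg x) 2]
    · simpa using! hb 1 (by norm_num) _ (gb i) fun x => by simpa using hin i x
    · refine hb 2 (by norm_num) _ ((gb i).mul (gb i)) fun x => ?_
      rw [abs_mul, pow_two]
      gcongr <;> exact hin i x
  have hlog : ∀ l ∈ Icc l₁ l₂, ∀ y : E, |Real.log (evidence μ l y) + 1|
      ≤ (K + 1) * (1 + ‖y‖ ^ 2) := by
    intro l hl y
    have := (abs_add_le (Real.log (evidence μ l y)) 1).trans (add_le_add_left (hK l hl y) _)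
    rw [abs_one] at this
    nlinarith [sq_nonneg ‖y‖]
  have key := integral_mul_gaussKernel_sub b
    (Φ := fun l y => evidence μ l y * Real.log (evidence μ l y))
    (Φ' := fun l y => mq' l y * (Real.log (evidence μ l y) + 1))
    (Φ1 := fun i l y => moment₁ μ (b i) l y * (Real.log (evidence μ l y) + 1))
    (Φ2 := fun i l y => moment₂ μ (b i) (b i) l y * (Real.log (evidence μ l y) + 1) +
      moment₁ μ (b i) l y ^ 2 / evidence μ l y)
    -- The 4 counts the monomials of (1 + ‖y‖²)(1 + ‖y‖), and with multiplicity those of (1 +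
    -- ‖y‖²)².
    (D := fun l y => 4 * (K + 1) * domFn μ l y) h₁ h₁₂ ?_ ?_ ?_ ?_ ?_ ?_ ?_ ?_ ?_ ?_ ?_ ?_ ?_
  · have hcongr : ∀ l ∈ Icc l₁ l₂, ∫ y, (mq' l y * (Real.log (evidence μ l y) + 1) +
        1 / 2 * ∑ i, (moment₂ μ (b i) (b i) l y * (Real.log (evidence μ l y) + 1) +
        moment₁ μ (b i) l y ^ 2 / evidence μ l y)) * gaussKernel l y
        = ∫ y, (1 / 2 * ∑ i, moment₁ μ (b i) l y ^ 2 / evidence μ l y) * gaussKernel l y := by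
      intro l hl
      have hl0 : 0 < l := h₁.trans_le hl.1
      refine integral_congr_ae (Eventually.of_forall fun y => ?_)
      have s2 := sum_inner_mul_inner_sq (μ := μ) b (ExpGrowth.const 1) hl0 y
      simp only [one_mul] at s2
      simp only [Finset.sum_add_distrib, ← Finset.sum_mul, moment₂, s2, hmq', one_mul]
      ring
    refine ⟨key.1.congr fun l hl => ?_, key.2.trans (intervalIntegral.integral_congr fun l hl => ?_)⟩
    · exact hcongr l (Ioc_subset_Icc_self (by rwa [uIoc_of_le h₁₂] at hl))
    · exact hcongr l (by rwa [uIcc_of_le h₁₂] at hl)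
  · exact me.mul me.log
  · exact mq'm.mul (me.log.add_const 1)
  · intro i l
    exact (sec (m1 (b i)) l).mul ((sec me l).log.add_const 1)
  · intro i l
    exact ((sec (m2 (b i) (b i)) l).mul ((sec me l).log.add_const 1)).add
      (((sec (m1 (b i)) l).pow_const 2).div (sec me l))
  · intro l hl y
    have hl0 : 0 < l := h₁.trans_le hl.1
    have hd := hasDerivAt_moment_param (μ := μ) (ExpGrowth.const 1) hl0 y
    refine (HasDerivAt.mul hd (hd.log (evidence_pos hl0 y).ne')).congr_deriv ?_
    have := (evidence_pos (μ := μ) hl0 y).ne'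
    simp only [hmq', evidence] at *
    field_simp
  · intro i l hl y
    have hl0 : 0 < l := h₁.trans_le hl.1
    have hd := hasLineDerivAt_evidence (μ := μ) hl0 y (b i)
    refine (HasDerivAt.mul hd (HasDerivAt.log hd (evidence_pos hl0 _).ne')).congr_deriv ?_
    have := (evidence_pos (μ := μ) hl0 y).ne'
    simp only [zero_smul, add_zero]
    field_simp
  · intro i l hl y
    have hl0 : 0 < l := h₁.trans_le hl.1
    have hd := hasLineDerivAt_evidence (μ := μ) hl0 y (b i)
    have hm := hasLineDerivAt_moment₁ (μ := μ) (b i) hl0 y (b i)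
    refine (HasDerivAt.mul hm ((HasDerivAt.log hd (evidence_pos hl0 _).ne').add_const 1)).congr_deriv
      ?_
    simp only [zero_smul, add_zero]
    ring
  · intro l hl y
    obtain ⟨N, hN, h0, ht, hq, hD, -, -⟩ := bnd l hl y
    rw [hD, abs_mul, abs_of_pos hq]
    calc _ ≤ evidence μ l y * (K * (1 + ‖y‖ ^ 2)) * (1 + ‖y‖ ^ 2) := by gcongr; exact hK l hl y
      _ = evidence μ l y * (K * (1 + 2 * ‖y‖ ^ 2 + ‖y‖ ^ 4)) := by ring
      _ ≤ evidence μ l y * ((K + 1) * (4 * (N ^ 4 + ‖y‖ ^ 4))) := by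
        have h00 := ht 0 0 (by norm_num)
        have h02 := ht 0 2 (by norm_num)
        have h04 := ht 0 4 (by norm_num)
        simp only [pow_zero, one_mul] at h00 h02 h04
        refine mul_le_mul_of_nonneg_left (mul_le_mul (by linarith) (by linarith) (by positivity)
          (by positivity)) hq.le
      _ = _ := by ring
  · intro l hl y
    obtain ⟨N, hN, h0, ht, hq, hD, hq', -⟩ := bnd l hl y
    rw [hD, abs_mul]
    calc _ ≤ evidence μ l y * N ^ 2 * ((K + 1) * (1 + ‖y‖ ^ 2)) := by gcongr; exact hlog l hl y
      _ = evidence μ l y * ((K + 1) * (N ^ 2 + N ^ 2 * ‖y‖ ^ 2)) := by ring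
      _ ≤ evidence μ l y * ((K + 1) * (4 * (N ^ 4 + ‖y‖ ^ 4))) := by
        have h20 := ht 2 0 (by norm_num)
        have h22 := ht 2 2 (by norm_num)
        simp only [pow_zero, mul_one] at h20 h22
        have : 0 ≤ N ^ 4 + ‖y‖ ^ 4 := by positivity
        refine mul_le_mul_of_nonneg_left (mul_le_mul_of_nonneg_left (by linarith)
          (by positivity)) hq.le
      _ = _ := by ring
  · intro i l hl y
    obtain ⟨N, hN, h0, ht, hq, hD, -, hi⟩ := bnd l hl y
    rw [hD, abs_mul]
    calc _ ≤ evidence μ l y * N * ((K + 1) * (1 + ‖y‖ ^ 2)) * (1 + ‖y‖) := by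
            gcongr
            exacts [(hi i).1, hlog l hl y]
      _ = evidence μ l y * ((K + 1) * (N + N * ‖y‖ + N * ‖y‖ ^ 2 + N * ‖y‖ ^ 3)) := by ring
      _ ≤ evidence μ l y * ((K + 1) * (4 * (N ^ 4 + ‖y‖ ^ 4))) := by
        have e0 := ht 1 0 (by norm_num)
        have e1 := ht 1 1 (by norm_num)
        have e2 := ht 1 2 (by norm_num)
        have e3 := ht 1 3 (by norm_num)
        simp only [pow_zero, mul_one, pow_one] at e0 e1 e2 e3
        refine mul_le_mul_of_nonneg_left (mul_le_mul_of_nonneg_left (by linarith)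
          (by positivity)) hq.le
      _ = _ := by ring
  · intro i l hl y
    obtain ⟨N, hN, h0, ht, hq, hD, -, hi⟩ := bnd l hl y
    rw [hD]
    have e : |moment₁ μ (b i) l y ^ 2 / evidence μ l y| ≤ evidence μ l y * N ^ 2 := by
      rw [abs_div, abs_pow, abs_of_pos hq, div_le_iff₀ hq]
      calc _ ≤ (evidence μ l y * N) ^ 2 := by gcongr; exact (hi i).1
        _ = _ := by ring
    calc _ ≤ |moment₂ μ (b i) (b i) l y| * |Real.log (evidence μ l y) + 1| +
          |moment₁ μ (b i) l y ^ 2 / evidence μ l y| := by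
            rw [← abs_mul]; exact abs_add_le _ _
      _ ≤ evidence μ l y * N ^ 2 * ((K + 1) * (1 + ‖y‖ ^ 2)) + evidence μ l y * N ^ 2 := by
            gcongr
            exacts [(hi i).2, hlog l hl y]
      _ = evidence μ l y * ((K + 1) * (N ^ 2 + N ^ 2 * ‖y‖ ^ 2) + N ^ 2) := by ring
      _ ≤ evidence μ l y * ((K + 1) * (4 * (N ^ 4 + ‖y‖ ^ 4))) := by
        have h20 := ht 2 0 (by norm_num)
        have h22 := ht 2 2 (by norm_num)
        simp only [pow_zero, mul_one] at h20 h22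
        have : 0 ≤ N ^ 4 + ‖y‖ ^ 4 := by positivity
        refine mul_le_mul_of_nonneg_left ?_ hq.le
        nlinarith
      _ = _ := by ring
  · simpa only [mul_assoc] using (integrable_domFn_prod h4 h₁ (l₂ := l₂)).const_mul (4 * (K + 1))
  · intro l hl
    simpa only [mul_assoc] using (integrable_domFn h4 (h₁.trans_le hl.1)).const_mul (4 * (K + 1))

end Entropy

/-! ### The minimum mean square error and the I-MMSE relation -/

section MMSE

open Filter Topology
open scoped RealInnerProductSpace

variable {E : Type*} [NormedAddCommGroup E] [InnerProductSpace ℝ E] [FiniteDimensional ℝ E]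
  [MeasurableSpace E] [BorelSpace E] {μ : Measure E} [IsProbabilityMeasure μ]

lemma moment_nonneg {ψ : E → ℝ} (h : ∀ x, 0 ≤ ψ x) (l : ℝ) (y : E) : 0 ≤ moment μ ψ l y :=
  integral_nonneg fun x => mul_nonneg (h x) (tiltWeight_pos l y x).le

/-- The Cauchy-Schwarz inequality for the unnormalised posterior. -/
lemma moment_mul_sq_le {f g : E → ℝ} (hf : ExpGrowth f) (hg : ExpGrowth g) {l : ℝ} (hl : 0 < l)
    (y : E) : moment μ (fun x => f x * g x) l y ^ 2
      ≤ moment μ (fun x => f x ^ 2) l y * moment μ (fun x => g x ^ 2) l y := by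
  have hff : ExpGrowth (fun x => f x ^ 2) := by simpa [pow_two] using hf.mul hf
  have hgg : ExpGrowth (fun x => g x ^ 2) := by simpa [pow_two] using hg.mul hg
  have h : ∀ t : ℝ, 0 ≤ moment μ (fun x => f x ^ 2) l y * (t * t) +
      (2 * moment μ (fun x => f x * g x) l y) * t + moment μ (fun x => g x ^ 2) l y := by
    intro t
    have e : moment μ (fun x => (t * t * f x ^ 2 + 2 * t * (f x * g x)) + g x ^ 2) l y
        = moment μ (fun x => f x ^ 2) l y * (t * t) +
        (2 * moment μ (fun x => f x * g x) l y) * t + moment μ (fun x => g x ^ 2) l y := by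
      rw [moment_add (((ExpGrowth.const _).mul hff).add ((ExpGrowth.const _).mul (hf.mul hg))) hgg
        hl, moment_add ((ExpGrowth.const _).mul hff) ((ExpGrowth.const _).mul (hf.mul hg)) hl,
        moment_const_mul, moment_const_mul]
      ring
    rw [← e]
    refine moment_nonneg (fun x => ?_) l y
    nlinarith [sq_nonneg (t * f x + g x)]
  have := discrim_le_zero h
  rw [discrim] at this
  nlinarith

lemma moment₁_sq_div_le (u : E) {l : ℝ} (hl : 0 < l) (y : E) :
    moment₁ μ u l y ^ 2 / evidence μ l y ≤ moment μ (fun x => ⟪x, u⟫ ^ 2) l y := by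
  rw [div_le_iff₀ (evidence_pos hl y)]
  simpa [moment₁, evidence] using
    moment_mul_sq_le (μ := μ) (ExpGrowth.inner_right u) (ExpGrowth.const 1) hl y

variable {ι : Type*} [Fintype ι] (b : OrthonormalBasis ι ℝ E)

lemma expGrowth_inner_sub (c : E) (i : ι) : ExpGrowth (fun x : E => ⟪x - c, b i⟫) := by
  have := (ExpGrowth.inner_right (b i)).sub (ExpGrowth.const ⟪c, b i⟫)
  simpa [inner_sub_left] using this

/-- The squared Hilbert-Schmidt norm of the posterior covariance is at most the fourth posterior
moment about any point. -/
lemma sum_sq_cov_le (c : E) {l : ℝ} (hl : 0 < l) (y : E) :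
    ∑ i, ∑ j, (moment₂ μ (b i) (b j) l y - postMean μ (b i) l y * moment₁ μ (b j) l y) ^ 2
      / evidence μ l y ≤ moment μ (fun x => ‖x - c‖ ^ 4) l y := by
  have hq := evidence_pos (μ := μ) hl y
  have gi := fun i => ExpGrowth.inner_right (b i)
  have gc := fun i => expGrowth_inner_sub b c i
  have g1 := ExpGrowth.const (E := E) 1
  set a : ι → ℝ := fun i => postMean μ (b i) l y with ha
  have ha' : ∀ i, moment₁ μ (b i) l y = a i * evidence μ l y := fun i => by
    simp only [ha, postMean]; field_simp
  have ga : ∀ i, ExpGrowth (fun x : E => ⟪x, b i⟫ - a i) := fun i => (gi i).sub (ExpGrowth.const _)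
  set G : ι → ℝ := fun i => moment μ (fun x => ⟪x - c, b i⟫ ^ 2) l y with hG
  have gcc : ∀ i, ExpGrowth (fun x : E => ⟪x - c, b i⟫ ^ 2) := fun i => by
    simpa [pow_two] using (gc i).mul (gc i)
  have gaa : ∀ i, ExpGrowth (fun x : E => (⟪x, b i⟫ - a i) ^ 2) := fun i => by
    simpa [pow_two] using (ga i).mul (ga i)
  -- One factor is centred at the posterior mean, so the other may be recentred at c at no cost.
  have hcov : ∀ i j, moment₂ μ (b i) (b j) l y - a i * moment₁ μ (b j) l y
      = moment μ (fun x => (⟪x, b i⟫ - a i) * ⟪x - c, b j⟫) l y := by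
    intro i j
    have e : (fun x : E => (⟪x, b i⟫ - a i) * ⟪x - c, b j⟫) = fun x =>
        ((⟪x, b i⟫ * ⟪x, b j⟫ + (-a i) * ⟪x, b j⟫) + (-⟪c, b j⟫) * ⟪x, b i⟫)
          + (a i * ⟪c, b j⟫) * 1 := by
      funext x
      rw [inner_sub_left]
      ring
    rw [e, moment_add ((((gi i).mul (gi j)).add ((ExpGrowth.const _).mul (gi j))).add
      ((ExpGrowth.const _).mul (gi i))) ((ExpGrowth.const _).mul g1) hl,
      moment_add (((gi i).mul (gi j)).add ((ExpGrowth.const _).mul (gi j)))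
      ((ExpGrowth.const _).mul (gi i)) hl,
      moment_add ((gi i).mul (gi j)) ((ExpGrowth.const _).mul (gi j)) hl,
      moment_const_mul, moment_const_mul, moment_const_mul]
    have h1 : moment μ (fun x => ⟪x, b i⟫) l y = a i * moment μ (fun _ => 1) l y := ha' i
    rw [h1]
    simp only [moment₂, moment₁]
    ring
  -- The mean minimises the second moment about a point.
  have hF : ∀ i, moment μ (fun x => (⟪x, b i⟫ - a i) ^ 2) l y ≤ G i := by
    intro i
    have e : (fun x : E => ⟪x - c, b i⟫ ^ 2) = fun x =>
        ((⟪x, b i⟫ - a i) ^ 2 + (2 * (a i - ⟪c, b i⟫)) * ⟪x, b i⟫)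
          + (⟪c, b i⟫ ^ 2 - a i ^ 2) * 1 := by
      funext x
      rw [inner_sub_left]
      ring
    have h1 : moment μ (fun x => ⟪x, b i⟫) l y = a i * moment μ (fun _ => 1) l y := ha' i
    simp only [hG]
    rw [e, moment_add ((gaa i).add ((ExpGrowth.const _).mul (gi i))) ((ExpGrowth.const _).mul g1)
      hl, moment_add (gaa i) ((ExpGrowth.const _).mul (gi i)) hl, moment_const_mul,
      moment_const_mul, h1]
    have : 0 ≤ moment μ (fun _ : E => (1:ℝ)) l y := hq.le
    nlinarith [mul_nonneg this (sq_nonneg (a i - ⟪c, b i⟫))]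
  have hG0 : ∀ i, 0 ≤ G i := fun i => moment_nonneg (fun x => sq_nonneg _) l y
  have hGsum : ∑ i, G i = moment μ (fun x => ‖x - c‖ ^ 2) l y := by
    simp only [hG]
    rw [← moment_sum _ gcc hl]
    simp only [b.sum_sq_inner_left]
  have hS : (moment μ (fun x => ‖x - c‖ ^ 2) l y) ^ 2
      ≤ evidence μ l y * moment μ (fun x => ‖x - c‖ ^ 4) l y := by
    have g2 : ExpGrowth (fun x : E => ‖x - c‖ ^ 2) := by
      refine ExpGrowth.of_le ((ExpGrowth.norm_pow 2 |>.add (ExpGrowth.const (‖c‖ ^ 2))) |>.mul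
        (ExpGrowth.const 2)) (by fun_prop) fun x => ?_
      rw [abs_of_nonneg (by positivity)]
      have : ‖x - c‖ ^ 2 ≤ (‖x‖ + ‖c‖) ^ 2 := by gcongr; exact norm_sub_le _ _
      nlinarith [sq_nonneg (‖x‖ - ‖c‖)]
    have := moment_mul_sq_le (μ := μ) g1 g2 hl y
    simpa [evidence, ← pow_mul] using this
  calc ∑ i, ∑ j, (moment₂ μ (b i) (b j) l y - a i * moment₁ μ (b j) l y) ^ 2 / evidence μ l y
      ≤ ∑ i, ∑ j, G i * G j / evidence μ l y := by
        refine Finset.sum_le_sum fun i _ => Finset.sum_le_sum fun j _ => ?_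
        rw [hcov]
        gcongr
        refine (moment_mul_sq_le (ga i) (gc j) hl y).trans ?_
        exact mul_le_mul_of_nonneg_right (hF i) (hG0 j)
    _ = (∑ i, G i) ^ 2 / evidence μ l y := by
        simp only [pow_two, Finset.sum_mul_sum, Finset.sum_div]
    _ ≤ _ := by
        rw [hGsum, div_le_iff₀ hq, mul_comm]
        exact hS

variable (μ)

/-- The minimum mean square error `E ‖X - E[X | Y]‖²`, `Y = l X + √l Z`, of the Gaussian channel
with input law `μ`. -/
noncomputable def mmse (l : ℝ) : ℝ :=
  (∫ x, ‖x‖ ^ 2 ∂μ) - ∫ y, (∑ i, moment₁ μ (b i) l y ^ 2 / evidence μ l y) * gaussKernel l y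

/-- The mutual information of the Gaussian channel with input law `μ`. -/
noncomputable def channelInfo (l : ℝ) : ℝ :=
  l / 2 * (∫ x, ‖x‖ ^ 2 ∂μ) - ∫ y, evidence μ l y * Real.log (evidence μ l y) * gaussKernel l y

variable {μ}

lemma integrable_inner_sq (h4 : Integrable (fun x => ‖x‖ ^ 4) μ) (i : ι) :
    Integrable (fun x => ⟪x, b i⟫ ^ 2) μ := by
  refine (integrable_norm_pow_of_le h4 (d := 2) (by norm_num)).mono' (by fun_prop)
    (Eventually.of_forall fun x => ?_)
  rw [Real.norm_eq_abs, abs_pow]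
  gcongr
  simpa using abs_real_inner_le_norm x (b i)

lemma integrable_moment₁_sq_div (h4 : Integrable (fun x => ‖x‖ ^ 4) μ) (i : ι) {l : ℝ}
    (hl : 0 < l) :
    Integrable (fun y => moment₁ μ (b i) l y ^ 2 / evidence μ l y * gaussKernel l y) := by
  have sec : ∀ {f : ℝ → E → ℝ}, Measurable (fun p : ℝ × E => f p.1 p.2) → Measurable (f l) :=
    fun hf => hf.comp (measurable_prodMk_left (x := l))
  refine (integrable_moment_mul_gaussKernel (integrable_inner_sq b h4 i) hl).mono'
    ((((sec (measurable_moment₁ (b i))).pow_const 2).div (sec measurable_evidence)).mul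
      (measurable_gaussKernel_right l)).aestronglyMeasurable (Eventually.of_forall fun y => ?_)
  have hg := (gaussKernel_pos hl y).le
  have hq := evidence_pos (μ := μ) hl y
  rw [Real.norm_eq_abs, abs_of_nonneg (by positivity)]
  exact mul_le_mul_of_nonneg_right (moment₁_sq_div_le _ hl y) hg

lemma integrable_norm_sub_pow_four (h4 : Integrable (fun x => ‖x‖ ^ 4) μ) (c : E) :
    Integrable (fun x => ‖x - c‖ ^ 4) μ := by
  refine ((h4.add (integrable_const (‖c‖ ^ 4))).const_mul 8).mono' (by fun_prop)
    (Eventually.of_forall fun x => ?_)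
  rw [Real.norm_eq_abs, abs_of_nonneg (by positivity)]
  simpa [sub_eq_add_neg] using norm_add_pow_four_le (-c) x

/-- The decrement is the integral over l of the mean squared norm of the posterior covariance, hence
nonnegative. By `sum_sq_cov_le` and because the posterior averages to the prior, that mean is at
most the fourth prior moment about c. -/
theorem mmse_sub (h4 : Integrable (fun x => ‖x‖ ^ 4) μ) (c : E) {l₁ l₂ : ℝ} (h₁ : 0 < l₁)
    (h₁₂ : l₁ ≤ l₂) : 0 ≤ mmse μ b l₁ - mmse μ b l₂ ∧
      mmse μ b l₁ - mmse μ b l₂ ≤ (∫ x, ‖x - c‖ ^ 4 ∂μ) * (l₂ - l₁) := by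
  have key := fun i => integral_moment₁_sq_sub b h4 (b.norm_eq_one i) h₁ h₁₂
  have h₂ : 0 < l₂ := h₁.trans_le h₁₂
  set H : ι → ℝ → E → ℝ := fun i l y => (∑ j, (moment₂ μ (b i) (b j) l y -
    postMean μ (b i) l y * moment₁ μ (b j) l y) ^ 2 / evidence μ l y) * gaussKernel l y with hH
  have hH0 : ∀ l ∈ Icc l₁ l₂, ∀ i y, 0 ≤ H i l y := fun l hl i y => by
    have hl0 := h₁.trans_le hl.1
    have hg := (gaussKernel_pos hl0 y).le
    have hq := (evidence_pos (μ := μ) hl0 y).le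
    exact mul_nonneg (Finset.sum_nonneg fun j _ => by positivity) hg
  have e : mmse μ b l₁ - mmse μ b l₂ = ∫ l in l₁..l₂, ∑ i, ∫ y, H i l y := by
    rw [intervalIntegral.integral_finsetSum fun i _ => (key i).1, mmse, mmse]
    simp only [Finset.sum_mul]
    rw [integral_finsetSum _ fun i _ => integrable_moment₁_sq_div b h4 i h₁,
      integral_finsetSum _ fun i _ => integrable_moment₁_sq_div b h4 i h₂, sub_sub_sub_cancel_left,
      ← Finset.sum_sub_distrib]
    exact Finset.sum_congr rfl fun i _ => (key i).2.trans (by simp only [Finset.sum_mul])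
  have hint : IntervalIntegrable (fun l => ∑ i, ∫ y, H i l y) volume l₁ l₂ := by
    have := IntervalIntegrable.sum Finset.univ (f := fun i l => ∫ y, H i l y) fun i _ => (key i).1
    simpa [Finset.sum_fn] using this
  rw [e]
  constructor
  · exact intervalIntegral.integral_nonneg h₁₂ fun l hl =>
      Finset.sum_nonneg fun i _ => integral_nonneg (hH0 l hl i)
  · have hM : ∀ l ∈ Icc l₁ l₂, ∑ i, ∫ y, H i l y ≤ ∫ x, ‖x - c‖ ^ 4 ∂μ := by
      intro l hl
      have hl0 := h₁.trans_le hl.1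
      have sec : ∀ {f : ℝ → E → ℝ}, Measurable (fun p : ℝ × E => f p.1 p.2) → Measurable (f l) :=
        fun hf => hf.comp (measurable_prodMk_left (x := l))
      have bd : ∀ y, ∑ i, H i l y ≤ moment μ (fun x => ‖x - c‖ ^ 4) l y * gaussKernel l y := by
        intro y
        simp only [hH, ← Finset.sum_mul]
        exact mul_le_mul_of_nonneg_right (sum_sq_cov_le b c hl0 y) (gaussKernel_pos hl0 y).le
      have I0 := integrable_moment_mul_gaussKernel (integrable_norm_sub_pow_four h4 c) hl0
      have IH : ∀ i, Integrable (fun y => H i l y) := by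
        intro i
        refine I0.mono' ?_ (Eventually.of_forall fun y => ?_)
        · refine Measurable.aestronglyMeasurable (Measurable.mul ?_ (measurable_gaussKernel_right l))
          exact Finset.measurable_sum _ fun j _ => (((sec (measurable_moment₂ (b i) (b j))).sub
            ((sec (measurable_postMean (b i))).mul (sec (measurable_moment₁ (b j))))).pow_const
            2).div (sec measurable_evidence)
        · rw [Real.norm_eq_abs, abs_of_nonneg (hH0 l hl i y)]
          exact (Finset.single_le_sum (f := fun i => H i l y) (fun i _ => hH0 l hl i y)
            (Finset.mem_univ i)).trans (bd y)
      rw [← integral_finsetSum _ fun i _ => IH i]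
      refine (integral_mono (integrable_finsetSum _ fun i _ => IH i) I0 bd).trans_eq ?_
      exact integral_moment_mul_gaussKernel (integrable_norm_sub_pow_four h4 c) hl0
    refine (intervalIntegral.integral_mono_on h₁₂ hint intervalIntegrable_const hM).trans_eq ?_
    rw [intervalIntegral.integral_const, smul_eq_mul, mul_comm]

theorem continuousOn_mmse (h4 : Integrable (fun x => ‖x‖ ^ 4) μ) :
    ContinuousOn (mmse μ b) (Ioi 0) := by
  have h0 : 0 ≤ ∫ x, ‖x - (0 : E)‖ ^ 4 ∂μ := integral_nonneg fun x => by positivity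
  refine LipschitzOnWith.continuousOn (K := (∫ x, ‖x - (0 : E)‖ ^ 4 ∂μ).toNNReal)
    (LipschitzOnWith.of_dist_le_mul ?_)
  have aux : ∀ x ∈ Ioi (0:ℝ), ∀ y ∈ Ioi (0:ℝ), x ≤ y → dist (mmse μ b x) (mmse μ b y)
      ≤ (∫ x, ‖x - (0 : E)‖ ^ 4 ∂μ) * dist x y := by
    intro x hx y hy hxy
    have := mmse_sub b h4 0 hx hxy
    rw [Real.dist_eq, abs_of_nonneg this.1, dist_comm, Real.dist_eq, abs_of_nonneg (by linarith)]
    exact this.2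
  intro x hx y hy
  rw [Real.coe_toNNReal _ h0]
  rcases le_total x y with h | h
  · exact aux x hx y hy h
  · rw [dist_comm, dist_comm x]; exact aux y hy x hx h

theorem channelInfo_sub (h4 : Integrable (fun x => ‖x‖ ^ 4) μ) {l₁ l₂ : ℝ} (h₁ : 0 < l₁)
    (h₁₂ : l₁ ≤ l₂) :
    channelInfo μ l₂ - channelInfo μ l₁ = ∫ l in l₁..l₂, mmse μ b l / 2 := by
  have key := integral_evidence_mul_log_sub b h4 h₁ h₁₂
  have e : ∀ l, mmse μ b l / 2 = 1 / 2 * (∫ x, ‖x‖ ^ 2 ∂μ) -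
      ∫ y, (1 / 2 * ∑ i, moment₁ μ (b i) l y ^ 2 / evidence μ l y) * gaussKernel l y := by
    intro l
    simp only [mmse, mul_assoc, integral_const_mul]
    ring
  simp only [e]
  rw [intervalIntegral.integral_sub intervalIntegrable_const key.1, ← key.2,
    intervalIntegral.integral_const, channelInfo, channelInfo, smul_eq_mul]
  ring

/-- The I-MMSE relation. -/
theorem hasDerivAt_channelInfo (h4 : Integrable (fun x => ‖x‖ ^ 4) μ) {l : ℝ} (hl : 0 < l) :
    HasDerivAt (channelInfo μ) (mmse μ b l / 2) l := by
  have hc := (continuousOn_mmse b h4).div_const 2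
  -- The base point l / 2 keeps the interval of integration inside (0, ∞), where mmse is continuous.
  have hl2 : 0 < l / 2 := by positivity
  have hint : ∀ r ∈ Ioi (0:ℝ), IntervalIntegrable (fun l => mmse μ b l / 2) volume (l / 2) r := by
    intro r hr
    refine (hc.mono fun x hx => ?_).intervalIntegrable
    exact lt_of_lt_of_le (lt_min hl2 hr) hx.1
  have h := intervalIntegral.integral_hasDerivAt_right (hint l hl)
    (hc.stronglyMeasurableAtFilter isOpen_Ioi l hl) (hc.continuousAt (Ioi_mem_nhds hl))
  have h2 := h.const_add (channelInfo μ (l / 2))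
  refine h2.congr_of_eventuallyEq ?_
  filter_upwards [Ioi_mem_nhds (by linarith : l / 2 < l)] with r hr
  rw [← channelInfo_sub b h4 hl2 (le_of_lt hr)]
  ring

end MMSE

/-! ### Weak gradients vanish on the zero set of a nonnegative function -/

section WeakGradient

open Filter Topology
open scoped RealInnerProductSpace

variable {E : Type*} [NormedAddCommGroup E] [InnerProductSpace ℝ E] [FiniteDimensional ℝ E]
  [MeasurableSpace E] [BorelSpace E]

lemma integrable_comp_add_smul {G : E → ℝ} (hG : Integrable G) (v : E) (a c : ℝ) :
    Integrable (fun p : ℝ × E => G (p.2 + p.1 • v))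
      ((volume.restrict (Icc a c)).prod volume) := by
  have mp : MeasurePreserving (fun p : ℝ × E => (p.1, p.2 + p.1 • v))
      ((volume.restrict (Icc a c)).prod volume) ((volume.restrict (Icc a c)).prod volume) :=
    (MeasurePreserving.id _).skew_product (g := fun r x => x + r • v) (by fun_prop)
      (Eventually.of_forall fun r => (measurePreserving_add_right volume (r • v)).map_eq)
  have h := (integrable_const (1:ℝ) (μ := volume.restrict (Icc a c))).mul_prod hG
  simpa [Function.comp_def] using mp.integrable_comp_of_integrable h

/-- Translation acts continuously on L¹, and integration over S is a continuous functional. -/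
lemma continuous_setIntegral_translate {G : E → ℝ} (hG : Integrable G) (v : E) (S : Set E) :
    Continuous (fun r : ℝ => ∫ x in S, G (x + r • v)) := by
  have : Fact ((1:ℝ≥0∞) ≠ ∞) := ⟨ENNReal.one_ne_top⟩
  have hL : MemLp G 1 := memLp_one_iff_integrable.2 hG
  have hc : Continuous (fun r : ℝ => DomAddAct.mk (r • v) +ᵥ hL.toLp G) := by
    have h1 : Continuous (fun r : ℝ => DomAddAct.mk (r • v)) :=
      DomAddAct.continuous_mk.comp (by fun_prop)
    exact h1.vadd continuous_const
  convert (continuous_setIntegral (μ := volume) S).comp hc using 2 with r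
  refine integral_congr_ae (ae_restrict_of_ae ?_)
  have h1 := ((hL.comp_measurePreserving <| measurePreserving_vadd (r • v) volume)).coeFn_toLp
  have e : (DomAddAct.mk (r • v) +ᵥ hL.toLp G) = (hL.comp_measurePreserving <|
    measurePreserving_vadd (r • v) volume).toLp (G ∘ fun x => r • v +ᵥ x) := rfl
  filter_upwards [h1] with x hx
  rw [e, hx, Function.comp_apply, vadd_eq_add, add_comm]

lemma _root_.HasWeakGradient.integral_mul_fderiv {ρ : E → ℝ} {g : E → E} (h : HasWeakGradient ρ g)
    {φ : E → ℝ} (hφ : ContDiff ℝ (⊤ : ℕ∞) φ) (hc : HasCompactSupport φ) (v : E) :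
    ∫ x, ρ x * fderiv ℝ φ x v = -∫ x, φ x * ⟪g x, v⟫ := by
  have hgrad : ∀ x, gradient φ x = (InnerProductSpace.toDual ℝ E).symm (fderiv ℝ φ x) :=
    fun x => rfl
  have hcont : Continuous (gradient φ) := by
    have : Continuous (fderiv ℝ φ) := hφ.continuous_fderiv (by simp)
    exact (InnerProductSpace.toDual ℝ E).symm.continuous.comp this
  have hcs : HasCompactSupport (gradient φ) :=
    (hc.fderiv (𝕜 := ℝ)).comp_left (g := (InnerProductSpace.toDual ℝ E).symm) (map_zero _)
  have i1 : Integrable (fun x => ρ x • gradient φ x) :=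
    h.locallyIntegrable.integrable_smul_right_of_hasCompactSupport hcont hcs
  have i2 : Integrable (fun x => φ x • g x) :=
    h.locallyIntegrable_grad.integrable_smul_left_of_hasCompactSupport hφ.continuous hc
  have key := congrArg (fun w => ⟪v, w⟫) (h.integral_eq φ hφ hc)
  simp only [inner_neg_right] at key
  rw [← integral_inner i1, ← integral_inner i2] at key
  refine Eq.trans ?_ (key.trans ?_)
  · refine integral_congr_ae (Eventually.of_forall fun x => ?_)
    simp only [inner_smul_right, hgrad]
    rw [real_inner_comm, InnerProductSpace.toDual_symm_apply]
  · simp only [inner_smul_right, real_inner_comm v]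

/-- By duality: paired with a test function φ, the translation moves onto φ, where the classical
fundamental theorem of calculus applies; Fubini and the weak gradient identity for each translate of
φ finish. The indicator makes the merely locally integrable g integrable without changing it on the
segments in question. -/
theorem _root_.HasWeakGradient.ae_sub_eq {ρ : E → ℝ} {g : E → E} (h : HasWeakGradient ρ g) (v : E)
    {R t : ℝ} (ht : t ∈ Icc (0:ℝ) 1) :
    ∀ᵐ x, x ∈ Metric.ball (0 : E) R → ρ (x + t • v) - ρ x = ∫ r in Icc 0 t,
      (Metric.closedBall (0 : E) (R + ‖v‖)).indicator (fun x => ⟪g x, v⟫) (x + r • v) := by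
  set B := Metric.closedBall (0 : E) (R + ‖v‖)
  set G := B.indicator (fun x => ⟪g x, v⟫) with hG
  have hgi : IntegrableOn (fun x => ⟪g x, v⟫) B :=
    (h.locallyIntegrable_grad.integrableOn_isCompact (isCompact_closedBall _ _)).inner_const v
  have hGi : Integrable G := hgi.integrable_indicator measurableSet_closedBall
  have hF := integrable_comp_add_smul hGi v 0 t
  have hint : Integrable (fun x => ∫ r in Icc 0 t, G (x + r • v)) := hF.integral_prod_right
  have hρt : LocallyIntegrable (fun x => ρ (x + t • v)) := by
    have := (locallyIntegrable_map_homeomorph (Homeomorph.addRight (t • v)) (f := ρ)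
      (μ := volume)).1 (by
        have e : Measure.map (Homeomorph.addRight (t • v)) (volume : Measure E) = volume :=
          (measurePreserving_add_right volume (t • v)).map_eq
        rw [e]; exact h.locallyIntegrable)
    simpa [Function.comp_def] using this
  have hloc : LocallyIntegrable (fun x => ρ (x + t • v) - ρ x - ∫ r in Icc 0 t, G (x + r • v)) :=
    (hρt.sub h.locallyIntegrable).sub hint.locallyIntegrable
  have key := IsOpen.ae_eq_zero_of_integral_contDiff_smul_eq_zero (μ := volume)
    (Metric.isOpen_ball (x := (0:E)) (ε := R)) (hloc.locallyIntegrableOn _) ?_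
  · filter_upwards [key] with x hx hxR
    exact sub_eq_zero.1 (hx hxR)
  intro φ hφ hφc hφs
  have hD : Continuous (fun x => fderiv ℝ φ x v) :=
    (hφ.continuous_fderiv (by simp)).clm_apply continuous_const
  have hcsD : HasCompactSupport (fun x => fderiv ℝ φ x v) := hφc.fderiv_apply (𝕜 := ℝ) v
  obtain ⟨C, hC⟩ := hD.bounded_above_of_compact_support hcsD
  obtain ⟨C', hC'⟩ := hφ.continuous.bounded_above_of_compact_support hφc
  have hC0 : 0 ≤ C := (norm_nonneg _).trans (hC 0)
  have supp : ∀ z, z ∉ Metric.ball (0:E) R → φ z = 0 ∧ fderiv ℝ φ z v = 0 := by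
    intro z hz
    have hz' : z ∉ tsupport φ := fun h' => hz (hφs h')
    refine ⟨image_eq_zero_of_notMem_tsupport hz', ?_⟩
    have : fderiv ℝ φ z = 0 := by
      by_contra hne
      exact hz' (support_fderiv_subset ℝ (Function.mem_support.2 hne))
    rw [this]; simp
  -- B has radius R + ‖v‖ so as to contain all translates of the ball by r v with 0 ≤ r ≤ t ≤ 1.
  have far : ∀ r ∈ Icc 0 t, ∀ x, x ∉ B → x - r • v ∉ Metric.ball (0:E) R := by
    intro r hr x hx hx'
    refine hx ?_
    rw [mem_ball_zero_iff] at hx'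
    rw [mem_closedBall_zero_iff]
    have h1 : ‖x‖ ≤ ‖x - r • v‖ + ‖r • v‖ := by simpa using norm_add_le (x - r • v) (r • v)
    have h2 : ‖r • v‖ ≤ ‖v‖ := by
      rw [norm_smul, Real.norm_eq_abs, abs_of_nonneg hr.1]
      exact mul_le_of_le_one_left (norm_nonneg v) (hr.2.trans ht.2)
    linarith
  have ftc : ∀ x, φ (x - t • v) - φ x = -∫ r in Icc 0 t, fderiv ℝ φ (x - r • v) v := by
    intro x
    have hd : ∀ r : ℝ, HasDerivAt (fun r : ℝ => φ (x - r • v)) (-fderiv ℝ φ (x - r • v) v) r := by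
      intro r
      have h1 : HasDerivAt (fun r : ℝ => x - r • v) (-v) r := by
        simpa using ((hasDerivAt_id r).smul_const v).const_sub x
      have h2 := ((hφ.differentiable (by simp)) (x - r • v)).hasFDerivAt.comp_hasDerivAt r h1
      simpa [Function.comp_def] using h2
    have := intervalIntegral.integral_eq_sub_of_hasDerivAt (a := 0) (b := t)
      (fun r _ => hd r) ((hD.comp (by fun_prop : Continuous fun r : ℝ => x - r • v)).neg.intervalIntegrable _ _)
    rw [intervalIntegral.integral_of_le ht.1, ← integral_Icc_eq_integral_Ioc, integral_neg] at this
    rw [this]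
    simp
  have fub1 : Integrable (fun p : ℝ × E => ρ p.2 * fderiv ℝ φ (p.2 - p.1 • v) v)
      ((volume.restrict (Icc 0 t)).prod volume) := by
    have hρB : Integrable (B.indicator ρ) :=
      (h.locallyIntegrable.integrableOn_isCompact (isCompact_closedBall _ _)).integrable_indicator
        measurableSet_closedBall
    have hb := ((integrable_const (1:ℝ) (μ := volume.restrict (Icc 0 t))).mul_prod hρB).norm.const_mul C
    refine hb.mono' ?_ ?_
    · exact (h.locallyIntegrable.aestronglyMeasurable.comp_snd).mul
        (hD.comp (by fun_prop : Continuous fun p : ℝ × E => p.2 - p.1 • v)).aestronglyMeasurable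
    · have memae : ∀ᵐ p : ℝ × E ∂((volume.restrict (Icc 0 t)).prod volume), p.1 ∈ Icc 0 t :=
        Measure.quasiMeasurePreserving_fst.ae (ae_restrict_mem measurableSet_Icc)
      filter_upwards [memae] with p hp
      by_cases hx : p.2 ∈ B
      · rw [norm_mul, one_mul, indicator_of_mem hx, mul_comm]
        exact mul_le_mul_of_nonneg_right (hC _) (norm_nonneg _)
      · rw [(supp _ (far p.1 hp p.2 hx)).2, mul_zero, norm_zero]
        positivity
  have fub2 : Integrable (fun p : ℝ × E => φ p.2 * G (p.2 + p.1 • v))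
      ((volume.restrict (Icc 0 t)).prod volume) := by
    refine Integrable.bdd_mul (c := C') hF
      (hφ.continuous.comp continuous_snd).aestronglyMeasurable (Eventually.of_forall fun p => ?_)
    exact hC' _
  have slice : ∀ r ∈ Icc 0 t, ∫ x, ρ x * fderiv ℝ φ (x - r • v) v = -∫ x, φ x * G (x + r • v) := by
    intro r hr
    have hφr : ContDiff ℝ (⊤ : ℕ∞) (fun x => φ (x - r • v)) :=
      hφ.comp (contDiff_id.sub contDiff_const)
    have hcr : HasCompactSupport (fun x => φ (x - r • v)) := by
      simpa [sub_eq_add_neg] using! hφc.comp_homeomorph (Homeomorph.addRight (-(r • v)))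
    have := h.integral_mul_fderiv hφr hcr v
    simp only [fderiv_comp_sub] at this
    rw [this, ← integral_add_right_eq_self _ (r • v)]
    congr 1
    refine integral_congr_ae (Eventually.of_forall fun x => ?_)
    simp only [add_sub_cancel_right]
    by_cases hx : x ∈ Metric.ball (0:E) R
    · have hxB : x + r • v ∈ B := by
        by_contra hn
        exact far r hr _ hn (by simpa using hx)
      simp only [hG, indicator_of_mem hxB]
    · simp [(supp x hx).1]
  have i1 : Integrable (fun x => φ x * ρ (x + t • v)) :=
    hρt.integrable_smul_left_of_hasCompactSupport hφ.continuous hφc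
  have i2 : Integrable (fun x => φ x * ρ x) :=
    h.locallyIntegrable.integrable_smul_left_of_hasCompactSupport hφ.continuous hφc
  have i3 : Integrable (fun x => φ x * ∫ r in Icc 0 t, G (x + r • v)) :=
    hint.locallyIntegrable.integrable_smul_left_of_hasCompactSupport hφ.continuous hφc
  have i1' : Integrable (fun x => φ (x - t • v) * ρ x) := by
    simpa using i1.comp_sub_right (t • v)
  simp only [smul_eq_mul, mul_sub]
  have i12 : Integrable (fun x => φ x * ρ (x + t • v) - φ x * ρ x) := i1.sub i2
  rw [integral_sub i12 i3, integral_sub i1 i2]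
  have e1 : ∫ x, φ x * ρ (x + t • v) = ∫ x, φ (x - t • v) * ρ x := by
    rw [← integral_sub_right_eq_self _ (t • v)]
    simp
  have e2 : (∫ x, φ (x - t • v) * ρ x) - ∫ x, φ x * ρ x
      = -∫ x, ∫ r in Icc 0 t, ρ x * fderiv ℝ φ (x - r • v) v := by
    rw [← integral_sub i1' i2, ← integral_neg]
    refine integral_congr_ae (Eventually.of_forall fun x => ?_)
    simp only [integral_const_mul]
    rw [← sub_mul, ftc x]
    ring
  have e3 : ∫ x, φ x * ∫ r in Icc 0 t, G (x + r • v)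
      = ∫ r in Icc 0 t, ∫ x, φ x * G (x + r • v) := by
    rw [integral_integral_swap fub2]
    simp only [integral_const_mul]
  rw [e1, e2, e3, ← integral_integral_swap fub1, setIntegral_congr_fun measurableSet_Icc slice,
    integral_neg]
  ring

/-- At a zero of ρ, which is a minimum, all increments of ρ are nonnegative. Integrating them over
an arbitrary subset S of the zero set makes the integrand continuous in the shift, so dividing by t
and letting t → 0⁺ gives a nonnegative integral of ⟨g, v⟩ over S. -/
theorem _root_.HasWeakGradient.ae_inner_nonneg {ρ : E → ℝ} {g : E → E} (h : HasWeakGradient ρ g)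
    (hm : Measurable ρ) (h0 : ∀ x, 0 ≤ ρ x) (v : E) : ∀ᵐ x, ρ x = 0 → 0 ≤ ⟪g x, v⟫ := by
  suffices H : ∀ n : ℕ, ∀ᵐ x, x ∈ Metric.ball (0 : E) n → ρ x = 0 → 0 ≤ ⟪g x, v⟫ by
    filter_upwards [ae_all_iff.2 H] with x hx
    obtain ⟨n, hn⟩ := exists_nat_gt ‖x‖
    exact hx n (by simpa using hn)
  intro n
  set R : ℝ := (n : ℝ)
  set B := Metric.closedBall (0 : E) (R + ‖v‖)
  set G := B.indicator (fun x => ⟪g x, v⟫) with hG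
  have hgi : IntegrableOn (fun x => ⟪g x, v⟫) B :=
    (h.locallyIntegrable_grad.integrableOn_isCompact (isCompact_closedBall _ _)).inner_const v
  have hGi : Integrable G := hgi.integrable_indicator measurableSet_closedBall
  set Z := {x | ρ x = 0} ∩ Metric.ball (0 : E) R
  have hZ : MeasurableSet Z := (hm (measurableSet_singleton 0)).inter measurableSet_ball
  have hS : ∀ S, MeasurableSet S → S ⊆ Z → 0 ≤ ∫ x in S, G x := by
    intro S hSm hSZ
    set K : ℝ → ℝ := fun r => ∫ x in S, G (x + r • v) with hK
    have hKc : Continuous K := continuous_setIntegral_translate hGi v S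
    have hP : ∀ t ∈ Ioc (0:ℝ) 1, 0 ≤ ∫ r in (0:ℝ)..t, K r := by
      intro t ht
      have hF := integrable_comp_add_smul hGi v 0 t
      have hF' : Integrable (fun p : ℝ × E => G (p.2 + p.1 • v))
          ((volume.restrict (Icc 0 t)).prod (volume.restrict S)) :=
        hF.mono_measure (Measure.prod_mono le_rfl Measure.restrict_le_self)
      rw [intervalIntegral.integral_of_le ht.1.le, ← integral_Icc_eq_integral_Ioc]
      simp only [hK]
      rw [integral_integral_swap hF']
      refine integral_nonneg_of_ae ?_
      have h1 := ae_restrict_of_ae (s := S) (h.ae_sub_eq v (R := R) ⟨ht.1.le, ht.2⟩)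
      filter_upwards [h1, ae_restrict_mem hSm] with x hx hxS
      rw [Pi.zero_apply, ← hx (hSZ hxS).2, (hSZ hxS).1, sub_zero]
      exact h0 _
    have hd : HasDerivAt (fun t => ∫ r in (0:ℝ)..t, K r) (K 0) 0 :=
      intervalIntegral.integral_hasDerivAt_right (by simp)
        (hKc.stronglyMeasurableAtFilter _ _) hKc.continuousAt
    have hlim := hd.tendsto_slope_zero_right
    have : 0 ≤ K 0 := by
      refine ge_of_tendsto hlim ?_
      filter_upwards [Ioc_mem_nhdsGT (zero_lt_one' ℝ)] with t ht
      simp only [zero_add, intervalIntegral.integral_same, sub_zero, smul_eq_mul]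
      exact mul_nonneg (inv_nonneg.2 ht.1.le) (hP t ht)
    simpa [hK] using this
  have hae : 0 ≤ᵐ[volume] Z.indicator G := by
    refine ae_nonneg_of_forall_setIntegral_nonneg (hGi.indicator hZ) fun S hSm _ => ?_
    rw [setIntegral_indicator hZ]
    exact hS _ (hSm.inter hZ) inter_subset_right
  filter_upwards [hae] with x hx hxR hx0
  have hxZ : x ∈ Z := ⟨hx0, hxR⟩
  have hxB : x ∈ B := by
    have : ‖x‖ < R := by simpa using hxR
    simp only [B, mem_closedBall_zero_iff]
    linarith [norm_nonneg v]
  simpa [hxZ, hG, hxB] using hx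

/-- The weak gradient of a nonnegative function vanishes almost everywhere on its zero set. -/
theorem _root_.HasWeakGradient.ae_eq_zero {ρ : E → ℝ} {g : E → E} (h : HasWeakGradient ρ g)
    (hm : Measurable ρ) (h0 : ∀ x, 0 ≤ ρ x) : ∀ᵐ x, ρ x = 0 → g x = 0 := by
  set b := stdOrthonormalBasis ℝ E
  have h1 := ae_all_iff.2 fun i => h.ae_inner_nonneg hm h0 (b i)
  have h2 := ae_all_iff.2 fun i => h.ae_inner_nonneg hm h0 (-b i)
  filter_upwards [h1, h2] with x hx1 hx2 hx
  refine InnerProductSpace.ext_inner_right_basis b.toBasis fun i => ?_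
  have e1 := hx1 i hx
  have e2 := hx2 i hx
  rw [inner_neg_right] at e2
  simp only [OrthonormalBasis.coe_toBasis, inner_zero_left]
  linarith

end WeakGradient

/-! ### Integration by parts with bounded test functions, Gaussian moments and the score -/

section VanTrees

open Filter Topology
open scoped RealInnerProductSpace

variable {E : Type*} [NormedAddCommGroup E] [InnerProductSpace ℝ E] [FiniteDimensional ℝ E]
  [MeasurableSpace E] [BorelSpace E]

/-- The weak gradient identity for bounded smooth test functions with bounded derivative. -/
lemma _root_.HasWeakGradient.integral_mul_fderiv_of_bounded {ρ : E → ℝ} {g : E → E}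
    (h : HasWeakGradient ρ g) (hρ : Integrable ρ) (hg : Integrable g) {φ : E → ℝ}
    (hφ : ContDiff ℝ (⊤ : ℕ∞) φ) (v : E) {C : ℝ} (h0 : ∀ x, |φ x| ≤ C)
    (h1 : ∀ x, |fderiv ℝ φ x v| ≤ C) :
    ∫ x, ρ x * fderiv ℝ φ x v = -∫ x, φ x * ⟪g x, v⟫ := by
  have hC : 0 ≤ C := (abs_nonneg _).trans (h0 0)
  -- φ is cut off by χ(x / (k + 1)). The derivative falling on the cutoff carries the factor 1 / (k
  -- + 1) and disappears in the limit.
  let χ : ContDiffBump (0 : E) := ⟨1, 2, one_pos, one_lt_two⟩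
  have hχ : ContDiff ℝ (⊤ : ℕ∞) (χ : E → ℝ) := χ.contDiff
  have hχd : Continuous (fun x => fderiv ℝ χ x v) :=
    (hχ.continuous_fderiv (by simp)).clm_apply continuous_const
  obtain ⟨K, hK⟩ := hχd.bounded_above_of_compact_support
    (χ.hasCompactSupport.fderiv_apply (𝕜 := ℝ) v)
  have hK0 : 0 ≤ K := (norm_nonneg _).trans (hK 0)
  set c : ℕ → ℝ := fun k => 1 / ((k : ℝ) + 1) with hc
  have hc0 : ∀ k, 0 < c k := fun k => by positivity
  have hc1 : ∀ k, c k ≤ 1 := fun k => by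
    simp only [hc]; rw [div_le_one (by positivity)]; simp
  have hclim : Tendsto c atTop (𝓝 0) := tendsto_one_div_add_atTop_nhds_zero_nat
  have hχk : ∀ k, ContDiff ℝ (⊤ : ℕ∞) (fun x => χ (c k • x)) := fun k =>
    hχ.comp (contDiff_const_smul (c k))
  have hder : ∀ k x, fderiv ℝ (fun x => φ x * χ (c k • x)) x v
      = fderiv ℝ φ x v * χ (c k • x) + φ x * (c k * fderiv ℝ χ (c k • x) v) := by
    intro k x
    have d1 : HasFDerivAt (fun x : E => χ (c k • x))
        ((fderiv ℝ χ (c k • x)).comp (c k • ContinuousLinearMap.id ℝ E)) x :=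
      (hχ.differentiable (by simp) _).hasFDerivAt.comp x ((hasFDerivAt_id x).const_smul (c k))
    have d2 := ((hφ.differentiable (by simp) x).hasFDerivAt).mul d1
    have e : (fun x => φ x * χ (c k • x)) = φ * fun x : E => χ (c k • x) := rfl
    rw [e, d2.fderiv]
    simp
    ring
  have hcs : ∀ k, HasCompactSupport (fun x => φ x * χ (c k • x)) := by
    intro k
    refine HasCompactSupport.mul_left ?_
    exact χ.hasCompactSupport.comp_homeomorph (Homeomorph.smulOfNeZero (c k) (hc0 k).ne')
  have key := fun k => h.integral_mul_fderiv (hφ.mul (hχk k)) (hcs k) v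
  have hlim0 : ∀ x : E, Tendsto (fun k => c k • x) atTop (𝓝 0) := fun x => by
    simpa using hclim.smul_const x
  have hχ1 : ∀ x : E, Tendsto (fun k => χ (c k • x)) atTop (𝓝 1) := fun x => by
    have := (χ.continuous.tendsto 0).comp (hlim0 x)
    rwa [show χ 0 = 1 from χ.one_of_mem_closedBall (Metric.mem_closedBall_self χ.rIn_pos.le)] at this
  have hφd : Continuous (fun x => fderiv ℝ φ x v) :=
    (hφ.continuous_fderiv (by simp)).clm_apply continuous_const
  have L1 : Tendsto (fun k => ∫ x, ρ x * fderiv ℝ (fun x => φ x * χ (c k • x)) x v) atTop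
      (𝓝 (∫ x, ρ x * fderiv ℝ φ x v)) := by
    refine tendsto_integral_of_dominated_convergence (fun x => ‖ρ x‖ * (C + C * K)) (fun k => ?_)
      (hρ.norm.mul_const _) (fun k => Eventually.of_forall fun x => ?_)
      (Eventually.of_forall fun x => ?_)
    · refine hρ.aestronglyMeasurable.mul (Continuous.aestronglyMeasurable ?_)
      exact ((hφ.mul (hχk k)).continuous_fderiv (by simp)).clm_apply continuous_const
    · rw [norm_mul]
      refine mul_le_mul_of_nonneg_left ?_ (norm_nonneg _)
      rw [hder, Real.norm_eq_abs]
      refine (abs_add_le _ _).trans (add_le_add ?_ ?_)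
      · rw [abs_mul, abs_of_nonneg χ.nonneg]
        calc _ ≤ C * 1 := mul_le_mul (h1 x) χ.le_one χ.nonneg hC
          _ = C := mul_one C
      · rw [abs_mul, abs_mul, abs_of_pos (hc0 k)]
        refine mul_le_mul (h0 x) ?_ (by positivity) hC
        calc _ ≤ 1 * K := mul_le_mul (hc1 k) (hK _) (abs_nonneg _) zero_le_one
          _ = K := one_mul K
    · simp only [hder]
      have t1 := (hχ1 x).const_mul (fderiv ℝ φ x v)
      have t2 : Tendsto (fun k => φ x * (c k * fderiv ℝ χ (c k • x) v)) atTop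
          (𝓝 (φ x * (0 * fderiv ℝ χ 0 v))) :=
        (hclim.mul ((hχd.tendsto 0).comp (hlim0 x))).const_mul _
      simpa using (t1.add t2).const_mul (ρ x)
  have L2 : Tendsto (fun k => -∫ x, φ x * χ (c k • x) * ⟪g x, v⟫) atTop
      (𝓝 (-∫ x, φ x * ⟪g x, v⟫)) := by
    refine (tendsto_integral_of_dominated_convergence (fun x => C * ‖⟪g x, v⟫‖) (fun k => ?_)
      ((hg.inner_const v).norm.const_mul _) (fun k => Eventually.of_forall fun x => ?_)
      (Eventually.of_forall fun x => ?_)).neg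
    · exact ((hφ.mul (hχk k)).continuous.aestronglyMeasurable).mul
        (hg.inner_const v).aestronglyMeasurable
    · rw [norm_mul, norm_mul]
      refine mul_le_mul_of_nonneg_right ?_ (norm_nonneg _)
      rw [Real.norm_eq_abs, Real.norm_eq_abs, abs_of_nonneg χ.nonneg]
      calc _ ≤ C * 1 := mul_le_mul (h0 x) χ.le_one χ.nonneg hC
        _ = C := mul_one C
    · simpa using ((hχ1 x).const_mul (φ x)).mul_const ⟪g x, v⟫
  exact tendsto_nhds_unique L1 (by simpa only [key] using! L2)

/-- Gaussian integration by parts of the linear function ⟨y, v⟩, whose derivative along v is 1. -/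
lemma integral_inner_sq_mul_gaussKernel {l : ℝ} (hl : 0 < l) {v : E} (hv : ‖v‖ = 1) :
    ∫ y : E, ⟪y, v⟫ ^ 2 * gaussKernel l y = l := by
  have hin : ∀ y : E, |⟪y, v⟫| ≤ ‖y‖ := fun y => by
    simpa [hv] using abs_real_inner_le_norm y v
  have mg := measurable_gaussKernel_right (E := E) l
  have I1 : Integrable (fun y : E => ⟪y, v⟫ * gaussKernel l y) := by
    refine (integrable_norm_pow_mul_gaussKernel hl 1).mono'
      (Measurable.aestronglyMeasurable (by fun_prop)) (Eventually.of_forall fun y => ?_)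
    rw [norm_mul, Real.norm_eq_abs, Real.norm_eq_abs, abs_of_pos (gaussKernel_pos hl y), pow_one]
    exact mul_le_mul_of_nonneg_right (hin y) (gaussKernel_pos hl y).le
  have I2 : Integrable (fun y : E => ⟪y, v⟫ ^ 2 * gaussKernel l y) := by
    refine (integrable_norm_pow_mul_gaussKernel hl 2).mono'
      (Measurable.aestronglyMeasurable (by fun_prop)) (Eventually.of_forall fun y => ?_)
    rw [norm_mul, Real.norm_eq_abs, Real.norm_eq_abs, abs_of_pos (gaussKernel_pos hl y), abs_pow]
    exact mul_le_mul_of_nonneg_right (pow_le_pow_left₀ (abs_nonneg _) (hin y) 2)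
      (gaussKernel_pos hl y).le
  have e : ∀ y : E, ⟪y, v⟫ * (-(⟪y, v⟫ / l) * gaussKernel l y)
      = -(1 / l) * (⟪y, v⟫ ^ 2 * gaussKernel l y) := fun y => by ring
  have := integral_mul_lineDeriv_eq_neg (f := fun y : E => ⟪y, v⟫) (f' := fun _ => 1)
    (g := gaussKernel l) (g' := fun y => -(⟪y, v⟫ / l) * gaussKernel l y) (v := v)
    (by simpa using integrable_gaussKernel hl) (by simp only [e]; exact I2.const_mul _) I1
    (fun y => by
      have h1 : (fun t : ℝ => ⟪y + t • v, v⟫) = fun t => ⟪y, v⟫ + t := by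
        funext t
        rw [inner_add_left, inner_smul_left, real_inner_self_eq_norm_sq, hv]
        simp
      unfold HasLineDerivAt
      rw [h1]
      exact (hasDerivAt_id 0).const_add _)
    (fun y => hasLineDerivAt_gaussKernel l y v)
  simp only [e, integral_const_mul, one_mul, integral_gaussKernel hl] at this
  field_simp at this
  linarith

lemma integral_norm_sq_mul_gaussKernel {l : ℝ} (hl : 0 < l) :
    ∫ y : E, ‖y‖ ^ 2 * gaussKernel l y = Module.finrank ℝ E * l := by
  set b := stdOrthonormalBasis ℝ E
  have e : ∀ y : E, ‖y‖ ^ 2 * gaussKernel l y = ∑ i, ⟪y, b i⟫ ^ 2 * gaussKernel l y := fun y => by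
    rw [← Finset.sum_mul, b.sum_sq_inner_left]
  simp only [e]
  have I : ∀ i, Integrable (fun y : E => ⟪y, b i⟫ ^ 2 * gaussKernel l y) := fun i => by
    by_contra hn
    have h1 := integral_inner_sq_mul_gaussKernel (E := E) hl (b.norm_eq_one i)
    rw [integral_undef hn] at h1
    exact hl.ne h1
  rw [integral_finsetSum _ fun i _ => I i]
  simp [integral_inner_sq_mul_gaussKernel hl (b.norm_eq_one _)]

variable {ρ : E → ℝ} {g : E → E}

lemma integral_withDensity_ofReal {𝓧 F : Type*} [MeasurableSpace 𝓧] {m : Measure 𝓧} {f : 𝓧 → ℝ}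
    [NormedAddCommGroup F] [NormedSpace ℝ F] (hm : Measurable f) (h0 : ∀ x, 0 ≤ f x) (h : 𝓧 → F) :
    ∫ x, h x ∂(m.withDensity fun x => ENNReal.ofReal (f x)) = ∫ x, f x • h x ∂m := by
  rw [integral_withDensity_eq_integral_toReal_smul (by fun_prop) (by simp)]
  simp [ENNReal.toReal_ofReal, h0]

lemma integrable_withDensity_ofReal {𝓧 F : Type*} [MeasurableSpace 𝓧] {m : Measure 𝓧} {f : 𝓧 → ℝ}
    [NormedAddCommGroup F] [NormedSpace ℝ F] (hm : Measurable f) (h0 : ∀ x, 0 ≤ f x) (h : 𝓧 → F) :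
    Integrable h (m.withDensity fun x => ENNReal.ofReal (f x)) ↔
      Integrable (fun x => f x • h x) m := by
  rw [integrable_withDensity_iff_integrable_smul' (by fun_prop) (by simp)]
  simp [ENNReal.toReal_ofReal, h0]

/-- The score function `∇ log ρ`. -/
noncomputable def score (ρ : E → ℝ) (g : E → E) (x : E) : E := (ρ x)⁻¹ • g x

/-- Turns the extended Fisher integral into a second moment of the score under the input law. The
value 0 of the score on the zero set of ρ is harmless, as the density gives that set no mass. -/
lemma integrable_score_sq (h : HasWeakGradient ρ g) (hm : Measurable ρ) (h0 : ∀ x, 0 ≤ ρ x)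
    {J : ℝ} (hJ0 : 0 ≤ J)
    (hJ : ∫⁻ x, ENNReal.ofReal (ρ x * ‖(ρ x)⁻¹ • g x‖ ^ 2) ≤ ENNReal.ofReal J) :
    AEStronglyMeasurable (score ρ g) (volume.withDensity fun x => ENNReal.ofReal (ρ x)) ∧
    Integrable (fun x => ‖score ρ g x‖ ^ 2) (volume.withDensity fun x => ENNReal.ofReal (ρ x)) ∧
    ∫ x, ‖score ρ g x‖ ^ 2 ∂(volume.withDensity fun x => ENNReal.ofReal (ρ x)) ≤ J := by
  have mv : AEStronglyMeasurable (score ρ g) volume :=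
    hm.inv.aestronglyMeasurable.smul h.locallyIntegrable_grad.aestronglyMeasurable
  have mj : AEStronglyMeasurable (fun x => ρ x * ‖score ρ g x‖ ^ 2) volume :=
    hm.aestronglyMeasurable.mul (mv.norm.pow 2)
  have nn : ∀ x, 0 ≤ ρ x * ‖score ρ g x‖ ^ 2 := fun x => mul_nonneg (h0 x) (by positivity)
  refine ⟨mv.mono_ac (withDensity_absolutelyContinuous _ _), ?_, ?_⟩
  · rw [integrable_withDensity_ofReal hm h0]
    simp only [smul_eq_mul]
    refine ⟨mj, ?_⟩
    rw [hasFiniteIntegral_iff_ofReal (Eventually.of_forall nn)]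
    exact hJ.trans_lt ENNReal.ofReal_lt_top
  · simp only [integral_withDensity_ofReal hm h0, smul_eq_mul]
    rw [integral_eq_lintegral_of_nonneg_ae (Eventually.of_forall nn) mj]
    exact ENNReal.toReal_le_of_le_ofReal hJ0 hJ

end VanTrees

/-! ### The van Trees inequality -/

section VanTreesInequality

open Filter Topology
open scoped RealInnerProductSpace

variable {E : Type*} [NormedAddCommGroup E] [InnerProductSpace ℝ E] [FiniteDimensional ℝ E]
  [MeasurableSpace E] [BorelSpace E]

section Channel

variable {μ : Measure E} [IsProbabilityMeasure μ] {ψ : E → E}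

lemma integral_inner_mul_gaussKernel (l : ℝ) (y₀ : E) :
    ∫ y : E, ⟪y₀, y⟫ * gaussKernel l y = 0 := by
  have h := integral_neg_eq_self (fun y : E => ⟪y₀, y⟫ * gaussKernel l y) volume
  have e : ∀ y : E, ⟪y₀, -y⟫ * gaussKernel l (-y) = -(⟪y₀, y⟫ * gaussKernel l y) := fun y => by
    simp [gaussKernel, inner_neg_right]
  simp only [e, integral_neg] at h
  linarith

/-- When ψ is the prior score, ψ(x) + (y - l x) is the x-gradient of the log joint density. Under
the joint law y - l x is N(0, l I) and independent of x, so the cross term vanishes. -/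
lemma integrable_integral_norm_add_sq (hψ : AEStronglyMeasurable ψ μ)
    (hi : Integrable (fun x => ‖ψ x‖ ^ 2) μ) {l : ℝ} (hl : 0 < l) :
    Integrable (fun p : E × E => ‖ψ p.1 + (p.2 - l • p.1)‖ ^ 2 * gaussKernel l (p.2 - l • p.1))
      (μ.prod volume) ∧
    ∫ p : E × E, ‖ψ p.1 + (p.2 - l • p.1)‖ ^ 2 * gaussKernel l (p.2 - l • p.1) ∂(μ.prod volume)
      = (∫ x, ‖ψ x‖ ^ 2 ∂μ) + Module.finrank ℝ E * l := by
  have mg := measurable_gaussKernel_right (E := E) l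
  have i1 := hi.mul_prod (integrable_gaussKernel (E := E) hl)
  have i2 := (integrable_const (1:ℝ) (μ := μ)).mul_prod
    (integrable_norm_pow_mul_gaussKernel (E := E) hl 2)
  have mψ : AEStronglyMeasurable (fun p : E × E => ψ p.1) (μ.prod volume) := hψ.comp_fst
  have i3 : Integrable (fun p : E × E => ⟪ψ p.1, p.2⟫ * gaussKernel l p.2) (μ.prod volume) := by
    refine (i1.add i2).mono' ((mψ.inner (by fun_prop)).mul
      (mg.comp measurable_snd).aestronglyMeasurable) (Eventually.of_forall fun p => ?_)
    have hg := (gaussKernel_pos hl p.2).le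
    rw [norm_mul, Real.norm_eq_abs, Real.norm_eq_abs, abs_of_nonneg hg]
    simp only [Pi.add_apply, one_mul, ← add_mul]
    refine mul_le_mul_of_nonneg_right ((abs_real_inner_le_norm _ _).trans ?_) hg
    nlinarith [sq_nonneg (‖ψ p.1‖ - ‖p.2‖), sq_nonneg ‖ψ p.1‖, sq_nonneg ‖p.2‖]
  have e : ∀ p : E × E, ‖ψ p.1 + p.2‖ ^ 2 * gaussKernel l p.2 = ‖ψ p.1‖ ^ 2 * gaussKernel l p.2 +
      2 * (⟪ψ p.1, p.2⟫ * gaussKernel l p.2) + 1 * (‖p.2‖ ^ 2 * gaussKernel l p.2) := fun p => by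
    rw [norm_add_sq_real]; ring
  have e' : ∀ p : E × E, ‖ψ p.1 + (p.2 + l • p.1 - l • p.1)‖ ^ 2 * gaussKernel l p.2
      = ‖ψ p.1 + p.2‖ ^ 2 * gaussKernel l p.2 := fun p => by rw [add_sub_cancel_right]
  have i12 : Integrable (fun p : E × E => ‖ψ p.1‖ ^ 2 * gaussKernel l p.2 +
      2 * (⟪ψ p.1, p.2⟫ * gaussKernel l p.2)) (μ.prod volume) := i1.add (i3.const_mul 2)
  constructor
  · rw [integrable_shear (f := fun x y => ‖ψ x + (y - l • x)‖ ^ 2)]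
    simp only [e', e]
    exact i12.add i2
  · rw [integral_shear (f := fun x y => ‖ψ x + (y - l • x)‖ ^ 2)]
    simp only [e', e]
    rw [integral_add i12 i2, integral_add i1 (i3.const_mul 2), integral_const_mul,
      integral_prod _ i3, integral_prod_mul (fun x => ‖ψ x‖ ^ 2),
      integral_prod_mul (fun _ : E => (1:ℝ)) (fun y : E => ‖y‖ ^ 2 * gaussKernel l y)]
    simp [integral_inner_mul_gaussKernel, integral_gaussKernel hl,
      integral_norm_sq_mul_gaussKernel hl]

end Channel

variable {ρ : E → ℝ} {g : E → E}

lemma contDiff_inner_sub_mul_tiltWeight (l a : ℝ) (y v : E) :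
    ContDiff ℝ (⊤ : ℕ∞) (fun x : E => (⟪x, v⟫ - a) * tiltWeight l y x) := by
  unfold tiltWeight
  refine ((contDiff_id.inner ℝ contDiff_const).sub contDiff_const).mul (Real.contDiff_exp.comp ?_)
  exact (contDiff_id.inner ℝ contDiff_const).sub
    ((contDiff_const.mul (contDiff_norm_sq ℝ)).div_const 2)

/-- The vector y - l x is the x-gradient of the exponent of the weight, i.e. the likelihood score.
-/
lemma fderiv_inner_sub_mul_tiltWeight (l a : ℝ) (y x : E) {v : E} (hv : ‖v‖ = 1) :
    fderiv ℝ (fun x : E => (⟪x, v⟫ - a) * tiltWeight l y x) x v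
      = (1 + (⟪x, v⟫ - a) * ⟪y - l • x, v⟫) * tiltWeight l y x := by
  have hd : DifferentiableAt ℝ (fun x : E => (⟪x, v⟫ - a) * tiltWeight l y x) x :=
    (contDiff_inner_sub_mul_tiltWeight l a y v).differentiable (by simp) x
  rw [← hd.lineDeriv_eq_fderiv]
  refine HasLineDerivAt.lineDeriv ?_
  have h1 : HasDerivAt (fun t : ℝ => ⟪x + t • v, v⟫ - a) 1 0 := by
    have : (fun t : ℝ => ⟪x + t • v, v⟫ - a) = fun t => (⟪x, v⟫ - a) + t := by
      funext t
      rw [inner_add_left, inner_smul_left, real_inner_self_eq_norm_sq, hv]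
      simp
      ring
    rw [this]
    exact (hasDerivAt_id 0).const_add _
  have h2 : HasDerivAt (fun t : ℝ => ⟪x + t • v, y⟫ - l * ‖x + t • v‖ ^ 2 / 2)
      ⟪y - l • x, v⟫ 0 := by
    have : (fun t : ℝ => ⟪x + t • v, y⟫ - l * ‖x + t • v‖ ^ 2 / 2) = fun t =>
        (⟪x, y⟫ - l * ‖x‖ ^ 2 / 2) + t * ⟪y - l • x, v⟫ + t ^ 2 * (-(l / 2)) := by
      funext t
      rw [norm_add_sq_real, inner_add_left, inner_smul_left, inner_smul_right, norm_smul, hv,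
        inner_sub_left, inner_smul_left, real_inner_comm v y, mul_one, Real.norm_eq_abs, sq_abs]
      simp
      ring
    rw [this]
    refine ((((hasDerivAt_id (0:ℝ)).mul_const _).const_add _).add
      (((hasDerivAt_id (0:ℝ)).pow 2).mul_const _)).congr_deriv ?_
    simp
  have h3 := HasDerivAt.mul h1 h2.exp
  unfold HasLineDerivAt tiltWeight
  refine h3.congr_deriv ?_
  simp only [zero_smul, add_zero]
  ring

variable [IsProbabilityMeasure (volume.withDensity fun x => ENNReal.ofReal (ρ x))]

/-- The van Trees inequality (Bayesian Cramér-Rao bound) for the Gaussian channel. -/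
theorem sq_card_le_mul_mmse {ι : Type*} [Fintype ι] [Nonempty ι] (b : OrthonormalBasis ι ℝ E)
    (h : HasWeakGradient ρ g) (hm : Measurable ρ) (h0 : ∀ x, 0 ≤ ρ x) {J : ℝ} (hJ0 : 0 ≤ J)
    (hJ : ∫⁻ x, ENNReal.ofReal (ρ x * ‖(ρ x)⁻¹ • g x‖ ^ 2) ≤ ENNReal.ofReal J)
    (h4 : Integrable (fun x => ‖x‖ ^ 4) (volume.withDensity fun x => ENNReal.ofReal (ρ x)))
    {l : ℝ} (hl : 0 < l) :
    (Fintype.card ι : ℝ) ^ 2 ≤ (J + Fintype.card ι * l) *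
      mmse (volume.withDensity fun x => ENNReal.ofReal (ρ x)) b l := by
  classical
  obtain ⟨mψ, iψ, hψJ⟩ := integrable_score_sq h hm h0 hJ0 hJ
  set μ := volume.withDensity fun x => ENNReal.ofReal (ρ x) with hμ
  set ψ := score ρ g with hψ
  set n : ℝ := (Fintype.card ι : ℝ) with hn
  have hn0 : 0 < n := by simp only [hn]; exact_mod_cast Fintype.card_pos
  have hfin : (Module.finrank ℝ E : ℝ) = n := by
    rw [hn, Module.finrank_eq_card_basis b.toBasis]
  have iρ : Integrable ρ := by
    have := (integrable_withDensity_ofReal (m := volume) hm h0 (fun _ => (1:ℝ))).1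
      (integrable_const _)
    simpa using this
  have iψ1 : Integrable ψ μ := by
    refine (memLp_two_iff_integrable_sq_norm mψ).2 iψ |>.integrable (by norm_num)
  -- Off the zero set of ρ this is the definition of the score; on it, g vanishes almost everywhere.
  have hgψ : g =ᵐ[volume] fun x => ρ x • ψ x := by
    filter_upwards [h.ae_eq_zero hm h0] with x hx
    by_cases hz : ρ x = 0
    · rw [hx hz, hz, zero_smul]
    · simp only [hψ, score]
      rw [smul_smul, mul_inv_cancel₀ hz, one_smul]
  have ig : Integrable g := ((integrable_withDensity_ofReal hm h0 ψ).1 iψ1).congr hgψ.symm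
  obtain ⟨iV, hV⟩ := integrable_integral_norm_add_sq mψ iψ hl
  -- AM-GM with a fixed weight s, unlike Cauchy-Schwarz for each y, is linear and can be integrated
  -- over y directly. This s makes s⁻¹ times the second moment of the full score at most n, leaving
  -- n ≤ s · mmse.
  set s : ℝ := (J + n * l) / n with hs
  have hs0 : 0 < s := by positivity
  have g2 := ExpGrowth.norm_pow (E := E) 2
  -- the inequality at a fixed observation
  have point : ∀ y, 2 * n * evidence μ l y ≤ s * (moment μ (fun x => ‖x‖ ^ 2) l y -
      ∑ i, moment₁ μ (b i) l y ^ 2 / evidence μ l y) +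
      s⁻¹ * ∫ x, ‖ψ x + (y - l • x)‖ ^ 2 * tiltWeight l y x ∂μ := by
    intro y
    have hq := evidence_pos (μ := μ) hl y
    set a : ι → ℝ := fun i => postMean μ (b i) l y with ha
    have ga : ∀ i, ExpGrowth (fun x : E => ⟪x, b i⟫ - a i) := fun i =>
      (ExpGrowth.inner_right _).sub (ExpGrowth.const _)
    have gv : ∀ i, ExpGrowth (fun x : E => ⟪y - l • x, b i⟫) := fun i => by
      have := (ExpGrowth.const (E := E) ⟪y, b i⟫).sub
        ((ExpGrowth.const (E := E) l).mul (ExpGrowth.inner_right (b i)))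
      simpa [inner_sub_left, inner_smul_left] using this
    have gav : ∀ i, ExpGrowth (fun x : E => 1 + (⟪x, b i⟫ - a i) * ⟪y - l • x, b i⟫) := fun i =>
      (ExpGrowth.const 1).add ((ga i).mul (gv i))
    have iB : ∀ i, Integrable (fun x => (⟪x, b i⟫ - a i) * tiltWeight l y x * ⟪ψ x, b i⟫) μ := by
      intro i
      obtain ⟨K, -, hK⟩ := (ga i).bounded_mul_tiltWeight hl y
      refine Integrable.bdd_mul (c := K) (iψ1.inner_const (b i))
        ((ga i).measurable.mul (measurable_tiltWeight_right l y)).aestronglyMeasurable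
        (Eventually.of_forall hK)
    have iA : ∀ i, Integrable (fun x => (1 + (⟪x, b i⟫ - a i) * ⟪y - l • x, b i⟫) *
        tiltWeight l y x) μ := fun i => (gav i).integrable hl y
    -- Integration by parts against ρ. The test function is the centred coordinate times the weight;
    -- the Gaussian factor makes it and its derivative bounded, but not compactly supported.
    have test : ∀ i, ∫ x, (1 + (⟪x, b i⟫ - a i) * ⟪y - l • x, b i⟫) * tiltWeight l y x ∂μ
        = -∫ x, (⟪x, b i⟫ - a i) * tiltWeight l y x * ⟪ψ x, b i⟫ ∂μ := by
      intro i
      obtain ⟨K, hK0, hK⟩ := (ga i).bounded_mul_tiltWeight hl y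
      obtain ⟨K', hK0', hK'⟩ := (gav i).bounded_mul_tiltWeight hl y
      have := h.integral_mul_fderiv_of_bounded iρ ig
        (contDiff_inner_sub_mul_tiltWeight l (a i) y (b i)) (b i) (C := max K K')
        (fun x => (hK x).trans (le_max_left _ _))
        (fun x => by
          rw [fderiv_inner_sub_mul_tiltWeight _ _ _ _ (b.norm_eq_one i)]
          exact (hK' x).trans (le_max_right _ _))
      simp only [fderiv_inner_sub_mul_tiltWeight _ _ _ _ (b.norm_eq_one i)] at this
      rw [hμ, integral_withDensity_ofReal hm h0, integral_withDensity_ofReal hm h0]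
      simp only [smul_eq_mul]
      rw [this]
      congr 1
      refine integral_congr_ae ?_
      filter_upwards [hgψ] with x hx
      rw [hx, inner_smul_left]
      simp
      ring
    have iC : ∀ i, Integrable (fun x => (⟪x, b i⟫ - a i) * ⟪ψ x + (y - l • x), b i⟫ *
        tiltWeight l y x) μ := by
      intro i
      refine ((iB i).add (((ga i).mul (gv i)).integrable hl y)).congr
        (Eventually.of_forall fun x => ?_)
      simp only [Pi.add_apply, inner_add_left]
      ring
    -- Summed over coordinates: given y, the posterior expectation of ⟨x - a, full score⟩ is -n.
    have hsum : n * evidence μ l y = -∫ x, (∑ i, (⟪x, b i⟫ - a i) *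
        ⟪ψ x + (y - l • x), b i⟫) * tiltWeight l y x ∂μ := by
      have t1 : ∑ i, (∫ x, (1 + (⟪x, b i⟫ - a i) * ⟪y - l • x, b i⟫) * tiltWeight l y x ∂μ +
          ∫ x, (⟪x, b i⟫ - a i) * tiltWeight l y x * ⟪ψ x, b i⟫ ∂μ) = 0 :=
        Finset.sum_eq_zero fun i _ => by rw [test i]; ring
      have t2 : ∀ i, ∫ x, (1 + (⟪x, b i⟫ - a i) * ⟪y - l • x, b i⟫) * tiltWeight l y x ∂μ +
          ∫ x, (⟪x, b i⟫ - a i) * tiltWeight l y x * ⟪ψ x, b i⟫ ∂μ = evidence μ l y +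
          ∫ x, (⟪x, b i⟫ - a i) * ⟪ψ x + (y - l • x), b i⟫ * tiltWeight l y x ∂μ := by
        intro i
        have i1 := (ExpGrowth.const (E := E) 1).integrable (μ := μ) hl y
        rw [evidence, moment, ← integral_add (iA i) (iB i), ← integral_add i1 (iC i)]
        refine integral_congr_ae (Eventually.of_forall fun x => ?_)
        simp only [inner_add_left]
        ring
      simp only [t2, Finset.sum_add_distrib, Finset.sum_const, Finset.card_univ,
        nsmul_eq_mul] at t1
      simp only [Finset.sum_mul]
      rw [integral_finsetSum _ fun i _ => iC i]
      linarith
    have gsq : ExpGrowth (fun x : E => ∑ i, (⟪x, b i⟫ - a i) ^ 2) := by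
      have e : (fun x : E => ∑ i, (⟪x, b i⟫ - a i) ^ 2)
          = fun x => ‖x - ∑ i, a i • b i‖ ^ 2 := by
        funext x
        rw [← b.sum_sq_inner_left]
        refine Finset.sum_congr rfl fun i _ => ?_
        rw [inner_sub_left, sum_inner]
        simp [inner_smul_left, b.inner_eq_ite]
      rw [e]
      set c := ∑ i, a i • b i
      refine ExpGrowth.of_le ((ExpGrowth.norm_pow 2 |>.add (ExpGrowth.const (‖c‖ ^ 2))) |>.mul
        (ExpGrowth.const 2)) (by fun_prop) fun x => ?_
      rw [abs_of_nonneg (by positivity)]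
      have : ‖x - c‖ ^ 2 ≤ (‖x‖ + ‖c‖) ^ 2 := by gcongr; exact norm_sub_le _ _
      nlinarith [sq_nonneg (‖x‖ - ‖c‖)]
    have hsq : moment μ (fun x => ∑ i, (⟪x, b i⟫ - a i) ^ 2) l y
        = moment μ (fun x => ‖x‖ ^ 2) l y - ∑ i, moment₁ μ (b i) l y ^ 2 / evidence μ l y := by
      have gi := fun i => ExpGrowth.inner_right (b i)
      have gS : ExpGrowth (fun x : E => ∑ i, -2 * a i * ⟪x, b i⟫) := by
        have := ExpGrowth.inner_right (∑ i, (-2 * a i) • b i)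
        simpa [inner_sum, inner_smul_right] using this
      have e : (fun x : E => ∑ i, (⟪x, b i⟫ - a i) ^ 2) = fun x : E => (‖x‖ ^ 2 +
          ∑ i, -2 * a i * ⟪x, b i⟫) + (∑ i, a i ^ 2) * 1 := by
        funext x
        rw [← b.sum_sq_inner_left x, mul_one, ← Finset.sum_add_distrib, ← Finset.sum_add_distrib]
        exact Finset.sum_congr rfl fun i _ => by ring
      rw [e, moment_add (g2.add gS) ((ExpGrowth.const _).mul (ExpGrowth.const 1)) hl,
        moment_add g2 gS hl, moment_const_mul,
        moment_sum _ (fun i => (ExpGrowth.const (-2 * a i)).mul (gi i)) hl, Finset.sum_mul,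
        add_assoc, ← Finset.sum_add_distrib, sub_eq_add_neg, ← Finset.sum_neg_distrib]
      congr 1
      refine Finset.sum_congr rfl fun i _ => ?_
      rw [moment_const_mul]
      have : moment₁ μ (b i) l y = a i * evidence μ l y := by
        simp only [ha, postMean]; field_simp
      change -2 * a i * moment₁ μ (b i) l y + a i ^ 2 * evidence μ l y = _
      rw [this]
      field_simp
      ring
    have iN : Integrable (fun x => ‖ψ x + (y - l • x)‖ ^ 2 * tiltWeight l y x) μ := by
      obtain ⟨K, -, hK⟩ := (ExpGrowth.const (E := E) 1).bounded_mul_tiltWeight hl y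
      have gN : ExpGrowth (fun x : E => ‖y - l • x‖ ^ 2) := by
        refine ExpGrowth.of_le ((ExpGrowth.const (2 * ‖y‖ ^ 2)).add ((ExpGrowth.const
          (2 * l ^ 2)).mul g2)) (by fun_prop) fun x => ?_
        rw [abs_of_nonneg (by positivity)]
        have : ‖y - l • x‖ ^ 2 ≤ (‖y‖ + l * ‖x‖) ^ 2 := by
          gcongr
          refine (norm_sub_le _ _).trans_eq ?_
          rw [norm_smul, Real.norm_eq_abs, abs_of_pos hl]
        nlinarith [sq_nonneg (‖y‖ - l * ‖x‖)]
      refine (((iψ.const_mul 2).mul_const K).add ((gN.integrable hl y).const_mul 2)).mono'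
        (((mψ.add (by fun_prop)).norm.pow 2).mul
          (measurable_tiltWeight_right l y).aestronglyMeasurable)
        (Eventually.of_forall fun x => ?_)
      have hw := (tiltWeight_pos l y x).le
      have hwK : tiltWeight l y x ≤ K := by simpa [abs_of_nonneg hw] using hK x
      rw [Real.norm_eq_abs, abs_of_nonneg (by positivity)]
      simp only [Pi.add_apply]
      have : ‖ψ x + (y - l • x)‖ ^ 2 ≤ 2 * ‖ψ x‖ ^ 2 + 2 * ‖y - l • x‖ ^ 2 := by
        have := pow_le_pow_left₀ (norm_nonneg _) (norm_add_le (ψ x) (y - l • x)) 2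
        nlinarith [sq_nonneg (‖ψ x‖ - ‖y - l • x‖)]
      calc _ ≤ (2 * ‖ψ x‖ ^ 2 + 2 * ‖y - l • x‖ ^ 2) * tiltWeight l y x := by gcongr
        _ = 2 * ‖ψ x‖ ^ 2 * tiltWeight l y x + 2 * (‖y - l • x‖ ^ 2 * tiltWeight l y x) := by ring
        _ ≤ _ := by gcongr
    rw [mul_assoc, hsum, ← hsq, moment, ← integral_const_mul, ← integral_const_mul,
      ← integral_neg, ← integral_const_mul, ← integral_add ((gsq.integrable hl y).const_mul _)
      (iN.const_mul _)]
    refine integral_mono ?_ (((gsq.integrable hl y).const_mul _).add (iN.const_mul _))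
      fun x => ?_
    · refine (Integrable.neg ?_).const_mul 2
      simp only [Finset.sum_mul]
      exact integrable_finsetSum _ fun i _ => iC i
    · have hw := (tiltWeight_pos l y x).le
      -- In each coordinate this is s⁻¹ (s p + r)² ≥ 0, expanded.
      have key : 2 * -∑ i, (⟪x, b i⟫ - a i) * ⟪ψ x + (y - l • x), b i⟫ ≤
          s * ∑ i, (⟪x, b i⟫ - a i) ^ 2 + s⁻¹ * ‖ψ x + (y - l • x)‖ ^ 2 := by
        rw [← b.sum_sq_inner_left (ψ x + (y - l • x)), ← Finset.sum_neg_distrib, Finset.mul_sum,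
          Finset.mul_sum, Finset.mul_sum, ← Finset.sum_add_distrib]
        refine Finset.sum_le_sum fun i _ => ?_
        have h1 := mul_nonneg (inv_pos.2 hs0).le
          (sq_nonneg (s * (⟪x, b i⟫ - a i) + ⟪ψ x + (y - l • x), b i⟫))
        have h2 : s⁻¹ * s = 1 := inv_mul_cancel₀ hs0.ne'
        have h3 : s⁻¹ * (s * (⟪x, b i⟫ - a i) + ⟪ψ x + (y - l • x), b i⟫) ^ 2
            = (s⁻¹ * s) * s * (⟪x, b i⟫ - a i) ^ 2 + 2 * (s⁻¹ * s) * ((⟪x, b i⟫ - a i) *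
              ⟪ψ x + (y - l • x), b i⟫) + s⁻¹ * ⟪ψ x + (y - l • x), b i⟫ ^ 2 := by ring
        rw [h3, h2] at h1
        linarith
      have := mul_le_mul_of_nonneg_right key hw
      linarith
  have i2 : Integrable (fun x => ‖x‖ ^ 2) μ := integrable_norm_pow_of_le h4 (by norm_num)
  have j1 := integrable_moment_mul_gaussKernel (integrable_const (1 : ℝ) (μ := μ)) hl
  have e1 := integral_moment_mul_gaussKernel (integrable_const (1 : ℝ) (μ := μ)) hl
  have j2 := integrable_moment_mul_gaussKernel i2 hl
  have e2 := integral_moment_mul_gaussKernel i2 hl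
  have j3 : Integrable (fun y => (∑ i, moment₁ μ (b i) l y ^ 2 / evidence μ l y) *
      gaussKernel l y) := by
    simp only [Finset.sum_mul]
    exact integrable_finsetSum _ fun i _ => integrable_moment₁_sq_div b h4 i hl
  have e4 : ∀ y, (∫ x, ‖ψ x + (y - l • x)‖ ^ 2 * tiltWeight l y x ∂μ) * gaussKernel l y
      = ∫ x, ‖ψ x + (y - l • x)‖ ^ 2 * gaussKernel l (y - l • x) ∂μ := fun y => by
    rw [← integral_mul_const]
    refine integral_congr_ae (Eventually.of_forall fun x => ?_)
    simp only [mul_assoc, tiltWeight_mul_gaussKernel hl y x]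
  have j4 : Integrable (fun y => (∫ x, ‖ψ x + (y - l • x)‖ ^ 2 * tiltWeight l y x ∂μ) *
      gaussKernel l y) := by
    simp only [e4]
    exact iV.integral_prod_right
  have e5 : ∫ y, (∫ x, ‖ψ x + (y - l • x)‖ ^ 2 * tiltWeight l y x ∂μ) * gaussKernel l y
      = (∫ x, ‖ψ x‖ ^ 2 ∂μ) + n * l := by
    simp only [e4]
    rw [← hfin, ← hV, integral_prod_symm _ iV]
  have j23 : Integrable (fun y => moment μ (fun x => ‖x‖ ^ 2) l y * gaussKernel l y -
      (∑ i, moment₁ μ (b i) l y ^ 2 / evidence μ l y) * gaussKernel l y) := j2.sub j3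
  have main : ∫ y, 2 * n * (evidence μ l y * gaussKernel l y) ≤
      ∫ y, s * (moment μ (fun x => ‖x‖ ^ 2) l y * gaussKernel l y -
        (∑ i, moment₁ μ (b i) l y ^ 2 / evidence μ l y) * gaussKernel l y) +
        s⁻¹ * ((∫ x, ‖ψ x + (y - l • x)‖ ^ 2 * tiltWeight l y x ∂μ) * gaussKernel l y) := by
    refine integral_mono (j1.const_mul _) ((j23.const_mul _).add (j4.const_mul _))
      fun y => ?_
    have := mul_le_mul_of_nonneg_right (point y) (gaussKernel_pos hl y).le
    simp only at this ⊢
    linarith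
  rw [integral_const_mul, integral_add (j23.const_mul _) (j4.const_mul _),
    integral_const_mul, integral_const_mul, integral_sub j2 j3, e2, e5] at main
  have e1' : ∫ y, evidence μ l y * gaussKernel l y = 1 := by
    simpa [evidence] using e1
  rw [e1', mul_one] at main
  change 2 * n ≤ s * mmse μ b l + _ at main
  have hb : s⁻¹ * ((∫ x, ‖ψ x‖ ^ 2 ∂μ) + n * l) ≤ n := by
    have : (∫ x, ‖ψ x‖ ^ 2 ∂μ) + n * l ≤ s * n := by
      rw [hs, div_mul_cancel₀ _ hn0.ne']
      linarith
    rwa [inv_mul_le_iff₀ hs0]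
  have hsn : s * n = J + n * l := by rw [hs, div_mul_cancel₀ _ hn0.ne']
  have : n ≤ s * mmse μ b l := by linarith
  calc n ^ 2 = n * n := by ring
    _ ≤ n * (s * mmse μ b l) := by gcongr
    _ = (J + n * l) * mmse μ b l := by rw [← hsn]; ring

end VanTreesInequality

/-! ### Mutual information of the Gaussian channel -/

section MutualInformation

open Filter Topology InformationTheory
open scoped RealInnerProductSpace

/-- The data processing inequality for e and for its inverse. -/
lemma klDiv_map_measurableEquiv {𝓧 𝓨 : Type*} [MeasurableSpace 𝓧] [MeasurableSpace 𝓨]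
    (μ ν : Measure 𝓧) [IsFiniteMeasure μ] [IsFiniteMeasure ν] (e : 𝓧 ≃ᵐ 𝓨) :
    klDiv (μ.map e) (ν.map e) = klDiv μ ν := by
  refine le_antisymm (klDiv_map_le μ ν e.measurable) ?_
  have := klDiv_map_le (μ.map e) (ν.map e) e.symm.measurable
  rwa [Measure.map_map e.symm.measurable e.measurable,
    Measure.map_map e.symm.measurable e.measurable, e.symm_comp_self, Measure.map_id,
    Measure.map_id] at this

lemma mutualInfo_congr {Ω F G : Type*} [MeasurableSpace Ω] [MeasurableSpace F] [MeasurableSpace G]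
    {P : Measure Ω} (X : Ω → F) {Y Y' : Ω → G} (h : Y =ᵐ[P] Y') :
    mutualInfo X Y P = mutualInfo X Y' P := by
  unfold mutualInfo
  rw [Measure.map_congr h, Measure.map_congr (f := fun ω => (X ω, Y ω)) (g := fun ω => (X ω, Y' ω))]
  filter_upwards [h] with ω hω
  rw [hω]

lemma mutualInfo_measurableEquiv_comp {Ω F G H : Type*} [MeasurableSpace Ω] [MeasurableSpace F]
    [MeasurableSpace G] [MeasurableSpace H] {P : Measure Ω} [IsFiniteMeasure P] {X : Ω → F}
    {Y : Ω → G} (hX : AEMeasurable X P) (hY : AEMeasurable Y P) (e : G ≃ᵐ H) :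
    mutualInfo X (fun ω => e (Y ω)) P = mutualInfo X Y P := by
  unfold mutualInfo
  rw [← klDiv_map_measurableEquiv (P.map fun ω => (X ω, Y ω)) _
    ((MeasurableEquiv.refl F).prodCongr e)]
  congr 1
  · rw [AEMeasurable.map_map_of_aemeasurable (MeasurableEquiv.measurable _).aemeasurable
      (hX.prodMk hY)]
    rfl
  · have h1 : P.map (fun ω => e (Y ω)) = (P.map Y).map e :=
      (AEMeasurable.map_map_of_aemeasurable e.measurable.aemeasurable hY).symm
    have h2 := Measure.map_prod_map (P.map X) (P.map Y) measurable_id e.measurable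
    rw [Measure.map_id] at h2
    rw [h1, h2]
    rfl

variable {E : Type*} [NormedAddCommGroup E] [InnerProductSpace ℝ E] [FiniteDimensional ℝ E]
  [MeasurableSpace E] [BorelSpace E]

lemma isProbabilityMeasure_gaussKernel {l : ℝ} (hl : 0 < l) :
    IsProbabilityMeasure ((volume : Measure E).withDensity
      fun y => ENNReal.ofReal (gaussKernel l y)) := by
  refine ⟨?_⟩
  rw [withDensity_apply _ MeasurableSet.univ, Measure.restrict_univ,
    ← ofReal_integral_eq_lintegral_ofReal (integrable_gaussKernel hl)
      (Eventually.of_forall fun y => (gaussKernel_pos hl y).le), integral_gaussKernel hl,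
    ENNReal.ofReal_one]

/-- Both sides have characteristic function exp(-l ‖t‖² / 2). -/
lemma map_smul_stdGaussian {l : ℝ} (hl : 0 < l) :
    (stdGaussian E).map (fun z => √l • z)
      = volume.withDensity fun y => ENNReal.ofReal (gaussKernel l y) := by
  have := isProbabilityMeasure_gaussKernel (E := E) hl
  have : IsProbabilityMeasure ((stdGaussian E).map (fun z => √l • z)) :=
    Measure.isProbabilityMeasure_map (by fun_prop)
  refine Measure.ext_of_charFun (funext fun t => ?_)
  rw [charFun_map_smul, charFun_stdGaussian, charFun_apply,
    integral_withDensity_ofReal (measurable_gaussKernel_right l)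
      (fun y => (gaussKernel_pos hl y).le)]
  have h := GaussianFourier.integral_cexp_neg_mul_sq_norm_add (V := E)
    (b := ((2 * l : ℝ) : ℂ)⁻¹) (by
      rw [← Complex.ofReal_inv, Complex.ofReal_re]; positivity) Complex.I t
  have e : ∀ y : E, gaussKernel l y • Complex.exp (⟪y, t⟫ * Complex.I)
      = (((2 * Real.pi * l) ^ (-(Module.finrank ℝ E / 2 : ℝ)) : ℝ) : ℂ) *
        Complex.exp (-((2 * l : ℝ) : ℂ)⁻¹ * ‖y‖ ^ 2 + Complex.I * ⟪t, y⟫) := fun y => by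
    rw [gaussKernel, Complex.real_smul, Complex.ofReal_mul, mul_assoc, Complex.ofReal_exp,
      ← Complex.exp_add, real_inner_comm]
    congr 2
    push_cast
    field_simp
  simp only [e]
  rw [integral_const_mul, h]
  have e2 : ((Real.pi : ℂ) / ((2 * l : ℝ) : ℂ)⁻¹) ^ (Module.finrank ℝ E / 2 : ℂ)
      = (((2 * Real.pi * l) ^ (Module.finrank ℝ E / 2 : ℝ) : ℝ) : ℂ) := by
    rw [Complex.ofReal_cpow (by positivity)]
    congr 1
    · push_cast; field_simp
    · push_cast; rfl
  rw [e2, ← mul_assoc, ← Complex.ofReal_mul, ← Real.rpow_add (by positivity), neg_add_cancel,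
    Real.rpow_zero, Complex.ofReal_one, one_mul, norm_smul, Real.norm_eq_abs, ← Complex.ofReal_pow,
    mul_pow, sq_abs, Real.sq_sqrt hl.le]
  congr 1
  rw [Complex.I_sq]
  push_cast
  field_simp
  norm_num

variable {μ : Measure E} [IsProbabilityMeasure μ]

variable (μ) in
/-- The joint law of the input `X` and the output `l X + √l Z` of the Gaussian channel. -/
noncomputable def jointLaw (l : ℝ) : Measure (E × E) :=
  (μ.prod volume).withDensity fun p => ENNReal.ofReal (gaussKernel l (p.2 - l • p.1))

lemma measurable_gaussKernel_sub (l : ℝ) :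
    Measurable (fun p : E × E => gaussKernel l (p.2 - l • p.1)) :=
  (measurable_gaussKernel_right l).comp (by fun_prop)

lemma map_shear_prod (l : ℝ) :
    (μ.prod ((volume : Measure E).withDensity fun y => ENNReal.ofReal (gaussKernel l y))).map
      (shear l) = jointLaw μ l := by
  have mg := measurable_gaussKernel_right (E := E) l
  rw [prod_withDensity_right (by fun_prop)]
  ext s hs
  rw [Measure.map_apply (shear l).measurable hs, jointLaw, withDensity_apply _ hs,
    withDensity_apply _ ((shear l).measurable hs),
    ← (measurePreserving_shear (μ := μ) l).setLIntegral_comp_preimage hs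
      (measurable_gaussKernel_sub l).ennreal_ofReal]
  simp [shear]

lemma measurable_evidence_right (l : ℝ) : Measurable (evidence μ l) :=
  (measurable_evidence (μ := μ)).comp (measurable_prodMk_left (x := l))

lemma map_snd_jointLaw {l : ℝ} (hl : 0 < l) : (jointLaw μ l).map Prod.snd
    = volume.withDensity fun y => ENNReal.ofReal (evidence μ l y * gaussKernel l y) := by
  ext s hs
  have i := integrable_prod_channel (μ := μ) (ψ := fun _ => 1) (integrable_const 1) hl
  rw [Measure.map_apply measurable_snd hs, jointLaw, withDensity_apply _ (measurable_snd hs),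
    withDensity_apply _ hs, ← univ_prod, ← Measure.prod_restrict, Measure.restrict_univ,
    lintegral_prod_symm' _ (measurable_gaussKernel_sub l).ennreal_ofReal]
  refine lintegral_congr_ae (ae_restrict_of_ae ?_)
  filter_upwards [i.prod_left_ae] with y hy
  simp only [one_mul] at hy
  rw [← ofReal_integral_eq_lintegral_ofReal hy
    (Eventually.of_forall fun x => (gaussKernel_pos hl _).le), evidence,
    moment_mul_gaussKernel hl]
  simp

/-- Bayes' rule: the density relative to the product of the marginals is the normalised posterior
weight, so its logarithm is explicit. -/
lemma jointLaw_eq_withDensity {l : ℝ} (hl : 0 < l) :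
    jointLaw μ l = (μ.prod ((jointLaw μ l).map Prod.snd)).withDensity
      fun p => ENNReal.ofReal (tiltWeight l p.2 p.1 / evidence μ l p.2) := by
  have mg := measurable_gaussKernel_right (E := E) l
  have mq := measurable_evidence_right (μ := μ) l
  have mw : Measurable (fun p : E × E => tiltWeight l p.2 p.1) := by
    unfold tiltWeight; fun_prop
  rw [map_snd_jointLaw hl, prod_withDensity_right (by fun_prop), ← withDensity_mul _ (by fun_prop)
    (by fun_prop), jointLaw]
  congr 1
  funext p
  have hq := evidence_pos (μ := μ) hl p.2
  rw [Pi.mul_apply, ← ENNReal.ofReal_mul (mul_nonneg hq.le (gaussKernel_pos hl _).le),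
    ← tiltWeight_mul_gaussKernel hl]
  congr 1
  field_simp

lemma isProbabilityMeasure_jointLaw {l : ℝ} (hl : 0 < l) : IsProbabilityMeasure (jointLaw μ l) := by
  have := isProbabilityMeasure_gaussKernel (E := E) hl
  rw [← map_shear_prod]
  exact Measure.isProbabilityMeasure_map (shear l).measurable.aemeasurable

lemma llr_jointLaw {l : ℝ} (hl : 0 < l) :
    jointLaw μ l ≪ μ.prod ((jointLaw μ l).map Prod.snd) ∧
    llr (jointLaw μ l) (μ.prod ((jointLaw μ l).map Prod.snd)) =ᵐ[jointLaw μ l]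
      fun p => ⟪p.1, p.2⟫ - l * ‖p.1‖ ^ 2 / 2 - Real.log (evidence μ l p.2) := by
  have := isProbabilityMeasure_jointLaw (μ := μ) hl
  have : IsProbabilityMeasure ((jointLaw μ l).map Prod.snd) :=
    Measure.isProbabilityMeasure_map measurable_snd.aemeasurable
  have mq := measurable_evidence_right (μ := μ) l
  have mw : Measurable (fun p : E × E => tiltWeight l p.2 p.1) := by
    unfold tiltWeight; fun_prop
  have hac : jointLaw μ l ≪ μ.prod ((jointLaw μ l).map Prod.snd) := by
    conv_lhs => rw [jointLaw_eq_withDensity hl]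
    exact withDensity_absolutelyContinuous _ _
  refine ⟨hac, ?_⟩
  have hr := Measure.rnDeriv_withDensity (μ.prod ((jointLaw μ l).map Prod.snd))
    (f := fun p => ENNReal.ofReal (tiltWeight l p.2 p.1 / evidence μ l p.2)) (by fun_prop)
  rw [← jointLaw_eq_withDensity hl] at hr
  filter_upwards [hac.ae_le hr] with p hp
  have hq := evidence_pos (μ := μ) hl p.2
  have hw := tiltWeight_pos l p.2 p.1
  rw [llr, hp, ENNReal.toReal_ofReal (by positivity), Real.log_div hw.ne' hq.ne', tiltWeight,
    Real.log_exp]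

lemma integrable_inner_mul_gaussKernel_prod (h2 : Integrable (fun x => ‖x‖ ^ 2) μ) {l : ℝ}
    (hl : 0 < l) :
    Integrable (fun p : E × E => ⟪p.1, p.2⟫ * gaussKernel l p.2) (μ.prod volume) := by
  have mg := measurable_gaussKernel_right (E := E) l
  have i1 := h2.mul_prod (integrable_gaussKernel (E := E) hl)
  have i2 := (integrable_const (1:ℝ) (μ := μ)).mul_prod
    (integrable_norm_pow_mul_gaussKernel (E := E) hl 2)
  refine (i1.add i2).mono' (by fun_prop) (Eventually.of_forall fun p => ?_)
  have hg := (gaussKernel_pos hl p.2).le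
  rw [norm_mul, Real.norm_eq_abs, Real.norm_eq_abs, abs_of_nonneg hg]
  simp only [Pi.add_apply, one_mul, ← add_mul]
  refine mul_le_mul_of_nonneg_right ((abs_real_inner_le_norm _ _).trans ?_) hg
  nlinarith [sq_nonneg (‖p.1‖ - ‖p.2‖), sq_nonneg ‖p.1‖, sq_nonneg ‖p.2‖]

/-- The divergence is the mean of ⟨X, Y⟩ - l ‖X‖² / 2 - log q(Y). As the noise is centred and
independent of X, the mean of ⟨X, Y⟩ is l times that of ‖X‖²; fourth moments make each term
integrable. -/
theorem klDiv_jointLaw (h4 : Integrable (fun x => ‖x‖ ^ 4) μ) {l : ℝ} (hl : 0 < l) :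
    klDiv (jointLaw μ l) (μ.prod ((jointLaw μ l).map Prod.snd)) ≠ ∞ ∧
    (klDiv (jointLaw μ l) (μ.prod ((jointLaw μ l).map Prod.snd))).toReal = channelInfo μ l := by
  have := isProbabilityMeasure_jointLaw (μ := μ) hl
  have : IsProbabilityMeasure ((jointLaw μ l).map Prod.snd) :=
    Measure.isProbabilityMeasure_map measurable_snd.aemeasurable
  have mg := measurable_gaussKernel_right (E := E) l
  have mk := measurable_gaussKernel_sub (E := E) l
  have mq := measurable_evidence_right (μ := μ) l
  have h2 : Integrable (fun x => ‖x‖ ^ 2) μ := integrable_norm_pow_of_le h4 (by norm_num)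
  obtain ⟨hac, hllr⟩ := llr_jointLaw (μ := μ) hl
  have k0 : ∀ p : E × E, 0 ≤ gaussKernel l (p.2 - l • p.1) := fun p => (gaussKernel_pos hl _).le
  have i0 := integrable_inner_mul_gaussKernel_prod h2 hl
  have i1 := (h2.const_mul (l / 2)).mul_prod (integrable_gaussKernel (E := E) hl)
  have e1 : ∀ p : E × E, (⟪p.1, p.2 + l • p.1⟫ - l * ‖p.1‖ ^ 2 / 2) * gaussKernel l p.2
      = ⟪p.1, p.2⟫ * gaussKernel l p.2 + l / 2 * ‖p.1‖ ^ 2 * gaussKernel l p.2 := fun p => by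
    rw [inner_add_right, inner_smul_right, real_inner_self_eq_norm_sq]; ring
  have ia : Integrable (fun p : E × E => (⟪p.1, p.2⟫ - l * ‖p.1‖ ^ 2 / 2) *
      gaussKernel l (p.2 - l • p.1)) (μ.prod volume) := by
    rw [integrable_shear (f := fun x y => ⟪x, y⟫ - l * ‖x‖ ^ 2 / 2)]
    simp only [e1]
    exact i0.add i1
  have ea : ∫ p : E × E, (⟪p.1, p.2⟫ - l * ‖p.1‖ ^ 2 / 2) *
      gaussKernel l (p.2 - l • p.1) ∂(μ.prod volume) = l / 2 * ∫ x, ‖x‖ ^ 2 ∂μ := by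
    rw [integral_shear (f := fun x y => ⟪x, y⟫ - l * ‖x‖ ^ 2 / 2)]
    simp only [e1]
    rw [integral_add i0 i1, integral_prod _ i0, integral_prod_mul (fun x : E => l / 2 * ‖x‖ ^ 2),
      integral_gaussKernel hl, integral_const_mul]
    simp [integral_inner_mul_gaussKernel]
  obtain ⟨K, hK0, hK⟩ := exists_abs_log_evidence_le (μ := μ) h4 (l₂ := l) hl
  have ib : Integrable (fun p : E × E => Real.log (evidence μ l p.2) *
      gaussKernel l (p.2 - l • p.1)) (μ.prod volume) := by
    have j0 := integrable_prod_channel (μ := μ) (ψ := fun _ => 1) (integrable_const 1) hl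
    have j4 := integrable_norm_pow_four_channel h4 hl
    refine ((j0.add j4).const_mul (2 * K)).mono' (by fun_prop) (Eventually.of_forall fun p => ?_)
    rw [norm_mul, Real.norm_eq_abs, Real.norm_eq_abs, abs_of_nonneg (k0 p)]
    simp only [Pi.add_apply, ← add_mul, ← mul_assoc]
    refine mul_le_mul_of_nonneg_right ((hK l ⟨le_rfl, le_rfl⟩ p.2).trans ?_) (k0 p)
    have : 1 + ‖p.2‖ ^ 2 ≤ 2 * (1 + ‖p.2‖ ^ 4) := by nlinarith [sq_nonneg (‖p.2‖ ^ 2 - 1)]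
    calc K * (1 + ‖p.2‖ ^ 2) ≤ K * (2 * (1 + ‖p.2‖ ^ 4)) := by gcongr
      _ = 2 * K * (1 + ‖p.2‖ ^ 4) := by ring
  have eb : ∫ p : E × E, Real.log (evidence μ l p.2) * gaussKernel l (p.2 - l • p.1)
      ∂(μ.prod volume) = ∫ y, evidence μ l y * Real.log (evidence μ l y) * gaussKernel l y := by
    rw [integral_prod_symm _ ib]
    refine integral_congr_ae (Eventually.of_forall fun y => ?_)
    simp only
    rw [integral_const_mul, mul_right_comm, mul_comm, evidence, moment_mul_gaussKernel hl]
    simp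
  have e : ∀ p : E × E, gaussKernel l (p.2 - l • p.1) •
      (⟪p.1, p.2⟫ - l * ‖p.1‖ ^ 2 / 2 - Real.log (evidence μ l p.2)) =
      (⟪p.1, p.2⟫ - l * ‖p.1‖ ^ 2 / 2) * gaussKernel l (p.2 - l • p.1) -
      Real.log (evidence μ l p.2) * gaussKernel l (p.2 - l • p.1) := fun p => by
    rw [smul_eq_mul]; ring
  constructor
  · refine klDiv_ne_top hac ((integrable_congr hllr).2 ?_)
    rw [jointLaw, integrable_withDensity_ofReal mk k0]
    simp only [e]
    exact ia.sub ib
  · rw [toReal_klDiv_of_measure_eq hac (by simp), integral_congr_ae hllr]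
    conv_lhs => rw [jointLaw]
    rw [integral_withDensity_ofReal mk k0]
    simp only [e]
    rw [integral_sub ia ib, ea, eb, channelInfo]

theorem mutualInfo_channel {Ω : Type*} [MeasurableSpace Ω] {P : Measure Ω} [IsProbabilityMeasure P]
    {X Z : Ω → E} (hX : HasLaw X μ P) (hZ : HasLaw Z (stdGaussian E) P) (hXZ : IndepFun X Z P)
    (h4 : Integrable (fun x => ‖x‖ ^ 4) μ) {l : ℝ} (hl : 0 < l) :
    mutualInfo X (fun ω => √l • Z ω + l • X ω) P ≠ ∞ ∧
    (mutualInfo X (fun ω => √l • Z ω + l • X ω) P).toReal = channelInfo μ l := by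
  have mX := hX.aemeasurable
  have mZ := hZ.aemeasurable
  have mS : AEMeasurable (fun ω => √l • Z ω) P := mZ.const_smul _
  have hS : P.map (fun ω => √l • Z ω)
      = volume.withDensity fun y => ENNReal.ofReal (gaussKernel l y) := by
    rw [← map_smul_stdGaussian hl, ← hZ.map_eq,
      AEMeasurable.map_map_of_aemeasurable (by fun_prop) mZ]
    rfl
  have hXS : IndepFun X (fun ω => √l • Z ω) P :=
    hXZ.comp measurable_id (measurable_const_smul (√l))
  have hj : P.map (fun ω => (X ω, √l • Z ω + l • X ω)) = jointLaw μ l := by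
    rw [← map_shear_prod, ← hS, ← hX.map_eq,
      ← (indepFun_iff_map_prod_eq_prod_map_map mX mS).1 hXS,
      AEMeasurable.map_map_of_aemeasurable (shear l).measurable.aemeasurable (mX.prodMk mS)]
    rfl
  have hY : P.map (fun ω => √l • Z ω + l • X ω) = (jointLaw μ l).map Prod.snd := by
    have mY : AEMeasurable (fun ω => √l • Z ω + l • X ω) P := by fun_prop
    rw [← hj, AEMeasurable.map_map_of_aemeasurable measurable_snd.aemeasurable (mX.prodMk mY)]
    rfl
  unfold mutualInfo
  rw [hj, hY, hX.map_eq]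
  exact klDiv_jointLaw h4 hl

end MutualInformation

/-! ### From the signal-to-noise ratio to time -/

section OrnsteinUhlenbeck

open Filter Topology

/-- With w = u + 1 and c = 1 - a + b, right side minus left side equals (u - a) w² - c w + 1. The
hypothesis bounds this below by (c w)² / 3 - c w + 1 = (c w - 3/2)² / 3 + 1/4. -/
lemma threshold_inequality {a b u : ℝ} (hu : a + 1 / 3 * (1 - a + b) ^ 2 ≤ u) :
    (1 + u) * (b + a * u) ≤ u ^ 2 * (2 + u) := by
  have h1 := mul_nonneg (sub_nonneg.2 hu) (sq_nonneg (u + 1))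
  nlinarith [sq_nonneg ((1 - a + b) * (u + 1) - 3 / 2)]

/-- If `m` decreases at rate at most `M` and is not too small, then `l ↦ m l * (l * (l + α))`
increases. -/
lemma mul_le_mul_of_sub_le {α M l₁ l₂ m₁ m₂ : ℝ} (hα : 0 < α) (hM : 0 ≤ M) (h₁ : 0 < l₁)
    (h₁₂ : l₁ ≤ l₂) (hm : m₁ - m₂ ≤ M * (l₂ - l₁))
    (hc : M * (l₂ * (l₂ + α)) ≤ m₂ * (2 * l₂ + α)) :
    m₁ * (l₁ * (l₁ + α)) ≤ m₂ * (l₂ * (l₂ + α)) := by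
  have h₂ : 0 < l₂ := h₁.trans_le h₁₂
  have d : 0 ≤ l₂ - l₁ := sub_nonneg.2 h₁₂
  -- The increment to be bounded is at least (l₂ - l₁) (m₂ (l₁ + l₂ + α) - M l₁ (l₁ + α)). This
  -- inequality transfers hc, known only at l₂, to the sign of the second factor.
  have w : l₁ * (l₁ + α) * (2 * l₂ + α) ≤ l₂ * (l₂ + α) * (l₁ + l₂ + α) := by
    have e : l₁ * (2 * l₂ + α) ≤ l₂ * (l₁ + l₂ + α) := by nlinarith
    calc l₁ * (l₁ + α) * (2 * l₂ + α) = (l₁ + α) * (l₁ * (2 * l₂ + α)) := by ring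
      _ ≤ (l₂ + α) * (l₂ * (l₁ + l₂ + α)) := by gcongr
      _ = _ := by ring
  have key : M * (l₁ * (l₁ + α)) ≤ m₂ * (l₁ + l₂ + α) := by
    refine le_of_mul_le_mul_right ?_ (show 0 < 2 * l₂ + α by positivity)
    calc M * (l₁ * (l₁ + α)) * (2 * l₂ + α) = M * (l₁ * (l₁ + α) * (2 * l₂ + α)) := by ring
      _ ≤ M * (l₂ * (l₂ + α) * (l₁ + l₂ + α)) := by gcongr
      _ = M * (l₂ * (l₂ + α)) * (l₁ + l₂ + α) := by ring
      _ ≤ m₂ * (2 * l₂ + α) * (l₁ + l₂ + α) := by gcongr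
      _ = m₂ * (l₁ + l₂ + α) * (2 * l₂ + α) := by ring
  have a1 := mul_le_mul_of_nonneg_right hm (show 0 ≤ l₁ * (l₁ + α) by positivity)
  have a2 := mul_le_mul_of_nonneg_left key d
  nlinarith

/-- The signal-to-noise ratio of `X_t` as an observation of `X_0`. -/
noncomputable def snr (α t : ℝ) : ℝ := α / (Real.exp (2 * α * t) - 1)

lemma exp_sub_one_pos {α t : ℝ} (hα : 0 < α) (ht : 0 < t) : 0 < Real.exp (2 * α * t) - 1 :=
  sub_pos.2 (Real.one_lt_exp_iff.2 (by positivity))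

lemma snr_pos {α t : ℝ} (hα : 0 < α) (ht : 0 < t) : 0 < snr α t :=
  div_pos hα (exp_sub_one_pos hα ht)

lemma snr_le_snr {α s t : ℝ} (hα : 0 < α) (hs : 0 < s) (hst : s ≤ t) : snr α t ≤ snr α s := by
  have := exp_sub_one_pos hα hs
  unfold snr
  gcongr

/-- With e = exp(2αt) one has l + α = α e / (e - 1), and l' = -2 α² e / (e - 1)². -/
lemma hasDerivAt_snr {α t : ℝ} (hα : 0 < α) (ht : 0 < t) :
    HasDerivAt (snr α) (-2 * (snr α t * (snr α t + α))) t := by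
  have h0 := exp_sub_one_pos hα ht
  have h1 : HasDerivAt (fun t => Real.exp (2 * α * t) - 1) (Real.exp (2 * α * t) * (2 * α)) t := by
    have := ((hasDerivAt_id t).const_mul (2 * α)).exp.sub_const 1
    simpa using this
  refine ((hasDerivAt_const t α).div h1 h0.ne').congr_deriv ?_
  unfold snr
  field_simp
  ring

variable {E : Type*} [NormedAddCommGroup E] [InnerProductSpace ℝ E] [FiniteDimensional ℝ E]
  [MeasurableSpace E] [BorelSpace E] {μ : Measure E} [IsProbabilityMeasure μ]

/-- X_t is r (√l Z + l X_0) with r = exp(-αt) / l: the choice of l matches the noise coefficient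
too, and the bijection y ↦ r y does not change mutual information. -/
theorem _root_.IsOUProcess.mutualInfo_eq {Ω : Type*} [MeasurableSpace Ω] {P : Measure Ω}
    [IsProbabilityMeasure P] {α : ℝ} (hα : 0 < α) {X : ℝ → Ω → E} (hX : IsOUProcess α X P)
    (hX0 : HasLaw (X 0) μ P) (h4 : Integrable (fun x => ‖x‖ ^ 4) μ) {t : ℝ} (ht : 0 < t) :
    mutualInfo (X 0) (X t) P ≠ ∞ ∧
    (mutualInfo (X 0) (X t) P).toReal = channelInfo μ (snr α t) := by
  obtain ⟨Z, hZ, hI, hXt⟩ := hX.exists_innovation 0 t le_rfl ht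
  -- At s = 0 the past is indexed by [0, 0], that is, by the single time 0.
  have hXZ : IndepFun (X 0) Z P :=
    hI.comp (φ := fun f : Icc (0:ℝ) 0 → E => f ⟨0, by simp⟩) (measurable_pi_apply _) measurable_id
  have hl := snr_pos hα ht
  set l := snr α t with hldef
  have h0 := exp_sub_one_pos hα ht
  set r : ℝ := Real.exp (-α * t) / l with hr
  have hr0 : 0 < r := by positivity
  have hrl : r * l = Real.exp (-α * t) := div_mul_cancel₀ _ hl.ne'
  have hrs : r * √l = √((1 - Real.exp (-2 * α * t)) / α) := by
    rw [← Real.sqrt_sq hr0.le, ← Real.sqrt_mul (sq_nonneg r)]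
    congr 1
    have e1 : Real.exp (-α * t) ^ 2 = Real.exp (-2 * α * t) := by
      rw [← Real.exp_nat_mul]; congr 1; push_cast; ring
    have e2 : Real.exp (-2 * α * t) * Real.exp (2 * α * t) = 1 := by
      rw [← Real.exp_add]; simp
    rw [hr, div_pow, e1, hldef, snr]
    have e3 : 1 - Real.exp (-2 * α * t)
        = Real.exp (-2 * α * t) * (Real.exp (2 * α * t) - 1) := by rw [mul_sub, e2, mul_one]
    rw [e3]
    generalize Real.exp (-2 * α * t) = x
    field_simp
  have hae : X t =ᵐ[P] fun ω => MeasurableEquiv.smul₀ r hr0.ne' (√l • Z ω + l • X 0 ω) := by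
    filter_upwards [hXt] with ω hω
    rw [hω, MeasurableEquiv.coe_smul₀]
    simp only [smul_add, smul_smul, hrl, hrs, sub_zero]
    rw [add_comm]
  have mX := hX0.aemeasurable
  have mZ := hZ.aemeasurable
  rw [mutualInfo_congr _ hae, mutualInfo_measurableEquiv_comp mX (by fun_prop)]
  exact mutualInfo_channel hX0 hZ hXZ h4 hl

/-- The t-derivative is -mmse(l) l (l + α) with l decreasing in t, so it is monotone once l ↦
mmse(l) l (l + α) increases. -/
lemma convexOn_channelInfo_snr {ι : Type*} [Fintype ι] (b : OrthonormalBasis ι ℝ E)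
    (h4 : Integrable (fun x => ‖x‖ ^ 4) μ) {α M T : ℝ} (hα : 0 < α) (hM : 0 ≤ M) (hT : 0 < T)
    {c : E} (hMc : ∫ x, ‖x - c‖ ^ 4 ∂μ = M)
    (hc : ∀ t, T ≤ t →
      M * (snr α t * (snr α t + α)) ≤ mmse μ b (snr α t) * (2 * snr α t + α)) :
    ConvexOn ℝ (Ici T) (fun t => channelInfo μ (snr α t)) := by
  have hd : ∀ t, T ≤ t → HasDerivAt (fun t => channelInfo μ (snr α t))
      (-(mmse μ b (snr α t) * (snr α t * (snr α t + α)))) t := fun t ht => by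
    have ht0 := hT.trans_le ht
    refine ((hasDerivAt_channelInfo b h4 (snr_pos hα ht0)).comp t
      (hasDerivAt_snr hα ht0)).congr_deriv ?_
    ring
  refine MonotoneOn.convexOn_of_deriv (convex_Ici T)
    (fun t ht => (hd t ht).continuousAt.continuousWithinAt) ?_ ?_ <;> rw [interior_Ici]
  · exact fun t ht => (hd t (le_of_lt ht)).differentiableAt.differentiableWithinAt
  · intro s hs t ht hst
    rw [(hd s (le_of_lt hs)).deriv, (hd t (le_of_lt ht)).deriv, neg_le_neg_iff]
    have hs0 := hT.trans hs
    have ht0 := hT.trans ht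
    have hts := snr_le_snr hα hs0 hst
    -- The larger signal-to-noise ratio belongs to the earlier time s, so hc is invoked at s.
    refine mul_le_mul_of_sub_le hα hM (snr_pos hα ht0) hts ?_ (hc s (le_of_lt hs))
    rw [← hMc]
    exact (mmse_sub b h4 c (snr_pos hα ht0) hts).2

/-- Substituting l = α / u and removing the factor n² α / u³ turns M l (l + α) (J + n l) ≤ n² (2 l +
α) into `threshold_inequality` with a = α M J / n² and b = α² M / n. Van Trees then replaces n² by
(J + n l) m. -/
lemma mul_snr_le {n : ℝ} (hn : 0 < n) {α M J m t : ℝ} (hα : 0 < α) (ht : 0 < t)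
    (hJ : 0 ≤ J) (hu : α * M * J / n ^ 2 +
      1 / 3 * (1 - α * M * J / n ^ 2 + α ^ 2 * M / n) ^ 2 ≤ Real.exp (2 * α * t) - 1)
    (hm : n ^ 2 ≤ (J + n * snr α t) * m) :
    M * (snr α t * (snr α t + α)) ≤ m * (2 * snr α t + α) := by
  have hl := snr_pos hα ht
  have h0 := exp_sub_one_pos hα ht
  have hlu : snr α t = α / (Real.exp (2 * α * t) - 1) := rfl
  set u := Real.exp (2 * α * t) - 1
  set l := snr α t
  have hp : 0 < J + n * l := by positivity
  have key := threshold_inequality hu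
  have e : M * (l * (l + α)) * (J + n * l) ≤ n ^ 2 * (2 * l + α) := by
    have e1 : M * (l * (l + α)) * (J + n * l)
        = (1 + u) * (α ^ 2 * M / n + α * M * J / n ^ 2 * u) * (n ^ 2 * α / u ^ 3) := by
      rw [hlu]; field_simp; ring
    have e2 : n ^ 2 * (2 * l + α) = u ^ 2 * (2 + u) * (n ^ 2 * α / u ^ 3) := by
      rw [hlu]; field_simp
    rw [e1, e2]
    gcongr
  refine le_of_mul_le_mul_right (e.trans ?_) hp
  calc n ^ 2 * (2 * l + α) ≤ (J + n * l) * m * (2 * l + α) := by gcongr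
    _ = m * (2 * l + α) * (J + n * l) := by ring

lemma integrable_norm_pow_four_of_lintegral {c : E} {M : ℝ≥0}
    (h : ∫⁻ x, ‖x - c‖ₑ ^ 4 ∂μ = M) :
    Integrable (fun x => ‖x‖ ^ 4) μ ∧ ∫ x, ‖x - c‖ ^ 4 ∂μ = M := by
  have e : ∀ x, ‖x - c‖ₑ ^ 4 = ENNReal.ofReal (‖x - c‖ ^ 4) := fun x => by
    rw [ENNReal.ofReal_pow (norm_nonneg _), ofReal_norm]
  simp only [e] at h
  have nn : 0 ≤ᵐ[μ] fun x => ‖x - c‖ ^ 4 := Eventually.of_forall fun x => by positivity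
  have hi : Integrable (fun x => ‖x - c‖ ^ 4) μ := by
    refine ⟨by fun_prop, ?_⟩
    rw [hasFiniteIntegral_iff_ofReal nn, h]
    exact ENNReal.coe_lt_top
  constructor
  · refine ((hi.add (integrable_const (‖c‖ ^ 4))).const_mul 8).mono' (by fun_prop)
      (Eventually.of_forall fun x => ?_)
    have := norm_add_pow_four_le c (x - c)
    rw [sub_add_cancel] at this
    rwa [Real.norm_eq_abs, abs_of_nonneg (by positivity)]
  · rw [integral_eq_lintegral_of_nonneg_ae nn (by fun_prop), h, ENNReal.coe_toReal]

/-- The Fisher information is an infimum over weak gradients. Working with J + ε and letting ε → 0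
avoids proving that it is attained. -/
lemma sq_card_le_mul_mmse_of_fisherInfo {ρ : E → ℝ} {ι : Type*} [Fintype ι] [Nonempty ι]
    (b : OrthonormalBasis ι ℝ E) (hm : Measurable ρ) (h0 : ∀ x, 0 ≤ ρ x) {J : ℝ≥0}
    (hJ : fisherInfo ρ = J)
    [IsProbabilityMeasure (volume.withDensity fun x => ENNReal.ofReal (ρ x))]
    (h4 : Integrable (fun x => ‖x‖ ^ 4) (volume.withDensity fun x => ENNReal.ofReal (ρ x)))
    {l : ℝ} (hl : 0 < l) :
    (Fintype.card ι : ℝ) ^ 2 ≤ (J + Fintype.card ι * l) *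
      mmse (volume.withDensity fun x => ENNReal.ofReal (ρ x)) b l := by
  have hε : ∀ ε : ℝ, 0 < ε → (Fintype.card ι : ℝ) ^ 2 ≤ (J + ε + Fintype.card ι * l) *
      mmse (volume.withDensity fun x => ENNReal.ofReal (ρ x)) b l := by
    intro ε hε
    have hlt : fisherInfo ρ < ENNReal.ofReal (J + ε) := by
      rw [hJ, ENNReal.ofReal_add J.coe_nonneg hε.le, ENNReal.ofReal_coe_nnreal]
      exact ENNReal.lt_add_right ENNReal.coe_ne_top (by simpa using hε)
    rw [fisherInfo, iInf_lt_iff] at hlt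
    obtain ⟨g, hg⟩ := hlt
    rw [iInf_lt_iff] at hg
    obtain ⟨hw, hg⟩ := hg
    exact sq_card_le_mul_mmse b hw hm h0 (by positivity) hg.le h4 hl
  set m := mmse (volume.withDensity fun x => ENNReal.ofReal (ρ x)) b l
  have hc : (0:ℝ) < Fintype.card ι := by exact_mod_cast Fintype.card_pos
  have hm0 : 0 < m := by
    have := (pow_pos hc 2).trans_le (hε 1 one_pos)
    exact pos_of_mul_pos_right this (by positivity)
  refine le_of_forall_pos_le_add fun δ hδ => (hε (δ / m) (by positivity)).trans_eq ?_
  field_simp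
  ring

end OrnsteinUhlenbeck

end GaussianChannel

/-! ### The threshold time and the conclusion -/

open GaussianChannel in
theorem theorem3 {n : ℕ} (hn : 0 < n) {Ω : Type*} [MeasurableSpace Ω]
    (P : Measure Ω) [IsProbabilityMeasure P] {α : ℝ} (hα : 0 < α)
    (X : ℝ → Ω → EuclideanSpace ℝ (Fin n)) (hX : IsOUProcess α X P)
    (ρ₀ : EuclideanSpace ℝ (Fin n) → ℝ) (hρ_meas : Measurable ρ₀) (hρ_nonneg : ∀ x, 0 ≤ ρ₀ x)
    (hX0 : HasLaw (X 0) (volume.withDensity (fun x => ENNReal.ofReal (ρ₀ x))) P)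
    (M J : ℝ≥0) (hM : fourthCentralMoment (X 0) P = M) (hJ : fisherInfo ρ₀ = J)
    (T : ℝ) (hT : T = 1 / (2 * α) * Real.log (1 + α * M * J / (n : ℝ) ^ 2 +
      1 / 3 * (1 - α * M * J / (n : ℝ) ^ 2 + α ^ 2 * M / n) ^ 2)) :
    (∀ t, T ≤ t → mutualInfo (X 0) (X t) P ≠ ∞) ∧
      ConvexOn ℝ (Ici T) (fun t => (mutualInfo (X 0) (X t) P).toReal) := by
  have : Nonempty (Fin n) := ⟨⟨0, hn⟩⟩
  have hn0 : (0:ℝ) < n := by exact_mod_cast hn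
  have hprob : IsProbabilityMeasure
      ((volume : Measure (EuclideanSpace ℝ (Fin n))).withDensity
        fun x => ENNReal.ofReal (ρ₀ x)) := by
    rw [← hX0.map_eq]
    exact Measure.isProbabilityMeasure_map hX0.aemeasurable
  set b := EuclideanSpace.basisFun (Fin n) ℝ
  have hM' : ∫⁻ x, ‖x - ∫ ω, X 0 ω ∂P‖ₑ ^ 4
      ∂(volume.withDensity fun x => ENNReal.ofReal (ρ₀ x)) = M := by
    rw [← hM, ← hX0.map_eq, lintegral_map' (by fun_prop) hX0.aemeasurable]
    rfl
  obtain ⟨h4, hMc⟩ := integrable_norm_pow_four_of_lintegral hM'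
  set u : ℝ := α * M * J / (n : ℝ) ^ 2 +
    1 / 3 * (1 - α * M * J / (n : ℝ) ^ 2 + α ^ 2 * M / n) ^ 2 with hu
  -- Strict positivity gives T > 0, which keeps t = 0 out of the interval. If α M J / n² = 0, the
  -- square alone is positive, its base being at least 1.
  have hu0 : 0 < u := by
    have ha : 0 ≤ α * M * J / (n : ℝ) ^ 2 := by positivity
    have hb : 0 ≤ α ^ 2 * M / (n : ℝ) := by positivity
    rcases ha.eq_or_lt with h | h
    · rw [hu, ← h]
      positivity
    · positivity
  rw [add_assoc, ← hu] at hT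
  have hT0 : 0 < T := by
    rw [hT]
    exact mul_pos (by positivity) (Real.log_pos (by linarith))
  have hexp : Real.exp (2 * α * T) = 1 + u := by
    rw [hT, show 2 * α * (1 / (2 * α) * Real.log (1 + u)) = Real.log (1 + u) by field_simp,
      Real.exp_log (by linarith)]
  have hI := fun t (ht : T ≤ t) => hX.mutualInfo_eq hα hX0 h4 (hT0.trans_le ht)
  refine ⟨fun t ht => (hI t ht).1, ?_⟩
  refine (convexOn_channelInfo_snr b h4 hα M.coe_nonneg hT0 hMc fun t ht => ?_).congr
    fun t ht => (hI t ht).2.symm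
  have ht0 := hT0.trans_le ht
  refine mul_snr_le hn0 hα ht0 J.coe_nonneg ?_ ?_
  · rw [← hu, le_sub_iff_add_le', ← hexp]
    gcongr
  · have := sq_card_le_mul_mmse_of_fisherInfo b hρ_meas hρ_nonneg hJ h4 (snr_pos hα ht0)
    rwa [Fintype.card_fin] at this
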